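/- **Syntax.** Fix a collection of ground types $\gamma$. Types are $A ::= \gamma \mid \bot \mid A\wp A\mid A\smallsetminus A$. There are countably many variables $x,y,z,\dots$ of each type, and each variable $x$ has an associated unary function $\mathtt x$. Terms are the m-terms $M ::= x\mid \mathtt x(M)\mid \mathtt{connect\ to}(R)\mid M\wp M\mid \mathtt{casel}(M)\mid\mathtt{caser}(M)\mid\mathtt{mkc}(M,\mathtt x)$ and the p-terms $P ::= \mathtt{postp}(y\mapsto N,M)\mid\mathtt{postp}(M)$, with $R ::= M\mid P$; $y$ is locally bound in $N$ in $\mathtt{postp}(y\mapsto N,M)$. A context $\kappa:\Gamma$ consists of a multiset of p-terms (written first below) and a sequence of m-terms $M_1:A_1,\dots,M_n:A_n$, with $\Gamma=A_1,\dots,A_n$. Terms in context $x:D\triangleright\kappa:\Gamma$ are generated by the following rules, in which distinct premises have no name (variable or function) in common: * axiom: $x:A\triangleright x:A$; exchange of neighbouring m-terms; * cut: from $z:D\triangleright\kappa:\Gamma,M:A$ and $x:A\triangleright\zeta:\Delta$ infer $z:D\triangleright\kappa:\Gamma,\zeta[x:=M]:\Delta$; * $\wp$I: from $x:D\triangleright\kappa:\Theta,M_0:A,M_1:B$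 infer $x:D\triangleright\kappa:\Theta,M_0\wp M_1:A\wp B$; * $\wp$E: from $z:D\triangleright\kappa:\Upsilon,N:A\wp B$, $x:A\triangleright\zeta:\Gamma$ and $y:B\triangleright\xi:\Delta$ infer $z:D\triangleright\kappa:\Upsilon,\ \zeta[x:=\mathtt{casel}(N)]:\Gamma,\ \xi[y:=\mathtt{caser}(N)]:\Delta$; * $\smallsetminus$I: from $x:D\triangleright\kappa:\Gamma,M:A$ and $y:B\triangleright\zeta:\Delta$ infer $x:D\triangleright\kappa:\Gamma,\ \zeta[y:=\mathtt y(M)]:\Delta,\ \mathtt{mkc}(M,\mathtt y):A\smallsetminus B$; * $\smallsetminus$E: from $x:D\triangleright\kappa:\Gamma,M:A\smallsetminus B$ and $y:A\triangleright\xi:\Delta,N:B$ infer $x:D\triangleright\mathtt{postp}(y\mapsto N,M),\ \kappa:\Gamma,\ \xi[y:=\mathtt y(M)]:\Delta$; * $\bot$I: from $x:D\triangleright\kappa:\Gamma$ and a term $R$ of $\kappa$ infer $x:D\triangleright\kappa:\Gamma,\mathtt{connect\ to}(R):\bot$; $\bot$E: $x:\bot\triangleright\mathtt{postp}(x)$.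 **Theory.** Equations in context $x:D\triangleright\kappa=\kappa':\Gamma$ are generated by reflexivity (on derivable terms in context), symmetry, transitivity, simultaneous exchange on both sides, renaming of bound names, the rule (Subst): from $z:D\triangleright(\kappa_0,M_0)=(\kappa_1,M_1):\Gamma,A$ and $x:A\triangleright\zeta_0=\zeta_1:\Delta$ infer $z:D\triangleright(\kappa_0,\zeta_0[x:=M_0])=(\kappa_1,\zeta_1[x:=M_1]):\Gamma,\Delta$ (for each $i$, no name common to $(z,\kappa_i,M_i)$ and $(x,\zeta_i)$), and the following equations, for derivable premises without common names: * ($\wp$-$\beta$) for $z:D\triangleright\kappa:\Theta,M_0:A,M_1:B$, $x:A\triangleright\zeta:\Gamma$, $y:B\triangleright\xi:\Delta$: $\ z:D\triangleright \kappa,\zeta[x:=\mathtt{casel}(M_0\wp M_1)],\xi[y:=\mathtt{caser}(M_0\wp M_1)]=\kappa,\zeta[x:=M_0],\xi[y:=M_1]\ :\Theta,\Gamma,\Delta$; * ($\wp$-$\eta$) for $z:D\triangleright\kappa:\Upsilon,M:A\wp B$: $\ z:D\triangleright\kappa,\ \mathtt{casel}(M)\wp\mathtt{caser}(M)=\kappa,\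 M\ :\Upsilon,A\wp B$; * ($\smallsetminus$-$\beta$) for $x:D\triangleright\kappa:\Gamma,M:A$, $y:B\triangleright\zeta:\Delta$, $z:A\triangleright\xi:\Lambda,L:B$: $\ x:D\triangleright\mathtt{postp}(z\mapsto L,\mathtt{mkc}(M,\mathtt y)),\kappa,\zeta[y:=\mathtt y(M)],\xi[z:=\mathtt z(\mathtt{mkc}(M,\mathtt y))]=\kappa,\zeta[y:=L[z:=M]],\xi[z:=M]\ :\Gamma,\Delta,\Lambda$; * ($\smallsetminus$-$\eta$) for $z:D\triangleright\kappa:\Delta,M:A\smallsetminus B$ and distinct fresh $x:A$, $y:B$: $\ z:D\triangleright\mathtt{postp}(x\mapsto\mathtt y(x),M),\kappa,\mathtt{mkc}(\mathtt x(M),\mathtt y)=\kappa,M\ :\Delta,A\smallsetminus B$; * (rewiring) for $x:D\triangleright\kappa:\Gamma$ and terms $R,R'$ of $\kappa$: $\ x:D\triangleright\kappa,\mathtt{connect\ to}(R)=\kappa,\mathtt{connect\ to}(R')\ :\Gamma,\bot$; the same equation holds if $R$ is not a term of $\kappa$, provided that $x:D\triangleright\kappa:\Gamma,\mathtt{connect\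 to}(R):\bot$ is derivable (the link was introduced at an earlier stage); * ($\bot$-$\beta$) for $x:D\triangleright\kappa:\Gamma$ and a term $R$ of $\kappa$: $\ x:D\triangleright\mathtt{postp}(\mathtt{connect\ to}(R)),\kappa=\kappa\ :\Gamma$; * ($\bot$-$\eta$) for $z:D\triangleright\kappa:\Gamma,M:\bot$: $\ z:D\triangleright\mathtt{postp}(M),\kappa,\mathtt{connect\ to}(\mathtt{postp}(M))=\kappa,M\ :\Gamma,\bot$. **Semantics.** Let $(\mathbb C,\bullet,1,\smallsetminus,\alpha,\lambda,\rho,\gamma)$ be a symmetric monoidal left-closed category, i.e. a symmetric monoidal category in which every functor $A\bullet-$ has a left adjoint $-\smallsetminus A$. A structure $\mathcal M$ in $\mathbb C$ assigns an object to every ground type; it extends to types by $[\![\bot]\!]=1$, $[\![A\wp B]\!]=[\![A]\!]\bullet[\![B]\!]$, $[\![A\smallsetminus B]\!]=[\![A]\!]\smallsetminus[\![B]\!]$, and to sequences $\Gamma$ by the left-associated tensor product ($1$ for the empty sequence). Each derivation of $x:D\triangleright\kappa:\Gamma$ is interpreted by a morphism $[\![D]\!]\to[\![\Gamma]\!]$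 by recursion (up to the canonical associativity and unit isomorphisms): the axiom is the identity, exchange is $\gamma$, and cut is composition along the cut formula; $\wp$I is the identity of $A\bullet B$, and $\wp$E composes $N$ with $[\![\zeta]\!]\bullet[\![\xi]\!]$; $\smallsetminus$I composes $M$ with the unit $A\to B\bullet(A\smallsetminus B)$ of the adjunction and then $B$ with $[\![\zeta]\!]$; $\smallsetminus$E composes $M$ with the transpose $A\smallsetminus B\to\Delta$ of $[\![\xi,N]\!]:A\to\Delta\bullet B$; $\bot$I is $\rho^{-1}$ and $\bot$E is the identity of $1$. **Theorem (soundness).** Let $\mathcal M$ be a structure in a symmetric monoidal left-closed category. Then $\mathcal M$ satisfies every equation $x:D\triangleright\kappa=\kappa':\Gamma$ of the theory: both sides are derivable, and there is a single morphism $[\![D]\!]\to[\![\Gamma]\!]$ that interprets every derivation of the left-hand side and every derivation of the right-hand side. In particular, the interpretation of a term in context does not depend on its derivation. -/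

import Mathlib

open CategoryTheory MonoidalCategory

namespace CoILL

/-! ### Formulas, variables, terms -/

/-- Formulas of multiplicative co-intuitionistic linear logic over a collection `G` of
ground types: `A ::= γ | ⊥ | A ⅋ A | A ∖ A`. -/
inductive Ty (G : Type*) where
  | ground (g : G) : Ty G
  | bot : Ty G
  | par (A B : Ty G) : Ty G
  | sub (A B : Ty G) : Ty G

/-- Variables, countably many of each type.  The same names serve for the free variables
`x, y, z, …` and for the associated unary functions `𝚡, 𝚢, 𝚣, …`. -/
structure Var (G : Type*) where
  id : ℕ
  ty : Ty G

/-- Raw terms `R` of the multiplicative dual linear calculus.  The constructors `postp₂` and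
`postp` build p-terms, all the others build m-terms; the typing rules keep the two sorts apart. -/
inductive Tm (G : Type*) where
  /-- a free variable `x` -/
  | var (x : Var G) : Tm G
  /-- `𝚡(M)` -/
  | app (x : Var G) (M : Tm G) : Tm G
  /-- `connect to(R)` -/
  | connect (R : Tm G) : Tm G
  /-- `M ⅋ N` -/
  | par (M N : Tm G) : Tm G
  /-- `casel(M)` -/
  | casel (M : Tm G) : Tm G
  /-- `caser(M)` -/
  | caser (M : Tm G) : Tm G
  /-- `mkc(M, 𝚡)` (make-coroutine) -/
  | mkc (M : Tm G) (x : Var G) : Tm G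
  /-- `postp(y ↦ N, M)` (binary postpone); the variable `y` is locally bound in `N` -/
  | postp₂ (y : Var G) (N M : Tm G) : Tm G
  /-- `postp(M)` (unary postpone) -/
  | postp (M : Tm G) : Tm G

open Classical in
/-- `Tm.subst x M t` is the substitution `t[x := M]` of `M` for the free variable `x` in `t`. -/
noncomputable def Tm.subst {G : Type*} (x : Var G) (M : Tm G) : Tm G → Tm G
  | .var y => if y = x then M else .var y
  | .app y N => .app y (Tm.subst x M N)
  | .connect R => .connect (Tm.subst x M R)
  | .par N₀ N₁ => .par (Tm.subst x M N₀) (Tm.subst x M N₁)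
  | .casel N => .casel (Tm.subst x M N)
  | .caser N => .caser (Tm.subst x M N)
  | .mkc N y => .mkc (Tm.subst x M N) y
  | .postp₂ y N₁ N₀ => .postp₂ y (if y = x then N₁ else Tm.subst x M N₁) (Tm.subst x M N₀)
  | .postp N => .postp (Tm.subst x M N)

/-- All names (of variables, of unary functions, of binders) that occur in a term. -/
def Tm.names {G : Type*} : Tm G → Set (Var G)
  | .var y => {y}
  | .app y N => {y} ∪ N.names
  | .connect R => R.names
  | .par N₀ N₁ => N₀.names ∪ N₁.names
  | .casel N => N.names
  | .caser N => N.names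
  | .mkc N y => {y} ∪ N.names
  | .postp₂ y N₁ N₀ => {y} ∪ (N₁.names ∪ N₀.names)
  | .postp N => N.names

/-- A type-preserving bijective renaming, given by a permutation of the variables of each type. -/
def Var.rename {G : Type*} (π : Ty G → Equiv.Perm ℕ) (x : Var G) : Var G :=
  ⟨π x.ty x.id, x.ty⟩

/-- Simultaneous renaming of all the names in a term. -/
def Tm.rename {G : Type*} (π : Ty G → Equiv.Perm ℕ) : Tm G → Tm G
  | .var y => .var (y.rename π)
  | .app y N => .app (y.rename π) (N.rename π)
  | .connect R => .connect (R.rename π)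
  | .par N₀ N₁ => .par (N₀.rename π) (N₁.rename π)
  | .casel N => .casel (N.rename π)
  | .caser N => .caser (N.rename π)
  | .mkc N y => .mkc (N.rename π) (y.rename π)
  | .postp₂ y N₁ N₀ => .postp₂ (y.rename π) (N₁.rename π) (N₀.rename π)
  | .postp N => .postp (N.rename π)

/-! ### Contexts

Lists of terms and of types are written from right to left: the head of a list is its last
(rightmost) entry, so that `A :: Γ` is the sequence `Γ, A` and `Δ ++ Γ` is `Γ, Δ`. -/

/-- A context `κ = P̄ | M̄`: the p-terms of the control area (up to order), and the sequence of
m-terms to which the formulas of the succedent are assigned. -/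
@[ext]
structure Cx (G : Type*) where
  ctrl : Multiset (Tm G)
  terms : List (Tm G)

namespace Cx

variable {G : Type*}

/-- `κ, M` -/
def snoc (κ : Cx G) (M : Tm G) : Cx G := ⟨κ.ctrl, M :: κ.terms⟩

/-- `P, κ`: add a p-term to the control area. -/
def addP (P : Tm G) (κ : Cx G) : Cx G := ⟨P ::ₘ κ.ctrl, κ.terms⟩

/-- `κ, ζ` -/
def append (κ ζ : Cx G) : Cx G := ⟨κ.ctrl + ζ.ctrl, ζ.terms ++ κ.terms⟩

/-- `κ[x := M]` -/
noncomputable def subst (κ : Cx G) (x : Var G) (M : Tm G) : Cx G :=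
  ⟨κ.ctrl.map (Tm.subst x M), κ.terms.map (Tm.subst x M)⟩

/-- Renaming of all the names in a context. -/
def rename (π : Ty G → Equiv.Perm ℕ) (κ : Cx G) : Cx G :=
  ⟨κ.ctrl.map (Tm.rename π), κ.terms.map (Tm.rename π)⟩

/-- `R ∈ κ` -/
def Has (κ : Cx G) (R : Tm G) : Prop := R ∈ κ.ctrl ∨ R ∈ κ.terms

/-- All names that occur in `κ`. -/
def names (κ : Cx G) : Set (Var G) := {v | ∃ R, κ.Has R ∧ v ∈ R.names}

end Cx

/-- The variable convention: `x ▷ κ` and `y ▷ ζ` have no name in common. -/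
def Apart {G : Type*} (x : Var G) (κ : Cx G) (y : Var G) (ζ : Cx G) : Prop :=
  Disjoint ({x} ∪ κ.names) ({y} ∪ ζ.names)

/-- Exchange of the two neighbouring entries at the positions `n` and `n + 1` (counted from the
right end of the sequence, that is, from the head of the list). -/
def swapAt {α : Type*} : ℕ → List α → List α
  | 0, [] => []
  | 0, [a] => [a]
  | 0, a :: b :: l => b :: a :: l
  | _ + 1, [] => []
  | n + 1, a :: l => a :: swapAt n l

/-- Exchange in the list of m-terms of a context. -/
def Cx.swapAt {G : Type*} (n : ℕ) (κ : Cx G) : Cx G := ⟨κ.ctrl, CoILL.swapAt n κ.terms⟩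

/-! ### Typing -/

/-- `Deriv x κ Γ` is the type of derivations of the term in context `x : x.ty ▷ κ : Γ` in the
decorated natural deduction system of multiplicative co-intuitionistic linear logic. -/
inductive Deriv {G : Type*} : Var G → Cx G → List (Ty G) → Type _ where
  /-- `x : A ▷ x : A` -/
  | ax (x : Var G) : Deriv x ⟨0, [.var x]⟩ [x.ty]
  /-- exchange -/
  | exch {x : Var G} {κ : Cx G} {Γ : List (Ty G)} (n : ℕ) :
      Deriv x κ Γ → Deriv x (κ.swapAt n) (swapAt n Γ)
  /-- cut (substitution) -/
  | cut {z x : Var G} {κ ζ : Cx G} {M : Tm G} {Γ Δ : List (Ty G)} :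
      Deriv z (κ.snoc M) (x.ty :: Γ) → Deriv x ζ Δ →
      Apart z (κ.snoc M) x ζ →
      Deriv z (κ.append (ζ.subst x M)) (Δ ++ Γ)
  /-- `⅋`-introduction -/
  | parI {x : Var G} {κ : Cx G} {M₀ M₁ : Tm G} {A B : Ty G} {Θ : List (Ty G)} :
      Deriv x ((κ.snoc M₀).snoc M₁) (B :: A :: Θ) →
      Deriv x (κ.snoc (.par M₀ M₁)) (.par A B :: Θ)
  /-- `⅋`-elimination -/
  | parE {z x y : Var G} {κ ζ ξ : Cx G} {N : Tm G} {Υ Γ Δ : List (Ty G)} :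
      Deriv z (κ.snoc N) (.par x.ty y.ty :: Υ) → Deriv x ζ Γ → Deriv y ξ Δ →
      Apart z (κ.snoc N) x ζ → Apart z (κ.snoc N) y ξ → Apart x ζ y ξ →
      Deriv z ((κ.append (ζ.subst x (.casel N))).append (ξ.subst y (.caser N))) (Δ ++ (Γ ++ Υ))
  /-- `∖`-introduction -/
  | subI {x y : Var G} {κ ζ : Cx G} {M : Tm G} {A : Ty G} {Γ Δ : List (Ty G)} :
      Deriv x (κ.snoc M) (A :: Γ) → Deriv y ζ Δ →
      Apart x (κ.snoc M) y ζ →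
      Deriv x ((κ.append (ζ.subst y (.app y M))).snoc (.mkc M y)) (.sub A y.ty :: (Δ ++ Γ))
  /-- `∖`-elimination -/
  | subE {x y : Var G} {κ ξ : Cx G} {M N : Tm G} {B : Ty G} {Γ Δ : List (Ty G)} :
      Deriv x (κ.snoc M) (.sub y.ty B :: Γ) → Deriv y (ξ.snoc N) (B :: Δ) →
      Apart x (κ.snoc M) y (ξ.snoc N) →
      Deriv x ((κ.append (ξ.subst y (.app y M))).addP (.postp₂ y N M)) (Δ ++ Γ)
  /-- `⊥`-introduction -/
  | botI {x : Var G} {κ : Cx G} {R : Tm G} {Γ : List (Ty G)} :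
      Deriv x κ Γ → κ.Has R → Deriv x (κ.snoc (.connect R)) (.bot :: Γ)
  /-- `⊥`-elimination -/
  | botE (n : ℕ) : Deriv ⟨n, .bot⟩ ⟨{.postp (.var ⟨n, .bot⟩)}, []⟩ []

/-! ### The equational theory -/

/-- `EqCx x κ κ' Γ` : the equation in context `x : x.ty ▷ κ = κ' : Γ` belongs to the theory
generated by the basic equations and by the `β` and `η` equations for `⅋`, `∖` and `⊥`. -/
inductive EqCx {G : Type*} : Var G → Cx G → Cx G → List (Ty G) → Prop where
  | refl {z : Var G} {κ : Cx G} {Γ : List (Ty G)} : Deriv z κ Γ → EqCx z κ κ Γ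
  | symm {z : Var G} {κ κ' : Cx G} {Γ : List (Ty G)} : EqCx z κ κ' Γ → EqCx z κ' κ Γ
  | trans {z : Var G} {κ₀ κ₁ κ₂ : Cx G} {Γ : List (Ty G)} :
      EqCx z κ₀ κ₁ Γ → EqCx z κ₁ κ₂ Γ → EqCx z κ₀ κ₂ Γ
  | subst {z x : Var G} {κ₀ κ₁ ζ₀ ζ₁ : Cx G} {M₀ M₁ : Tm G} {Γ Δ : List (Ty G)} :
      EqCx z (κ₀.snoc M₀) (κ₁.snoc M₁) (x.ty :: Γ) → EqCx x ζ₀ ζ₁ Δ →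
      Apart z (κ₀.snoc M₀) x ζ₀ → Apart z (κ₁.snoc M₁) x ζ₁ →
      EqCx z (κ₀.append (ζ₀.subst x M₀)) (κ₁.append (ζ₁.subst x M₁)) (Δ ++ Γ)
  /-- simultaneous exchange on both sides (exchange is implicit in the calculus) -/
  | exch {x : Var G} {κ κ' : Cx G} {Γ : List (Ty G)} (n : ℕ) :
      EqCx x κ κ' Γ → EqCx x (κ.swapAt n) (κ'.swapAt n) (swapAt n Γ)
  /-- renaming of bound names (terms are taken up to `α`-equivalence) -/
  | alpha {x : Var G} {κ : Cx G} {Γ : List (Ty G)} (π : Ty G → Equiv.Perm ℕ) :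
      Deriv x κ Γ → x.rename π = x → EqCx x κ (κ.rename π) Γ
  /-- the `⅋-β` rules -/
  | par_beta {z x y : Var G} {κ ζ ξ : Cx G} {M₀ M₁ : Tm G} {Θ Γ Δ : List (Ty G)} :
      Deriv z ((κ.snoc M₀).snoc M₁) (y.ty :: x.ty :: Θ) → Deriv x ζ Γ → Deriv y ξ Δ →
      Apart z ((κ.snoc M₀).snoc M₁) x ζ → Apart z ((κ.snoc M₀).snoc M₁) y ξ → Apart x ζ y ξ →
      EqCx z
        ((κ.append (ζ.subst x (.casel (.par M₀ M₁)))).append (ξ.subst y (.caser (.par M₀ M₁))))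
        ((κ.append (ζ.subst x M₀)).append (ξ.subst y M₁))
        (Δ ++ (Γ ++ Θ))
  /-- the `⅋-η` rule -/
  | par_eta {z : Var G} {κ : Cx G} {M : Tm G} {A B : Ty G} {Υ : List (Ty G)} :
      Deriv z (κ.snoc M) (.par A B :: Υ) →
      EqCx z (κ.snoc (.par (.casel M) (.caser M))) (κ.snoc M) (.par A B :: Υ)
  /-- the `∖-β` rule, for `x : D ▷ κ : Γ, M : A`, `y : B ▷ ζ : Δ` and `z : A ▷ ξ : Λ, L : B` -/
  | sub_beta {x y z : Var G} {κ ζ ξ : Cx G} {M L : Tm G} {Γ Δ Λ : List (Ty G)} :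
      Deriv x (κ.snoc M) (z.ty :: Γ) → Deriv y ζ Δ → Deriv z (ξ.snoc L) (y.ty :: Λ) →
      Apart x (κ.snoc M) y ζ → Apart x (κ.snoc M) z (ξ.snoc L) → Apart y ζ z (ξ.snoc L) →
      EqCx x
        (((κ.append (ζ.subst y (.app y M))).append
          (ξ.subst z (.app z (.mkc M y)))).addP (.postp₂ z L (.mkc M y)))
        ((κ.append (ζ.subst y (Tm.subst z M L))).append (ξ.subst z M))
        (Λ ++ (Δ ++ Γ))
  /-- the `∖-η` rule -/
  | sub_eta {z x y : Var G} {κ : Cx G} {M : Tm G} {Δ : List (Ty G)} :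
      Deriv z (κ.snoc M) (.sub x.ty y.ty :: Δ) → x ≠ y →
      x ∉ {z} ∪ (κ.snoc M).names → y ∉ {z} ∪ (κ.snoc M).names →
      EqCx z ((κ.snoc (.mkc (.app x M) y)).addP (.postp₂ x (.app y (.var x)) M)) (κ.snoc M)
        (.sub x.ty y.ty :: Δ)
  /-- rewiring within a context -/
  | rewire {x : Var G} {κ : Cx G} {R R' : Tm G} {Γ : List (Ty G)} :
      Deriv x κ Γ → κ.Has R → κ.Has R' →
      EqCx x (κ.snoc (.connect R)) (κ.snoc (.connect R')) (.bot :: Γ)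
  /-- rewiring of a link `connect to(R)` that was introduced at an earlier stage of the
  derivation, where `R` need no longer be a term of the present context -/
  | rewire_late {y : Var G} {ζ : Cx G} {R R' : Tm G} {Γ : List (Ty G)} :
      Deriv y (ζ.snoc (.connect R)) (.bot :: Γ) → Deriv y ζ Γ → ζ.Has R' →
      EqCx y (ζ.snoc (.connect R)) (ζ.snoc (.connect R')) (.bot :: Γ)
  /-- the `⊥-β` rule -/
  | bot_beta {x : Var G} {κ : Cx G} {R : Tm G} {Γ : List (Ty G)} :
      Deriv x κ Γ → κ.Has R → EqCx x (κ.addP (.postp (.connect R))) κ Γ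
  /-- the `⊥-η` rule -/
  | bot_eta {z : Var G} {κ : Cx G} {M : Tm G} {Γ : List (Ty G)} :
      Deriv z (κ.snoc M) (.bot :: Γ) →
      EqCx z ((κ.snoc (.connect (.postp M))).addP (.postp M)) (κ.snoc M) (.bot :: Γ)

/-! ### Interpretation -/

/-- A monoidal category is left closed if every functor `A ⊗ -` has a left adjoint `- ∖ A`. -/
class LeftClosed (C : Type*) [Category C] [MonoidalCategory C] where
  /-- `coexp A` is the functor `- ∖ A`. -/
  coexp : C → C ⥤ C
  /-- `- ∖ A` is left adjoint to `A ⊗ -`. -/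
  adj : ∀ A : C, coexp A ⊣ tensorLeft A

/-- A structure for the signature in `C` assigns an object to every ground type; `⊥`, `⅋` and `∖`
and the term formers are interpreted by the symmetric monoidal left-closed structure of `C`. -/
structure Structure (G : Type*) (C : Type*) where
  obj : G → C

namespace Structure

variable {G : Type*} {C : Type*} [Category C] [MonoidalCategory C] [SymmetricCategory C]
  [LeftClosed C]

/-- The operation `f ↦ POSTP(f)`: the transpose `A ∖ B ⟶ X` of `f : A ⟶ X ⊗ B`. -/
def postpHom {A B X : C} (f : A ⟶ X ⊗ B) : (LeftClosed.coexp B).obj A ⟶ X :=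
  ((LeftClosed.adj B).homEquiv A X).symm (f ≫ (β_ X B).hom)

/-- The map `MKC : A ⟶ B ⊗ (A ∖ B)`, the unit of the adjunction. -/
def mkcHom (A B : C) : A ⟶ B ⊗ (LeftClosed.coexp B).obj A :=
  (LeftClosed.adj B).unit.app A

variable (S : Structure G C)

/-- The object `⟦A⟧`. -/
def ty : Ty G → C
  | .ground g => S.obj g
  | .bot => 𝟙_ C
  | .par A B => ty A ⊗ ty B
  | .sub A B => (LeftClosed.coexp (ty B)).obj (ty A)

/-- The object `⟦Γ⟧`, associated to the left; the empty sequence is interpreted by the unit. -/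
def ctx : List (Ty G) → C
  | [] => 𝟙_ C
  | A :: Γ => ctx Γ ⊗ S.ty A

/-- `Join(Γ, Δ) : ⟦Γ⟧ ⊗ ⟦Δ⟧ ⟶ ⟦Γ, Δ⟧` -/
def join (Γ : List (Ty G)) : ∀ Δ : List (Ty G), S.ctx Γ ⊗ S.ctx Δ ⟶ S.ctx (Δ ++ Γ)
  | [] => (ρ_ (S.ctx Γ)).hom
  | A :: Δ => (α_ (S.ctx Γ) (S.ctx Δ) (S.ty A)).inv ≫ (join Γ Δ ▷ S.ty A)

/-- The interpretation of exchange by the symmetry. -/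
def swapHom : ∀ (n : ℕ) (Γ : List (Ty G)), S.ctx Γ ⟶ S.ctx (swapAt n Γ)
  | 0, [] => 𝟙 _
  | 0, [_] => 𝟙 _
  | 0, B :: A :: Γ =>
      (α_ (S.ctx Γ) (S.ty A) (S.ty B)).hom ≫ (S.ctx Γ ◁ (β_ (S.ty A) (S.ty B)).hom) ≫
        (α_ (S.ctx Γ) (S.ty B) (S.ty A)).inv
  | _ + 1, [] => 𝟙 _
  | n + 1, A :: Γ => swapHom n Γ ▷ S.ty A

/-- The morphism `⟦D⟧ ⟶ ⟦Γ⟧` assigned to a derivation of `x : D ▷ κ : Γ`. -/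
def interp {x : Var G} {κ : Cx G} {Γ : List (Ty G)} : Deriv x κ Γ → (S.ty x.ty ⟶ S.ctx Γ)
  | .ax x => (λ_ (S.ty x.ty)).inv
  | .exch (Γ := Γ) n d => interp d ≫ S.swapHom n Γ
  | .cut (Γ := Γ) (Δ := Δ) d e _ => interp d ≫ (S.ctx Γ ◁ interp e) ≫ S.join Γ Δ
  | .parI (A := A) (B := B) (Θ := Θ) d =>
      interp d ≫ (α_ (S.ctx Θ) (S.ty A) (S.ty B)).hom
  | .parE (Υ := Υ) (Γ := Γ) (Δ := Δ) d e f _ _ _ =>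
      interp d ≫ (S.ctx Υ ◁ (interp e ⊗ₘ interp f)) ≫
        (α_ (S.ctx Υ) (S.ctx Γ) (S.ctx Δ)).inv ≫ (S.join Υ Γ ▷ S.ctx Δ) ≫ S.join (Γ ++ Υ) Δ
  | .subI (y := y) (A := A) (Γ := Γ) (Δ := Δ) d e _ =>
      interp d ≫ (S.ctx Γ ◁ mkcHom (S.ty A) (S.ty y.ty)) ≫
        (S.ctx Γ ◁ (interp e ▷ S.ty (.sub A y.ty))) ≫
        (α_ (S.ctx Γ) (S.ctx Δ) (S.ty (.sub A y.ty))).inv ≫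
        (S.join Γ Δ ▷ S.ty (.sub A y.ty))
  | .subE (Γ := Γ) (Δ := Δ) d e _ =>
      interp d ≫ (S.ctx Γ ◁ postpHom (interp e)) ≫ S.join Γ Δ
  | .botI (Γ := Γ) d _ => interp d ≫ (ρ_ (S.ctx Γ)).inv
  | .botE _ => 𝟙 (𝟙_ C)

/-- The structure assigns the morphism `f` to the term in context `x : x.ty ▷ κ : Γ`: it is
derivable, and each of its derivations is interpreted by `f`. -/
def Denotes (x : Var G) (κ : Cx G) (Γ : List (Ty G)) (f : S.ty x.ty ⟶ S.ctx Γ) : Prop :=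
  Nonempty (Deriv x κ Γ) ∧ ∀ d : Deriv x κ Γ, S.interp d = f

/-- The structure satisfies the equation in context `x : x.ty ▷ κ = κ' : Γ`: the morphisms
assigned to its two sides are equal. -/
def Satisfies (x : Var G) (κ κ' : Cx G) (Γ : List (Ty G)) : Prop :=
  ∃ f : S.ty x.ty ⟶ S.ctx Γ, S.Denotes x κ Γ f ∧ S.Denotes x κ' Γ f

end Structure

end CoILL

-- The heart of the matter is coherence: a term in context has many derivations, and transitivity of
-- equations is sound only if all of them are interpreted by one morphism. Granted this, each
-- generating equation is settled by exhibiting one derivation of either side and comparing two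
-- morphisms. For `⅋` and `⊥` this is monoidal bookkeeping, for `∖` it rests on the triangle
-- identities of the adjunction, and renaming leaves the interpretation unchanged because it
-- preserves types.
--
-- Coherence is obtained by reading a derivation as a run of a concurrent process. A state is a list
-- of labelled wires and of boxes, where a box holds the unfinished state of the second premise of a
-- `∖`-elimination; every state denotes an object. Exchange and `⊥`-introduction become structural
-- morphisms. The other steps are events: splitting and joining a `⅋`, making a coroutine, removing
-- a `⊥`, opening a box and closing it. Events may take place inside boxes. If all labels are
-- distinct, structural morphisms between two given states are unique (`WireSig.Str.unique`), two
-- steps for the same event agree (`Net.Fire.agree`), and steps for independent events commute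
-- (`Net.Fire.diamond`). Hence any two runs with the same events can be rearranged into each other,
-- and the morphism of a run depends only on its end states and its multiset of events
-- (`Net.Run.unique`).
--
-- Every derivation is simulated by a run (`Structure.simulates`). Its events can be read off from
-- its terms (`Structure.mem_events`), and its labels are distinct because its function names are
-- (`Structure.fns_nodup`, `Structure.labs_nodup`). So two derivations of one term give runs with
-- the same data, and their interpretations agree (`Structure.interp_comp_eq`,
-- `Structure.coherence`).
--
-- Two devices deal with `⊥`. A wire made from links only, of a type built from `⊥` by `⅋`, is
-- trivial: its object is isomorphic to the unit, and it is inserted and deleted structurally, so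
-- that rewiring is a structural morphism. But a gate fed only by trivial wires consumes nothing
-- that tells in which box it takes place. Therefore locations are marked by tokens, labelled wires
-- with the unit as object, and such a gate must find the token of its head name next to it.

namespace CoILL

universe u

set_option linter.unusedSectionVars false

/-! ### States: lists of wires and boxes -/

/-- An entry of a state: a wire, or a box that contains a state. -/
inductive Item (Λ β : Type u) : Type u where
  | wire (l : Λ) : Item Λ β
  | box (b : β) (L : List (Item Λ β)) : Item Λ β

/-- Objects assigned to wires and boxes; trivial wires carry an isomorphism with the unit. -/
structure WireSig (C : Type*) [Category C] [MonoidalCategory C] where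
  Wire : Type u
  Box : Type u
  ob : Wire → C
  boxOb : Box → C
  Triv : Wire → Prop
  unitIso : ∀ l, Triv l → (ob l ≅ 𝟙_ C)

namespace WireSig

section Labels

variable {C : Type*} [Category C] [MonoidalCategory C] {W : WireSig.{u} C}

/-- A state is a list of items. -/
abbrev St (W : WireSig.{u} C) : Type u := List (Item W.Wire W.Box)

/-! ### Labels -/

/-- The keys of wires and boxes. -/
abbrev Key (W : WireSig.{u} C) : Type u := W.Wire ⊕ W.Box

open Classical in
/-- The key of an item, if it is not a trivial wire. -/
noncomputable def key : Item W.Wire W.Box → Multiset W.Key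
  | .wire l => if W.Triv l then 0 else {.inl l}
  | .box b _ => {.inr b}

mutual
/-- The keys inside an item. -/
noncomputable def inner : Item W.Wire W.Box → Multiset W.Key
  | .wire _ => 0
  | .box _ L => labs L
/-- All keys of a state, at any depth. -/
noncomputable def labs : List (Item W.Wire W.Box) → Multiset W.Key
  | [] => 0
  | i :: L => (key i + inner i) + labs L
end

/-- The keys at the top level of a state. -/
noncomputable def tops (L : W.St) : Multiset W.Key := (L.map key).sum

/-- The keys of a state that are not at the top level. -/
noncomputable def inners (L : W.St) : Multiset W.Key := (L.map inner).sum

@[simp] theorem tops_nil : tops ([] : W.St) = 0 := rfl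
@[simp] theorem tops_cons (i) (L : W.St) : tops (i :: L) = key i + tops L := by simp [tops]
@[simp] theorem inners_nil : inners ([] : W.St) = 0 := rfl
@[simp] theorem inners_cons (i) (L : W.St) : inners (i :: L) = inner i + inners L := by
  simp [inners]
@[simp] theorem labs_nil : labs ([] : W.St) = 0 := by simp [labs]
@[simp] theorem labs_cons (i) (L : W.St) : labs (i :: L) = (key i + inner i) + labs L := by
  simp [labs]
@[simp] theorem inner_wire (l) : inner (W := W) (.wire l) = 0 := by simp [inner]
@[simp] theorem inner_box (b) (L : W.St) : inner (.box b L) = labs L := by simp [inner]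
@[simp] theorem key_box (b) (L : W.St) : key (.box b L) = {.inr b} := rfl
theorem key_wire {l} (h : ¬ W.Triv l) : key (W := W) (.wire l) = {.inl l} := by simp [key, h]
theorem key_triv {l} (h : W.Triv l) : key (W := W) (.wire l) = 0 := by simp [key, h]

theorem labs_eq (L : W.St) : labs L = tops L + inners L := by
  induction L with
  | nil => simp
  | cons i L ih => simp only [labs_cons, ih, tops_cons, inners_cons]; abel

end Labels

end WireSig

/-- Exchange of the last two factors. -/
def sw {C : Type*} [Category C] [MonoidalCategory C] [SymmetricCategory C] (X A B : C) :
    (X ⊗ A) ⊗ B ⟶ (X ⊗ B) ⊗ A :=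
  (α_ X A B).hom ≫ X ◁ (β_ A B).hom ≫ (α_ X B A).inv

-- Exchange of two tensor factors

section sw

variable {C : Type*} [Category C] [MonoidalCategory C] [SymmetricCategory C]

@[simp]
theorem sw_sw (X A B : C) : sw X A B ≫ sw X B A = 𝟙 _ := by
  simp [sw, ← MonoidalCategory.whiskerLeft_comp_assoc]

@[simp]
theorem sw_sw_assoc (X A B : C) {Z : C} (h : (X ⊗ A) ⊗ B ⟶ Z) : sw X A B ≫ sw X B A ≫ h = h := by
  rw [← Category.assoc, sw_sw, Category.id_comp]

theorem sw_naturality {X X' A A' B B' : C} (f : X ⟶ X') (g : A ⟶ A') (h : B ⟶ B') :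
    ((f ⊗ₘ g) ⊗ₘ h) ≫ sw X' A' B' = sw X A B ≫ ((f ⊗ₘ h) ⊗ₘ g) := by
  simp only [sw, Category.assoc, associator_naturality_assoc, ← associator_inv_naturality]
  rw [← id_tensorHom, ← id_tensorHom, tensorHom_comp_tensorHom_assoc,
    tensorHom_comp_tensorHom_assoc, BraidedCategory.braiding_naturality, Category.id_comp,
    Category.comp_id]

/-- This is the Yang-Baxter equation of the braiding, whiskered by `X`; it makes the extraction of
an item commute with a swap of two other items. -/
theorem sw_yang_baxter (X A B D : C) :
    sw X A B ▷ D ≫ sw (X ⊗ B) A D ≫ sw X B D ▷ A =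
      sw (X ⊗ A) B D ≫ sw X A D ▷ B ≫ sw (X ⊗ D) A B := by
  have h := BraidedCategory.yang_baxter A B D
  calc _ = (α_ _ _ _).hom ≫ (α_ _ _ _).hom ≫ X ◁ ((α_ A B D).inv ≫
      (β_ A B).hom ▷ D ≫ (α_ B A D).hom ≫
      B ◁ (β_ A D).hom ≫ (α_ B D A).inv ≫ (β_ B D).hom ▷ A ≫ (α_ D B A).hom) ≫ (α_ _ _ _).inv ≫ (α_ _ _ _).inv := by
        simp only [sw]; monoidal
    _ = _ := by
        rw [h]; simp only [sw]; monoidal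

/-- Naturality moves the braiding to two copies of the unit, where it is trivial because the two
unitors agree. So the order in which two unit-like factors are removed is immaterial. -/
theorem kill_sw {X A B : C} (a : A ≅ 𝟙_ C) (b : B ≅ 𝟙_ C) :
    sw X A B ≫ (X ⊗ B) ◁ a.hom ≫ (ρ_ _).hom ≫ X ◁ b.hom = 
     (X ⊗ A) ◁ b.hom ≫ (ρ_ _).hom ≫ X ◁ a.hom := by
  have h : (β_ A B).hom ≫ (B ◁ a.hom) ≫ (ρ_ _).hom ≫ b.hom = A ◁ b.hom ≫ (ρ_ _).hom ≫ a.hom := by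
    have : (β_ A B).hom ≫ (b.hom ⊗ₘ a.hom) = (a.hom ⊗ₘ b.hom) := by
      rw [← BraidedCategory.braiding_naturality]; simp [← unitors_equal]
    have e : (B ◁ a.hom) ≫ (ρ_ _).hom ≫ b.hom = (b.hom ⊗ₘ a.hom) ≫ (λ_ _).hom := by
      rw [tensorHom_def', unitors_equal]; simp
    rw [e, ← Category.assoc, this, tensorHom_def']; simp [unitors_equal]
  calc _ = (α_ _ _ _).hom ≫ X ◁ ((β_ A B).hom ≫ (B ◁ a.hom) ≫ (ρ_ _).hom ≫ b.hom) := by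
        simp only [sw]; monoidal
    _ = _ := by rw [h]; monoidal

theorem ins_sw (X A : C) {B : C} (u : 𝟙_ C ⟶ B) :
    (ρ_ (X ⊗ A)).inv ≫ (X ⊗ A) ◁ u ≫ sw X A B = ((ρ_ X).inv ≫ X ◁ u) ▷ A := by
  have h : (ρ_ A).inv ≫ A ◁ u ≫ (β_ A B).hom = (λ_ A).inv ≫ u ▷ A := by
    rw [BraidedCategory.braiding_naturality_right]; simp
  calc _ = X ◁ ((ρ_ A).inv ≫ A ◁ u ≫ (β_ A B).hom) ≫ (α_ _ _ _).inv := by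
        simp only [sw]; monoidal
    _ = _ := by rw [h]; monoidal

theorem sw_del (X A : C) {B : C} (d : B ⟶ 𝟙_ C) :
    sw X A B ≫ (X ◁ d ≫ (ρ_ X).hom) ▷ A = (X ⊗ A) ◁ d ≫ (ρ_ (X ⊗ A)).hom := by
  have h : (β_ A B).hom ≫ d ▷ A ≫ (λ_ A).hom = A ◁ d ≫ (ρ_ A).hom := by
    rw [← BraidedCategory.braiding_naturality_right_assoc]; simp
  calc _ = (α_ _ _ _).hom ≫ X ◁ ((β_ A B).hom ≫ d ▷ A ≫ (λ_ A).hom) := by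
        simp only [sw]; monoidal
    _ = _ := by rw [h]; monoidal

end sw

namespace WireSig

variable {C : Type*} [Category C] [MonoidalCategory C] [SymmetricCategory C] [LeftClosed C]

variable (W : WireSig.{u} C)

mutual
/-- The object of an item. -/
@[reducible]
def obj : Item W.Wire W.Box → C
  | .wire l => W.ob l
  | .box b L => (LeftClosed.coexp (W.boxOb b)).obj (ctx L)
/-- The object of a state. -/
@[reducible]
def ctx : List (Item W.Wire W.Box) → C
  | [] => 𝟙_ C
  | i :: L => ctx L ⊗ obj i
end

/-- Structural morphisms between states. -/
inductive Str : ∀ L L' : W.St, (W.ctx L ⟶ W.ctx L') → Prop where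
  | refl (L) : Str L L (𝟙 _)
  | trans {L L' L'' f g} : Str L L' f → Str L' L'' g → Str L L'' (f ≫ g)
  | swap (i j L) : Str (i :: j :: L) (j :: i :: L) (sw (W.ctx L) (W.obj j) (W.obj i))
  | cons (i) {L L' f} : Str L L' f → Str (i :: L) (i :: L') (f ▷ W.obj i)
  | box (b L) {T T' f} : Str T T' f → Str (.box b T :: L) (.box b T' :: L)
      (W.ctx L ◁ (LeftClosed.coexp (W.boxOb b)).map f)
  | ins (L l) (h : W.Triv l) : Str L (.wire l :: L)
      ((ρ_ _).inv ≫ W.ctx L ◁ (W.unitIso l h).inv)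
  | del (L l) (h : W.Triv l) : Str (.wire l :: L) L
      (W.ctx L ◁ (W.unitIso l h).hom ≫ (ρ_ _).hom)

variable {W}

/-- Every generator has an inverse among the generators: swaps undo swaps, and `ins` and `del` undo
each other. -/
theorem Str.symm {L L' : W.St} {f} (h : W.Str L L' f) :
    ∃ g, W.Str L' L g ∧ f ≫ g = 𝟙 _ ∧ g ≫ f = 𝟙 _ := by
  induction h with
  | refl L => exact ⟨_, .refl L, by simp, by simp⟩
  | trans _ _ ih ih' =>
    obtain ⟨g, hg, h1, h2⟩ := ih
    obtain ⟨g', hg', h1', h2'⟩ := ih'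
    refine ⟨_, hg'.trans hg, ?_, ?_⟩
    · rw [Category.assoc, reassoc_of% h1', h1]
    · rw [Category.assoc, reassoc_of% h2, h2']
  | swap i j L => exact ⟨_, .swap j i L, sw_sw _ _ _, sw_sw _ _ _⟩
  | cons i _ ih =>
    obtain ⟨g, hg, h1, h2⟩ := ih
    exact ⟨_, .cons i hg, by rw [← comp_whiskerRight, h1]; simp,
      by rw [← comp_whiskerRight, h2]; simp⟩
  | box b L _ ih =>
    obtain ⟨g, hg, h1, h2⟩ := ih
    exact ⟨_, .box b L hg, by
      rw [← MonoidalCategory.whiskerLeft_comp, ← Functor.map_comp, h1]; simp, by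
      rw [← MonoidalCategory.whiskerLeft_comp, ← Functor.map_comp, h2]; simp⟩
  | ins L l h =>
    refine ⟨_, .del L l h, ?_, ?_⟩
    · simp [← MonoidalCategory.whiskerLeft_comp_assoc]
    · simp [← MonoidalCategory.whiskerLeft_comp]
  | del L l h =>
    refine ⟨_, .ins L l h, ?_, ?_⟩
    · simp [← MonoidalCategory.whiskerLeft_comp]
    · simp [← MonoidalCategory.whiskerLeft_comp_assoc]

/-- The morphism from a state of trivial wires to the unit. -/
inductive Kill : ∀ L : W.St, (W.ctx L ⟶ 𝟙_ C) → Prop where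
  | nil : Kill [] (𝟙 _)
  | cons {L k} (l) (h : W.Triv l) : Kill L k →
      Kill (.wire l :: L) (W.ctx L ◁ (W.unitIso l h).hom ≫ (ρ_ _).hom ≫ k)

theorem Kill.unique {L : W.St} {k k'} (h : Kill L k) (h' : Kill L k') : k = k' := by
  induction h with
  | nil => cases h'; rfl
  | cons l hl _ ih =>
    cases h' with
    | cons _ _ h' => rw [ih h']

theorem Kill.isIso {L : W.St} {k} (h : Kill L k) : IsIso k := by
  induction h with
  | nil => exact inferInstanceAs (IsIso (𝟙 (𝟙_ C)))
  | cons l hl _ ih => infer_instance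

/-- A state of trivial wires has a preferred isomorphism with the unit, and structural morphisms
respect it; for a swap this is `kill_sw`. It settles uniqueness of structural morphisms out of the
empty state. -/
theorem Str.kill {L L' : W.St} {f k} (h : W.Str L L' f) (hk : Kill L k) :
    ∃ k', Kill L' k' ∧ f ≫ k' = k := by
  induction h with
  | refl L => exact ⟨_, hk, by simp⟩
  | trans _ _ ih ih' =>
    obtain ⟨k', hk', e⟩ := ih hk
    obtain ⟨k'', hk'', e'⟩ := ih' hk'
    exact ⟨_, hk'', by rw [Category.assoc, e', e]⟩
  | swap i j L =>
    cases hk with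
    | @cons _ k l hl hk =>
      cases hk with
      | @cons _ k l' hl' hk =>
        refine ⟨_, .cons l' hl' (.cons l hl hk), ?_⟩
        have := congr($(kill_sw (X := W.ctx L) (W.unitIso l' hl') (W.unitIso l hl)) ≫ (ρ_ _).hom ≫ k)
        simp only [Category.assoc] at this
        exact this
  | cons i _ ih =>
    cases hk with
    | @cons _ k l hl hk =>
      obtain ⟨k', hk', rfl⟩ := ih hk
      refine ⟨_, .cons l hl hk', ?_⟩
      simp only [obj]
      rw [← MonoidalCategory.whisker_exchange_assoc]
      simp
  | box b L _ ih => cases hk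
  | ins L l h =>
    refine ⟨_, .cons l h hk, ?_⟩
    simp [← MonoidalCategory.whiskerLeft_comp_assoc]
  | del L l h =>
    cases hk with
    | cons l hl hk =>
      exact ⟨_, hk, by simp⟩


/-- Trivial wires have no key, so the multiset of keys does not notice their insertion and deletion.
-/
theorem Str.tops_eq {L L' : W.St} {f} (h : W.Str L L' f) : tops L = tops L' := by
  induction h with
  | refl => rfl
  | trans _ _ h h' => exact h.trans h'
  | swap => simp only [tops_cons]; abel
  | cons _ _ h => simp [h]
  | box => simp
  | ins L l h => simp [key_triv h]
  | del L l h => simp [key_triv h]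

theorem Str.labs_eq {L L' : W.St} {f} (h : W.Str L L' f) : labs L = labs L' := by
  induction h with
  | refl => rfl
  | trans _ _ h h' => exact h.trans h'
  | swap => simp only [labs_cons]; abel
  | cons _ _ h => simp [h]
  | box _ _ _ h => simp [h]
  | ins L l h => simp [key_triv h]
  | del L l h => simp [key_triv h]

theorem Str.inners_eq {L L' : W.St} {f} (h : W.Str L L' f) : inners L = inners L' := by
  have := h.labs_eq
  rw [WireSig.labs_eq, WireSig.labs_eq, h.tops_eq] at this
  exact add_left_cancel this

/-- Structural morphisms between items. -/
inductive IStr : ∀ i j : Item W.Wire W.Box, (W.obj i ⟶ W.obj j) → Prop where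
  | refl (i) : IStr i i (𝟙 _)
  | box (b) {T T' f} : W.Str T T' f →
      IStr (.box b T) (.box b T') ((LeftClosed.coexp (W.boxOb b)).map f)

theorem IStr.str {i j} {h} (H : IStr (W := W) i j h) (L : W.St) :
    W.Str (i :: L) (j :: L) (W.ctx L ◁ h) := by
  cases H with
  | refl => simpa using Str.refl (i :: L)
  | box b H => exact .box b L H

theorem IStr.trans {i j k} {h h'} (H : IStr (W := W) i j h) (H' : IStr j k h') :
    IStr i k (h ≫ h') := by
  cases H with
  | refl => simpa using H'
  | box b H =>
    cases H' with
    | refl => simpa using IStr.box b H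
    | box b H' => rw [← Functor.map_comp]; exact .box b (H.trans H')

/-- `Ext k L i L₀ e`: the first item with key `k` of `L` is `i`, and `e` moves it to the end. -/
inductive Ext (k : W.Key) : ∀ (L : W.St) (i) (L₀ : W.St), (W.ctx L ⟶ W.ctx (i :: L₀)) → Prop where
  | here {i L} : key i = {k} → Ext k (i :: L) i L (𝟙 _)
  | there {L i L₀ e} (j) : k ∉ key j → Ext k L i L₀ e →
      Ext k (j :: L) i (j :: L₀) (e ▷ W.obj j ≫ sw _ _ _)

theorem Ext.str {k} {L : W.St} {i L₀ e} (h : Ext k L i L₀ e) : W.Str L (i :: L₀) e := by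
  induction h with
  | here => exact .refl _
  | there j _ _ ih => exact (Str.cons j ih).trans (.swap _ _ _)

theorem Ext.key_eq {k} {L : W.St} {i L₀ e} (h : Ext k L i L₀ e) : key i = {k} := by
  induction h with
  | here h => exact h
  | there _ _ _ ih => exact ih

theorem Ext.unique {k} {L : W.St} {i L₀ e i' L₀' e'} (h : Ext k L i L₀ e)
    (h' : Ext k L i' L₀' e') : ∃ (hi : i = i') (hL : L₀ = L₀'), hi ▸ hL ▸ e = e' := by
  induction h generalizing i' L₀' with
  | here h =>
    cases h' with
    | here => exact ⟨rfl, rfl, rfl⟩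
    | there _ hk => simp [h] at hk
  | there j hk _ ih =>
    cases h' with
    | here h => simp [h] at hk
    | there _ _ h' =>
      obtain ⟨rfl, rfl, rfl⟩ := ih h'
      exact ⟨rfl, rfl, rfl⟩

theorem Ext.exists {k} {L : W.St} (h : k ∈ tops L) : ∃ i L₀ e, Ext k L i L₀ e := by
  induction L with
  | nil => simp at h
  | cons j L ih =>
    by_cases hk : k ∈ key j
    · refine ⟨j, L, _, .here ?_⟩
      cases j with
      | wire l =>
        by_cases hl : W.Triv l
        · simp [key_triv hl] at hk
        · rw [key_wire hl] at hk ⊢; simp at hk; rw [hk]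
      | box b T => simp at hk ⊢; exact hk.symm
    · obtain ⟨i, L₀, e, h⟩ := ih (by simpa [hk] using h)
      exact ⟨_, _, _, .there j hk h⟩

/-- Extraction of the item with key `k` is natural along structural morphisms, and what remains
after it is again structural. Distinctness of keys matters for a swap: of two items with the same
key, the swap would change which one comes first. -/
theorem Str.ext {L L' : W.St} {f} (h : W.Str L L' f) (hn : (tops L).Nodup) {k i L₀ e}
    (hk : Ext k L i L₀ e) : ∃ i' L₀' e' h f', Ext k L' i' L₀' e' ∧ IStr i i' h ∧
      W.Str L₀ L₀' f' ∧ f ≫ e' = e ≫ (f' ⊗ₘ h) := by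
  induction h generalizing i L₀ with
  | refl L => exact ⟨_, _, _, _, _, hk, .refl _, .refl _, by simp⟩
  | trans h₁ _ ih ih' =>
    obtain ⟨i₁, L₁, e₁, h₁', f₁, hk₁, hi₁, hf₁, eq₁⟩ := ih hn hk
    obtain ⟨i₂, L₂, e₂, h₂, f₂, hk₂, hi₂, hf₂, eq₂⟩ := ih' (h₁.tops_eq ▸ hn) hk₁
    refine ⟨_, _, _, _, _, hk₂, hi₁.trans hi₂, hf₁.trans hf₂, ?_⟩
    rw [Category.assoc, eq₂, reassoc_of% eq₁, tensorHom_comp_tensorHom]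
  | swap a b L =>
    cases hk with
    | here ha =>
      have hb : k ∉ key b := by
        intro hb
        simp only [tops_cons, ha] at hn
        have := Multiset.disjoint_of_nodup_add hn
        exact Multiset.disjoint_left.1 this (Multiset.mem_singleton_self k) (by simp [hb])
      refine ⟨_, _, _, _, _, .there b hb (.here ha), .refl _, .refl _, ?_⟩
      simp
    | there _ ha hk =>
      cases hk with
      | here hb =>
        refine ⟨_, _, _, _, _, .here hb, .refl _, .refl _, ?_⟩
        simp
      | @there _ _ L₂ e₂ _ hb hk =>
        refine ⟨_, _, _, _, _, .there b hb (.there a ha hk), .refl _, .swap a b L₂, ?_⟩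
        have n : e₂ ▷ W.obj b ▷ W.obj a ≫ sw _ _ _ = sw _ _ _ ≫ e₂ ▷ W.obj a ▷ W.obj b := by
          simpa using sw_naturality e₂ (𝟙 (W.obj b)) (𝟙 (W.obj a))
        have y := sw_yang_baxter (W.ctx L₂) (W.obj i) (W.obj b) (W.obj a)
        simp only [comp_whiskerRight, Category.assoc, tensorHom_id]
        rw [y, reassoc_of% n]
  | cons j h ih =>
    cases hk with
    | here hj => exact ⟨_, _, _, _, _, .here hj, .refl _, h, by simp⟩
    | there _ hj hk =>
      obtain ⟨i₁, L₁, e₁, h₁', f₁, hk₁, hi₁, hf₁, eq₁⟩ := ih (by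
        simp only [tops_cons] at hn; exact (Multiset.nodup_add.1 hn).2.1) hk
      refine ⟨_, _, _, _, _, .there j hj hk₁, hi₁, .cons j hf₁, ?_⟩
      have n := sw_naturality f₁ h₁' (𝟙 (W.obj j))
      simp only [tensorHom_id] at n
      rw [Category.assoc, ← n, ← comp_whiskerRight_assoc, eq₁]
      simp
  | box b L h ih =>
    cases hk with
    | here hb => exact ⟨_, _, _, _, _, .here (by simpa using hb), .box b h, .refl _, by simp⟩
    | @there _ _ L₁ e₁ _ hb hk =>
      refine ⟨_, _, _, _, _, .there _ (by simpa using hb) hk, .refl _, .box b L₁ h, ?_⟩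
      rename_i T T' g
      have n := sw_naturality (𝟙 (W.ctx L₁)) (𝟙 (W.obj i)) ((LeftClosed.coexp (W.boxOb b)).map g)
      simp only [tensorHom_id, id_whiskerRight, id_tensorHom] at n
      simp only [tensorHom_id, Category.assoc]
      rw [← n, whisker_exchange_assoc]
  | ins L l h =>
    refine ⟨_, _, _, _, _, .there _ (by simp [key_triv h]) hk, .refl _, .ins L₀ l h, ?_⟩
    have n := ins_sw (W.ctx L₀) (W.obj i) (W.unitIso l h).inv
    simp only [Category.assoc, tensorHom_id]
    rw [whisker_exchange_assoc, ← rightUnitor_inv_naturality_assoc]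
    exact congr(e ≫ $n)
  | del L l h =>
    cases hk with
    | here hj => simp [key_triv h] at hj
    | @there _ _ L₁ e₁ _ hb hk =>
      refine ⟨_, _, _, _, _, hk, .refl _, .del L₁ l h, ?_⟩
      have n := sw_del (W.ctx L₁) (W.obj i) (W.unitIso l h).hom
      simp only [Category.assoc, tensorHom_id]
      rw [← rightUnitor_naturality, whisker_exchange_assoc]
      exact congr(e₁ ▷ W.ob l ≫ $n).symm

/-! ### Uniqueness of structural morphisms -/

theorem Str.isIso {L L' : W.St} {f} (h : W.Str L L' f) : IsIso f := by
  obtain ⟨g, _, h1, h2⟩ := h.symm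
  exact ⟨g, h1, h2⟩

mutual
/-- Structural morphisms out of a state without repeated keys are unique. -/
theorem Str.unique : ∀ {L L' : W.St} {f g}, (labs L).Nodup → W.Str L L' f → W.Str L L' g → f = g
  | [], L', f, g, _, hf, hg => by
    -- The target now consists of trivial wires, and its isomorphism `k` with the unit can be
    -- cancelled.
    obtain ⟨k, hk, e⟩ := hf.kill .nil
    obtain ⟨k', hk', e'⟩ := hg.kill .nil
    obtain rfl := hk.unique hk'
    have := hk.isIso
    rw [← cancel_mono k, e, e']
  | i :: L, L', f, g, hn, hf, hg => by
    have hnL : (labs L).Nodup := by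
      rw [labs_cons] at hn; exact (Multiset.nodup_add.1 hn).2.1
    have hnt : (tops (i :: L)).Nodup := by
      rw [labs_eq] at hn; exact (Multiset.nodup_add.1 hn).1
    by_cases hi : key i = 0
    · cases i with
      | box b T => simp at hi
      | wire l =>
        have hl : W.Triv l := by
          by_contra hl; simp [key_wire hl] at hi
        -- A trivial wire in front is removed by precomposing with its insertion, which is an
        -- isomorphism.
        have e := Str.unique hnL ((Str.ins L l hl).trans hf) ((Str.ins L l hl).trans hg)
        have := (Str.ins L l hl).isIso
        exact (cancel_epi _).1 e
    · have ⟨k, hk⟩ : ∃ k, key i = {k} := by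
        cases i with
        | box b T => exact ⟨_, rfl⟩
        | wire l =>
          by_cases hl : W.Triv l
          · exact absurd (key_triv hl) hi
          · exact ⟨_, key_wire hl⟩
      -- Otherwise the key of `i` is extracted from the target along both morphisms. The extracted
      -- items coincide, and the components on the item and on the remainder are compared
      -- recursively.
      obtain ⟨i₁, L₁, e₁, h₁, f₁, hk₁, hi₁, hf₁, eq₁⟩ := hf.ext hnt (.here hk)
      obtain ⟨i₂, L₂, e₂, h₂, f₂, hk₂, hi₂, hf₂, eq₂⟩ := hg.ext hnt (.here hk)
      obtain ⟨rfl, rfl, rfl⟩ := hk₁.unique hk₂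
      have := hk₁.str.isIso
      have hf := Str.unique hnL hf₁ hf₂
      have hi : h₁ = h₂ := IStr.unique (by
        rw [labs_cons] at hn
        exact (Multiset.nodup_add.1 (Multiset.nodup_add.1 hn).1).2.1) hi₁ hi₂
      subst hf hi
      exact (cancel_mono e₁).1 (eq₁.trans eq₂.symm)
/-- Structural morphisms out of an item without repeated keys are unique. -/
theorem IStr.unique : ∀ {i j : Item W.Wire W.Box} {h h'}, (inner i).Nodup → IStr i j h →
    IStr i j h' → h = h'
  | .wire l, j, h, h', _, hf, hg => by
    cases hf; cases hg; rfl
  | .box b T, j, h, h', hn, hf, hg => by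
    have ⟨T', f, hj, hf', e⟩ : ∃ T' f, j = .box b T' ∧ W.Str T T' f ∧
        HEq h ((LeftClosed.coexp (W.boxOb b)).map f) := by
      cases hf with
      | refl => exact ⟨T, _, rfl, .refl T, by simp⟩
      | box _ hf => exact ⟨_, _, rfl, hf, .rfl⟩
    subst hj
    have ⟨g, hg', e'⟩ : ∃ g, W.Str T T' g ∧ h' = (LeftClosed.coexp (W.boxOb b)).map g := by
      cases hg with
      | refl => exact ⟨_, .refl T, by simp⟩
      | box _ hg => exact ⟨_, hg, rfl⟩
    rw [inner_box] at hn
    obtain rfl := Str.unique hn hf' hg'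
    rw [e', eq_of_heq e]
end

end WireSig
end CoILL

namespace CoILL

universe u

set_option linter.unusedSectionVars false

/-! ### Concatenation of states -/

theorem sw_tensor {C : Type*} [Category C] [MonoidalCategory C] [SymmetricCategory C]
    (X A B D : C) :
    (α_ (X ⊗ A) B D).inv ≫ sw X A B ▷ D ≫ sw (X ⊗ B) A D =
      sw X A (B ⊗ D) ≫ (α_ X B D).inv ▷ A := by
  simp only [sw, BraidedCategory.braiding_tensor_right_hom]
  monoidal

theorem whiskerLeft_sw {C : Type*} [Category C] [MonoidalCategory C] [SymmetricCategory C]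
    (X A B D : C) :
    (α_ X (A ⊗ B) D).inv ≫ (α_ X A B).inv ▷ D ≫ sw (X ⊗ A) B D =
      X ◁ sw A B D ≫ (α_ X (A ⊗ D) B).inv ≫ (α_ X A D).inv ▷ B := by
  simp only [sw]
  monoidal

namespace WireSig

variable {C : Type*} [Category C] [MonoidalCategory C] [SymmetricCategory C] [LeftClosed C]
variable {W : WireSig.{u} C}

/-- Concatenation of states. -/
@[reducible]
def cat : W.St → W.St → W.St
  | [], r => r
  | i :: L, r => i :: cat L r

@[simp] theorem tops_cat (L r : W.St) : tops (cat L r) = tops L + tops r := by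
  induction L with
  | nil => simp
  | cons i L ih => simp [ih, add_assoc]

@[simp] theorem labs_cat (L r : W.St) : labs (cat L r) = labs L + labs r := by
  induction L with
  | nil => simp
  | cons i L ih => simp [ih, add_assoc]

/-- `⟦r⟧ ⊗ ⟦L⟧ ≅ ⟦r, L⟧` -/
def jn (r : W.St) : ∀ L : W.St, W.ctx r ⊗ W.ctx L ≅ W.ctx (cat L r)
  | [] => ρ_ _
  | i :: L => (α_ _ _ _).symm ≪≫ whiskerRightIso (jn r L) (W.obj i)

/-- A morphism acting below a prefix. -/
def pre {r r' : W.St} (f : W.ctx r ⟶ W.ctx r') : ∀ J : W.St, W.ctx (cat J r) ⟶ W.ctx (cat J r')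
  | [] => f
  | i :: J => pre f J ▷ W.obj i

/-- A morphism acting on a prefix. -/
def wh (r : W.St) {I O : W.St} (φ : W.ctx I ⟶ W.ctx O) : W.ctx (cat I r) ⟶ W.ctx (cat O r) :=
  (jn r I).inv ≫ W.ctx r ◁ φ ≫ (jn r O).hom

theorem jn_cons_hom (r : W.St) (i) (L : W.St) :
    (jn r (i :: L)).hom = (α_ _ _ _).inv ≫ (jn r L).hom ▷ W.obj i := rfl

theorem jn_cons_inv (r : W.St) (i) (L : W.St) :
    (jn r (i :: L)).inv = (jn r L).inv ▷ W.obj i ≫ (α_ _ _ _).hom := rfl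

@[simp] theorem pre_id (r J : W.St) : pre (𝟙 (W.ctx r)) J = 𝟙 _ := by
  induction J with
  | nil => rfl
  | cons i J ih => simp [pre, ih]

theorem pre_comp {r r' r'' : W.St} (f : W.ctx r ⟶ W.ctx r') (g : W.ctx r' ⟶ W.ctx r'') (J) :
    pre (f ≫ g) J = pre f J ≫ pre g J := by
  induction J with
  | nil => rfl
  | cons i J ih => simp [pre, ih]

theorem Str.pre {r r' : W.St} {f} (h : W.Str r r' f) (J) :
    W.Str (cat J r) (cat J r') (WireSig.pre f J) := by
  induction J with
  | nil => exact h
  | cons i J ih => exact .cons i ih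

theorem jn_naturality {r r' : W.St} (f : W.ctx r ⟶ W.ctx r') (L : W.St) :
    f ▷ W.ctx L ≫ (jn r' L).hom = (jn r L).hom ≫ pre f L := by
  induction L with
  | nil => simp [jn, pre]
  | cons i L ih =>
    simp only [jn_cons_hom, pre, Category.assoc, ← comp_whiskerRight, ← ih]
    simp

theorem jn_inv_naturality {r r' : W.St} (f : W.ctx r ⟶ W.ctx r') (L : W.St) :
    pre f L ≫ (jn r' L).inv = (jn r L).inv ≫ f ▷ W.ctx L := by
  rw [Iso.comp_inv_eq, Category.assoc, jn_naturality, Iso.inv_hom_id_assoc]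

theorem wh_pre {r r' I O : W.St} (φ : W.ctx I ⟶ W.ctx O) (g : W.ctx r ⟶ W.ctx r') :
    wh r φ ≫ pre g O = pre g I ≫ wh r' φ := by
  simp only [wh, Category.assoc, ← jn_naturality]
  rw [whisker_exchange_assoc, ← Category.assoc, ← jn_inv_naturality, Category.assoc]

@[simp] theorem wh_id (r I : W.St) : wh r (𝟙 (W.ctx I)) = 𝟙 _ := by simp [wh]

theorem wh_comp (r : W.St) {I J K : W.St} (φ : W.ctx I ⟶ W.ctx J) (ψ : W.ctx J ⟶ W.ctx K) :
    wh r (φ ≫ ψ) = wh r φ ≫ wh r ψ := by simp [wh]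

theorem wh_whiskerRight (r : W.St) {I J : W.St} (φ : W.ctx I ⟶ W.ctx J) (i) :
    wh r (I := i :: I) (O := i :: J) (φ ▷ W.obj i) = wh r φ ▷ W.obj i := by
  simp only [wh, jn_cons_hom, jn_cons_inv]
  simp

theorem wh_whiskerLeft (r I : W.St) {i j} (h : W.obj i ⟶ W.obj j) :
    wh r (I := i :: I) (O := j :: I) (W.ctx I ◁ h) = W.ctx (cat I r) ◁ h := by
  simp only [wh, jn_cons_hom, jn_cons_inv, Category.assoc, associator_inv_naturality_right_assoc,
    Iso.hom_inv_id_assoc]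
  rw [whisker_exchange, ← comp_whiskerRight_assoc]; simp

theorem wh_sw (r I : W.St) (i j) :
    wh r (I := i :: j :: I) (O := j :: i :: I) (sw (W.ctx I) (W.obj j) (W.obj i)) = sw _ _ _ := by
  have n := sw_naturality (jn r I).hom (𝟙 (W.obj j)) (𝟙 (W.obj i))
  simp only [tensorHom_id] at n
  have e := whiskerLeft_sw (W.ctx r) (W.ctx I) (W.obj j) (W.obj i)
  rw [wh, Iso.inv_comp_eq]
  simp only [jn_cons_hom, Category.assoc, comp_whiskerRight]
  rw [n, reassoc_of% e]

theorem wh_ins (r I : W.St) {l} (h : 𝟙_ C ⟶ W.ob l) :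
    wh r (I := I) (O := .wire l :: I) ((ρ_ _).inv ≫ W.ctx I ◁ h) =
      (ρ_ _).inv ≫ W.ctx (cat I r) ◁ h := by
  rw [wh, Iso.inv_comp_eq, rightUnitor_inv_naturality_assoc, ← whisker_exchange]
  simp only [jn_cons_hom]
  monoidal

theorem wh_del (r I : W.St) {l} (h : W.ob l ⟶ 𝟙_ C) :
    wh r (I := .wire l :: I) (O := I) (W.ctx I ◁ h ≫ (ρ_ _).hom) =
      W.ctx (cat I r) ◁ h ≫ (ρ_ _).hom := by
  rw [wh, Iso.inv_comp_eq]
  simp only [jn_cons_hom, Category.assoc]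
  rw [← whisker_exchange_assoc, rightUnitor_naturality]
  monoidal

theorem Str.wh (r : W.St) {I O : W.St} {f} (h : W.Str I O f) :
    W.Str (cat I r) (cat O r) (WireSig.wh r f) := by
  induction h with
  | refl => rw [wh_id]; exact .refl _
  | trans _ _ ih ih' => rw [wh_comp]; exact ih.trans ih'
  | swap i j L => rw [wh_sw]; exact .swap i j _
  | cons i _ ih => rw [wh_whiskerRight]; exact .cons i ih
  | box b L h _ =>
    have := wh_whiskerLeft r L (i := .box b _) (j := .box b _) ((LeftClosed.coexp (W.boxOb b)).map ‹_›)
    rw [this]; exact .box b _ h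
  | ins L l h => rw [wh_ins]; exact .ins _ l h
  | del L l h => rw [wh_del]; exact .del _ l h

/-- Move an item out of a prefix. -/
def pull (j) (X : W.St) : ∀ I : W.St, W.ctx (cat I (j :: X)) ⟶ W.ctx (j :: cat I X)
  | [] => 𝟙 _
  | i :: I => pull j X I ▷ W.obj i ≫ sw _ _ _

theorem Str.pull (j) (X I : W.St) : W.Str (cat I (j :: X)) (j :: cat I X) (WireSig.pull j X I) := by
  induction I with
  | nil => exact .refl _
  | cons i I ih => exact (Str.cons i ih).trans (.swap _ _ _)

theorem jn_pull (j) (X I : W.St) :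
    (jn (j :: X) I).hom ≫ pull j X I = sw _ _ _ ≫ (jn X I).hom ▷ W.obj j := by
  induction I with
  | nil =>
    have := sw_del (W.ctx X) (W.obj j) (𝟙 (𝟙_ C))
    simp only [MonoidalCategory.whiskerLeft_id, Category.id_comp] at this
    simp only [jn, pull, Category.comp_id]
    exact this.symm
  | cons i I ih =>
    simp only [jn_cons_hom, pull, Category.assoc]
    rw [← comp_whiskerRight_assoc, ih, comp_whiskerRight]
    have n := sw_naturality (jn X I).hom (𝟙 (W.obj j)) (𝟙 (W.obj i))
    simp only [tensorHom_id] at n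
    rw [Category.assoc, n]
    have := sw_tensor (W.ctx X) (W.obj j) (W.ctx I) (W.obj i)
    rw [← Category.assoc, ← Category.assoc, Category.assoc _ _ (sw _ _ _), this]
    simp

theorem wh_pull (j) (X : W.St) {I O : W.St} (φ : W.ctx I ⟶ W.ctx O) :
    wh (j :: X) φ ≫ pull j X O = pull j X I ≫ wh X φ ▷ W.obj j := by
  rw [← cancel_epi (jn (j :: X) I).hom, ← Category.assoc _ (pull j X I), jn_pull]
  simp only [wh, Category.assoc, Iso.hom_inv_id_assoc, comp_whiskerRight, jn_pull]
  have n := sw_naturality (𝟙 (W.ctx X)) (𝟙 (W.obj j)) φ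
  simp only [id_tensorHom, tensorHom_id, id_whiskerRight] at n
  rw [← Category.assoc, n]
  simp

/-- Exchange of two prefixes. -/
def swb (r I : W.St) : ∀ J : W.St, W.ctx (cat I (cat J r)) ⟶ W.ctx (cat J (cat I r))
  | [] => 𝟙 _
  | j :: J => pull j (cat J r) I ≫ swb r I J ▷ W.obj j

theorem Str.swb (r I J : W.St) :
    W.Str (cat I (cat J r)) (cat J (cat I r)) (WireSig.swb r I J) := by
  induction J with
  | nil => exact .refl _
  | cons j J ih => exact (Str.pull _ _ _).trans (.cons j ih)

/-- Naturality of the exchange of prefixes: a morphism acting on one prefix can be moved past the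
other. -/
theorem wh_swb (r J : W.St) {I O : W.St} (φ : W.ctx I ⟶ W.ctx O) :
    wh (cat J r) φ ≫ swb r O J = swb r I J ≫ pre (wh r φ) J := by
  induction J with
  | nil => simp [swb, pre]
  | cons j J ih =>
    simp only [swb, pre, Category.assoc, ← comp_whiskerRight, ← ih]
    rw [← Category.assoc, wh_pull, Category.assoc, comp_whiskerRight]


/-! ### Cancellation and extraction -/

theorem triv_of_key_eq_zero {i : Item W.Wire W.Box} (h : key i = 0) :
    ∃ l, i = .wire l ∧ W.Triv l := by
  cases i with
  | box b T => simp at h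
  | wire l =>
    refine ⟨l, rfl, ?_⟩
    by_contra hl; simp [key_wire hl] at h

theorem key_cases (i : Item W.Wire W.Box) : key i = 0 ∨ ∃ k, key i = {k} := by
  cases i with
  | box b T => exact .inr ⟨_, rfl⟩
  | wire l =>
    by_cases hl : W.Triv l
    · exact .inl (key_triv hl)
    · exact .inr ⟨_, key_wire hl⟩

theorem Str.cancel_triv {i j} {r r' : W.St} {f} (h : W.Str (i :: r) (j :: r') f)
    (hi : key i = 0) (hj : key j = 0) : ∃ g, W.Str r r' g := by
  obtain ⟨l, rfl, hl⟩ := triv_of_key_eq_zero hi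
  obtain ⟨l', rfl, hl'⟩ := triv_of_key_eq_zero hj
  exact ⟨_, ((Str.ins r l hl).trans h).trans (.del r' l' hl')⟩

theorem Str.cancel {i j} {r r' : W.St} {f k} (h : W.Str (i :: r) (j :: r') f)
    (hn : (tops (i :: r)).Nodup) (hi : key i = {k}) (hj : key j = {k}) :
    (∃ h, IStr i j h) ∧ ∃ g, W.Str r r' g := by
  obtain ⟨i', L, e, h', f', hk, hi', hf', -⟩ := h.ext hn (.here hi)
  obtain ⟨rfl, rfl, -⟩ := hk.unique (.here hj)
  exact ⟨⟨_, hi'⟩, _, hf'⟩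

/-- Items are cancelled one at a time: a trivial wire by its insertion and deletion, any other item
by its key. -/
theorem Str.cancel_cat {I r r' : W.St} {f} (h : W.Str (cat I r) (cat I r') f)
    (hn : (tops (cat I r)).Nodup) : ∃ g, W.Str r r' g := by
  induction I with
  | nil => exact ⟨_, h⟩
  | cons i I ih =>
    rcases key_cases i with hi | ⟨k, hi⟩
    · obtain ⟨g, hg⟩ := h.cancel_triv hi hi
      exact ih hg (by simpa [hi] using hn)
    · obtain ⟨-, g, hg⟩ := h.cancel hn hi hi
      exact ih hg (by rw [tops_cons] at hn; exact (Multiset.nodup_add.1 hn).2.1)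

/-- Two disjoint prefixes can be split off simultaneously. -/
theorem Str.split_disjoint {I₁ r₁ I₂ r₂ : W.St} {f} (h : W.Str (cat I₁ r₁) (cat I₂ r₂) f)
    (hn : (tops (cat I₁ r₁)).Nodup) (hd : Disjoint (tops I₁) (tops I₂)) :
    ∃ r g₁ g₂, W.Str r₁ (cat I₂ r) g₁ ∧ W.Str r₂ (cat I₁ r) g₂ := by
  induction I₂ generalizing r₁ with
  | nil =>
    obtain ⟨g, hg, -⟩ := h.symm
    exact ⟨r₁, _, g, .refl _, hg⟩
  | cons i I ih =>
    rcases key_cases i with hi | ⟨k, hi⟩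
    · obtain ⟨l, rfl, hl⟩ := triv_of_key_eq_zero hi
      obtain ⟨r, g₁, g₂, h₁, h₂⟩ := ih (h.trans (.del _ l hl)) hn (by simpa [hi] using hd)
      exact ⟨r, _, g₂, h₁.trans (.ins _ l hl), h₂⟩
    -- The key of `i` occurs in the state but, by disjointness, not in `I₁`; so the item can be
    -- taken out of `r₁`.
    · have hk : k ∈ tops r₁ := by
        have h1 : k ∈ tops (cat I₁ r₁) := by rw [h.tops_eq]; simp [hi]
        rw [tops_cat, Multiset.mem_add] at h1
        refine h1.resolve_left fun h1 => ?_
        exact Multiset.disjoint_left.1 hd h1 (by simp [hi])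
      obtain ⟨j, r₀, e, he⟩ := Ext.exists hk
      obtain ⟨e', he', -⟩ := (he.str.pre I₁).symm
      obtain ⟨p, hp, -⟩ := (Str.pull j r₀ I₁).symm
      have hn' : (tops (j :: cat I₁ r₀)).Nodup := by
        rwa [← (Str.pull j r₀ I₁).tops_eq, ← (he.str.pre I₁).tops_eq]
      obtain ⟨⟨h₁, hij⟩, g, hg⟩ := ((hp.trans he').trans h).cancel hn' he.key_eq hi
      obtain ⟨r, g₁, g₂, h₁, h₂⟩ := ih hg
        (by rw [tops_cons] at hn'; exact (Multiset.nodup_add.1 hn').2.1)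
        (Multiset.disjoint_left.2 fun hx hx' =>
          Multiset.disjoint_left.1 hd hx (by simp [hx']))
      exact ⟨r, _, g₂, (he.str.trans (hij.str _)).trans (.cons i h₁), h₂⟩

end WireSig
end CoILL

namespace CoILL

universe u

set_option linter.unusedSectionVars false

/-! ### Nets: events on states -/

/-- The postpone operation is natural in its codomain. -/
theorem Structure.postpHom_comp {C : Type*} [Category C] [MonoidalCategory C] [SymmetricCategory C]
    [LeftClosed C] {A B X Y : C} (f : A ⟶ X ⊗ B) (k : X ⟶ Y) :
    Structure.postpHom f ≫ k = Structure.postpHom (f ≫ k ▷ B) := by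
  rw [Structure.postpHom, Structure.postpHom, ← Adjunction.homEquiv_naturality_right_symm]
  simp

/-- The postpone operation is natural in its domain. -/
theorem Structure.map_postpHom {C : Type*} [Category C] [MonoidalCategory C] [SymmetricCategory C]
    [LeftClosed C] {A A' B X : C} (h : A' ⟶ A) (f : A ⟶ X ⊗ B) :
    (LeftClosed.coexp B).map h ≫ Structure.postpHom f = Structure.postpHom (h ≫ f) := by
  rw [Structure.postpHom, Structure.postpHom, ← Adjunction.homEquiv_naturality_left_symm]
  simp

variable {C : Type*} [Category C] [MonoidalCategory C] [SymmetricCategory C] [LeftClosed C]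

open WireSig

/-- Events on the states of a signature: gates that consume and produce wires, and, for every box,
the event that closes it.  A gate may have to be located next to the wires `rd g`, which no event
consumes. -/
structure Net (W : WireSig.{u} C) where
  Gate : Type u
  ins : Gate → W.St
  outs : Gate → W.St
  mor : ∀ g, W.ctx (ins g) ⟶ W.ctx (outs g)
  rd : Gate → Multiset W.Key
  anc : Gate → W.Key
  last : W.Box → W.Wire
  cls : ∀ b, W.ob (last b) ⟶ W.boxOb b
  -- The anchor ties a gate to one place: it is a top-level key wherever the gate can be applied.
  anc_mem : ∀ g, anc g ∈ tops (ins g) ∨ anc g ∈ rd g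
  box_ins : ∀ g b, Sum.inr b ∉ tops (ins g)
  -- What a gate reads is never consumed by an event, so reading does not obstruct the commutation
  -- of independent events.
  rd_ins : ∀ g g', ∀ k ∈ rd g, k ∉ tops (ins g')
  rd_last : ∀ g b, ∀ k ∈ rd g, k ∉ key (W := W) (.wire (last b))
  rd_box : ∀ g b, Sum.inr b ∉ rd g

namespace Net

variable {W : WireSig.{u} C} (N : Net W)

/-- The events of a net. -/
inductive Ev
  | gate (g : N.Gate)
  | cls (b : W.Box)

variable {N}

/-- The keys that an event consumes. -/
noncomputable def Ev.ins : N.Ev → Multiset W.Key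
  | .gate g => labs (N.ins g)
  | .cls b => {.inr b} + key (.wire (N.last b))

/-- The keys that an event produces. -/
noncomputable def Ev.outs : N.Ev → Multiset W.Key
  | .gate g => labs (N.outs g)
  | .cls _ => 0

/-- A key that is present wherever the event can take place. -/
noncomputable def Ev.anc : N.Ev → W.Key
  | .gate g => N.anc g
  | .cls b => .inr b

/-- The morphism that closes a box. -/
def close (N : Net W) (b : W.Box) (T : W.St) :
    W.ctx [.box b (.wire (N.last b) :: T)] ⟶ W.ctx T :=
  (λ_ _).hom ≫ Structure.postpHom (W.ctx T ◁ N.cls b)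

/-- The morphism of a box induced by a morphism of its content. -/
def boxMap (b : W.Box) {T T' : W.St} (f : W.ctx T ⟶ W.ctx T') :
    W.ctx [.box b T] ⟶ W.ctx [.box b T'] :=
  𝟙_ C ◁ (LeftClosed.coexp (W.boxOb b)).map f

variable (N)

/-- `Fire e L L' f`: the event `e` takes place, possibly inside boxes, and turns the state `L` into
`L'`; this is interpreted by the morphism `f`. -/
inductive Fire : N.Ev → ∀ L L' : W.St, (W.ctx L ⟶ W.ctx L') → Prop where
  | gate (g) {L L' : W.St} (r : W.St) {σ : W.ctx L ⟶ W.ctx (cat (N.ins g) r)}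
      {τ : W.ctx (cat (N.outs g) r) ⟶ W.ctx L'} : (∀ k ∈ N.rd g, k ∈ tops L) →
      W.Str L (cat (N.ins g) r) σ → W.Str (cat (N.outs g) r) L' τ →
      Fire (.gate g) L L' (σ ≫ wh r (N.mor g) ≫ τ)
  | cls (b) {L L' : W.St} (T r : W.St)
      {σ : W.ctx L ⟶ W.ctx (cat [.box b (.wire (N.last b) :: T)] r)}
      {τ : W.ctx (cat T r) ⟶ W.ctx L'} :
      W.Str L (cat [.box b (.wire (N.last b) :: T)] r) σ → W.Str (cat T r) L' τ →
      Fire (.cls b) L L' (σ ≫ wh r (N.close b T) ≫ τ)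
  | inBox (b) {e} {L L' T T' : W.St} {f} (r : W.St) {σ : W.ctx L ⟶ W.ctx (cat [.box b T] r)}
      {τ : W.ctx (cat [.box b T'] r) ⟶ W.ctx L'} :
      Fire e T T' f → W.Str L (cat [.box b T] r) σ → W.Str (cat [.box b T'] r) L' τ →
      Fire e L L' (σ ≫ wh r (boxMap b f) ≫ τ)

/-- The elementary steps, without their surroundings. -/
inductive Loc : N.Ev → ∀ I O : W.St, Multiset W.Key → (W.ctx I ⟶ W.ctx O) → Prop where
  | gate (g) : Loc (.gate g) (N.ins g) (N.outs g) (N.rd g) (N.mor g)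
  | cls (b T) : Loc (.cls b) [.box b (.wire (N.last b) :: T)] T 0 (N.close b T)
  | inBox (b) {e T T' f} : N.Fire e T T' f → Loc e [.box b T] [.box b T'] 0 (boxMap b f)

variable {N}

theorem Loc.fire {e I O R φ} (h : N.Loc e I O R φ) {L L' r : W.St}
    {σ : W.ctx L ⟶ W.ctx (cat I r)} {τ : W.ctx (cat O r) ⟶ W.ctx L'}
    (hR : ∀ k ∈ R, k ∈ tops L) (hσ : W.Str L (cat I r) σ) (hτ : W.Str (cat O r) L' τ) :
    N.Fire e L L' (σ ≫ wh r φ ≫ τ) := by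
  cases h with
  | gate g => exact .gate g r hR hσ hτ
  | cls b => exact .cls b _ r hσ hτ
  | inBox b h => exact .inBox b r h hσ hτ

/-- Every step is a local step in surroundings `r`, between two structural morphisms. This allows
the three kinds of step to be treated alike. -/
theorem Fire.loc {e} {L L' : W.St} {f} (h : N.Fire e L L' f) : ∃ I O R φ r σ τ, N.Loc e I O R φ ∧
    (∀ k ∈ R, k ∈ tops L) ∧ W.Str L (cat I r) σ ∧ W.Str (cat O r) L' τ ∧ f = σ ≫ wh r φ ≫ τ := by
  cases h with
  | gate g r hR hσ hτ => exact ⟨_, _, _, _, r, _, _, .gate g, hR, hσ, hτ, rfl⟩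
  | cls b T r hσ hτ => exact ⟨_, _, _, _, r, _, _, .cls b T, by simp, hσ, hτ, rfl⟩
  | inBox b r h hσ hτ => exact ⟨_, _, _, _, r, _, _, .inBox b h, by simp, hσ, hτ, rfl⟩

theorem Fire.str {e} {L₀ L L' L'' : W.St} {s f t} (h : N.Fire e L L' f) (hs : W.Str L₀ L s)
    (ht : W.Str L' L'' t) : N.Fire e L₀ L'' (s ≫ f ≫ t) := by
  obtain ⟨I, O, R, φ, r, σ, τ, hl, hR, hσ, hτ, rfl⟩ := h.loc
  have := hl.fire (hs.tops_eq ▸ hR) (hs.trans hσ) (hτ.trans ht)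
  simpa using this

theorem Fire.frame {e} {r r' : W.St} {f} (h : N.Fire e r r' f) (J : W.St) :
    N.Fire e (cat J r) (cat J r') (pre f J) := by
  obtain ⟨I, O, R, φ, x, σ, τ, hl, hR, hσ, hτ, rfl⟩ := h.loc
  obtain ⟨u, hu, -, hu'⟩ := (Str.swb x I J).symm
  have := hl.fire (r := cat J x) (fun k hk => by simp [hR k hk]) ((hσ.pre J).trans hu)
    ((Str.swb x O J).trans (hτ.pre J))
  have e : (pre σ J ≫ u) ≫ wh (cat J x) φ ≫ swb x O J ≫ pre τ J = pre (σ ≫ wh x φ ≫ τ) J := by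
    rw [← Category.assoc (wh _ _), wh_swb, pre_comp, pre_comp]
    simp [reassoc_of% hu']
  rwa [e] at this

/-- An event removes and adds fixed multisets of labels, at whatever depth it takes place. This
conservation law later bounds how often a label can be consumed. -/
theorem Fire.labs_eq {e} {L L' : W.St} {f} (h : N.Fire e L L' f) :
    labs L' + e.ins = labs L + e.outs := by
  induction h with
  | gate g r _ hσ hτ =>
    rw [hσ.labs_eq, ← hτ.labs_eq, labs_cat, labs_cat, Ev.ins, Ev.outs]; abel
  | cls b T r hσ hτ =>
    rw [hσ.labs_eq, ← hτ.labs_eq, labs_cat, labs_cat, Ev.ins, Ev.outs]; simp; abel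
  | inBox b r _ hσ hτ ih =>
    rw [hσ.labs_eq, ← hτ.labs_eq, labs_cat, labs_cat]
    simp only [labs_cons, labs_nil, add_zero, inner_box, key_box]
    rw [add_right_comm, add_assoc _ (labs _), ih]; abel

theorem Fire.anc_mem {e} {L L' : W.St} {f} (h : N.Fire e L L' f) : e.anc ∈ labs L := by
  induction h with
  | gate g r hR hσ hτ =>
    rw [WireSig.labs_eq, Multiset.mem_add]
    refine .inl ?_
    rcases N.anc_mem g with h | h
    · rw [hσ.tops_eq, tops_cat]; exact Multiset.mem_add.2 (.inl h)
    · exact hR _ h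
  | cls b T r hσ hτ => rw [hσ.labs_eq]; simp [Ev.anc]
  | inBox b r _ hσ hτ ih => rw [hσ.labs_eq]; simp [ih]

/-- Prefixes `I` and `I₂` of one state without common keys can be split off simultaneously, so the
step takes place in the remainder `r₂`. The two ways of arranging the state agree by `Str.unique`.
-/
theorem Loc.factor {e I O R φ} (h : N.Loc e I O R φ) {L L' r₁ I₂ r₂ : W.St}
    {σ : W.ctx L ⟶ W.ctx (cat I r₁)} {τ : W.ctx (cat O r₁) ⟶ W.ctx L'} {σ₂}
    (hR : ∀ k ∈ R, k ∈ tops L) (hσ : W.Str L (cat I r₁) σ) (hτ : W.Str (cat O r₁) L' τ)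
    (hσ₂ : W.Str L (cat I₂ r₂) σ₂) (hn : (labs L).Nodup) (hd : Disjoint (tops I) (tops I₂))
    (hR' : ∀ k ∈ R, k ∉ tops I₂) :
    ∃ r' f s, N.Fire e r₂ r' f ∧ W.Str L' (cat I₂ r') s ∧
      (σ ≫ wh r₁ φ ≫ τ) ≫ s = σ₂ ≫ pre f I₂ := by
  obtain ⟨σ', hσ', -, e1⟩ := hσ.symm
  obtain ⟨τ', hτ', e2, -⟩ := hτ.symm
  have hnt : (tops L).Nodup := by rw [WireSig.labs_eq] at hn; exact (Multiset.nodup_add.1 hn).1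
  obtain ⟨r, g₁, g₂, h₁, h₂⟩ := (hσ'.trans hσ₂).split_disjoint (hσ.tops_eq ▸ hnt) hd
  refine ⟨cat O r, _, _, h.fire (r := r) (fun k hk => ?_) h₂ (.refl _),
    hτ'.trans ((h₁.pre O).trans (Str.swb r O I₂)), ?_⟩
  · have := hR k hk
    rw [hσ₂.tops_eq, tops_cat, Multiset.mem_add] at this
    exact this.resolve_left (hR' k hk)
  · have u : σ ≫ pre g₁ I ≫ swb r I I₂ = σ₂ ≫ pre g₂ I₂ :=
      Str.unique hn (hσ.trans ((h₁.pre I).trans (Str.swb r I I₂))) (hσ₂.trans (h₂.pre I₂))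
    simp only [Category.comp_id, Category.assoc, pre_comp]
    rw [reassoc_of% e2, ← Category.assoc (wh r₁ φ), wh_pre, Category.assoc, wh_swb,
      ← Category.assoc, ← Category.assoc, Category.assoc σ, u, Category.assoc]

/-- By `Loc.factor` the first step acts in the remainder of the second one's prefix. The two then
act on different tensor factors and commute by the interchange law. -/
theorem Loc.diamond {e₁ e₂ I₁ O₁ R₁ φ₁ I₂ O₂ R₂ φ₂} (h₁ : N.Loc e₁ I₁ O₁ R₁ φ₁)
    (h₂ : N.Loc e₂ I₂ O₂ R₂ φ₂) {L L₁ L₂ r₁ r₂ : W.St}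
    {σ₁ : W.ctx L ⟶ W.ctx (cat I₁ r₁)} {τ₁ : W.ctx (cat O₁ r₁) ⟶ W.ctx L₁}
    {σ₂ : W.ctx L ⟶ W.ctx (cat I₂ r₂)} {τ₂ : W.ctx (cat O₂ r₂) ⟶ W.ctx L₂}
    (hR₁ : ∀ k ∈ R₁, k ∈ tops L) (hσ₁ : W.Str L (cat I₁ r₁) σ₁) (hτ₁ : W.Str (cat O₁ r₁) L₁ τ₁)
    (hR₂ : ∀ k ∈ R₂, k ∈ tops L) (hσ₂ : W.Str L (cat I₂ r₂) σ₂) (hτ₂ : W.Str (cat O₂ r₂) L₂ τ₂)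
    (hn : (labs L).Nodup) (hd : Disjoint (tops I₁) (tops I₂))
    (hR₁' : ∀ k ∈ R₁, k ∉ tops I₂) (hR₂' : ∀ k ∈ R₂, k ∉ tops I₁) :
    ∃ L₃ g₁ g₂, N.Fire e₂ L₁ L₃ g₁ ∧ N.Fire e₁ L₂ L₃ g₂ ∧
      (σ₁ ≫ wh r₁ φ₁ ≫ τ₁) ≫ g₁ = (σ₂ ≫ wh r₂ φ₂ ≫ τ₂) ≫ g₂ := by
  obtain ⟨r', f, s, hf, hs, e⟩ := h₁.factor hR₁ hσ₁ hτ₁ hσ₂ hn hd hR₁'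
  obtain ⟨τ', hτ', e2, -⟩ := hτ₂.symm
  refine ⟨cat O₂ r', _, _, h₂.fire (r := r') (fun k hk => ?_) hs (.refl _),
    (hf.frame O₂).str hτ' (.refl _), ?_⟩
  · have := hR₂ k hk
    rw [hσ₁.tops_eq, tops_cat, Multiset.mem_add] at this
    rw [← hτ₁.tops_eq, tops_cat, Multiset.mem_add]
    exact .inr (this.resolve_left (hR₂' k hk))
  · rw [← Category.assoc, e]
    simp only [Category.comp_id, Category.assoc, reassoc_of% e2, wh_pre]

/-- Used to decide the depth of an event: its anchor cannot lie both at the top level and inside a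
box. -/
theorem tops_inners_disjoint {L : W.St} (hn : (labs L).Nodup) {k} (h : k ∈ tops L)
    (h' : k ∈ inners L) : False := by
  rw [WireSig.labs_eq] at hn
  exact Multiset.disjoint_left.1 (Multiset.nodup_add.1 hn).2.2 h h'

theorem box_inners {L r T : W.St} {b σ} (h : W.Str L (cat [.box b T] r) σ) {k}
    (hk : k ∈ labs T) : k ∈ inners L := by
  rw [h.inners_eq]; simp [hk]

theorem istr_box {b} {T T' : W.St} {h} (H : IStr (W := W) (.box b T) (.box b T') h) :
    ∃ f, W.Str T T' f := by
  cases H with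
  | refl => exact ⟨_, .refl _⟩
  | box _ H => exact ⟨_, H⟩

theorem str_cancel_box {b} {T T' r r' : W.St} {f}
    (h : W.Str (cat [.box b T] r) (cat [.box b T'] r') f) (hn : (labs (.box b T :: r)).Nodup) :
    (∃ t, W.Str T T' t) ∧ ∃ g, W.Str r r' g := by
  have hnt : (tops (.box b T :: r)).Nodup := by
    rw [WireSig.labs_eq] at hn; exact (Multiset.nodup_add.1 hn).1
  obtain ⟨⟨_, hi⟩, hr⟩ := h.cancel hnt (key_box b T) (key_box b T')
  exact ⟨istr_box hi, hr⟩

/-- On the source side the two arrangements of `L` agree by uniqueness of structural morphisms; the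
square `e` carries the comparison over to the target side. -/
theorem agree_aux {L L₁ L₂ I₁ I₂ O₁ O₂ r₁ r₂ : W.St}
    {σ₁ : W.ctx L ⟶ W.ctx (cat I₁ r₁)} {τ₁ : W.ctx (cat O₁ r₁) ⟶ W.ctx L₁}
    {σ₂ : W.ctx L ⟶ W.ctx (cat I₂ r₂)} {τ₂ : W.ctx (cat O₂ r₂) ⟶ W.ctx L₂}
    {φ₁ : W.ctx I₁ ⟶ W.ctx O₁} {φ₂ : W.ctx I₂ ⟶ W.ctx O₂} {i o g}
    (hσ₁ : W.Str L (cat I₁ r₁) σ₁) (hτ₁ : W.Str (cat O₁ r₁) L₁ τ₁)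
    (hσ₂ : W.Str L (cat I₂ r₂) σ₂) (hτ₂ : W.Str (cat O₂ r₂) L₂ τ₂)
    (hi : W.Str I₁ I₂ i) (ho : W.Str O₁ O₂ o) (hr : W.Str r₁ r₂ g) (e : i ≫ φ₂ = φ₁ ≫ o)
    (hn : (labs L).Nodup) :
    ∃ s, W.Str L₁ L₂ s ∧ (σ₁ ≫ wh r₁ φ₁ ≫ τ₁) ≫ s = σ₂ ≫ wh r₂ φ₂ ≫ τ₂ := by
  obtain ⟨τ', hτ', e2, -⟩ := hτ₁.symm
  refine ⟨_, hτ'.trans (((ho.wh r₁).trans (hr.pre O₂)).trans hτ₂), ?_⟩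
  have u : σ₂ = σ₁ ≫ wh r₁ i ≫ pre g I₂ :=
    Str.unique hn hσ₂ (hσ₁.trans ((hi.wh r₁).trans (hr.pre I₂)))
  simp only [Category.assoc, reassoc_of% e2]
  rw [u, ← Category.assoc (wh r₁ φ₁), ← wh_comp, ← e, wh_comp]
  simp only [Category.assoc]
  rw [← Category.assoc (wh r₁ φ₂), wh_pre, Category.assoc]

/-- Closing is a transpose, and transposes are natural both in the domain and in the codomain. -/
theorem close_natural (b) {T T' : W.St} (t : W.ctx T ⟶ W.ctx T') :
    boxMap (T := .wire (N.last b) :: T) (T' := .wire (N.last b) :: T') b (t ▷ W.ob (N.last b)) ≫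
      N.close b T' = N.close b T ≫ t := by
  simp only [boxMap, close, Category.assoc]
  rw [leftUnitor_naturality_assoc, Structure.map_postpHom, Structure.postpHom_comp,
    whisker_exchange]

theorem boxMap_comp (b) {T T' T'' : W.St} (f : W.ctx T ⟶ W.ctx T') (g : W.ctx T' ⟶ W.ctx T'') :
    boxMap b (f ≫ g) = boxMap b f ≫ boxMap b g := by
  simp [boxMap]

theorem str_inBox (b) {T T' : W.St} {f} (h : W.Str T T' f) :
    W.Str [.box b T] [.box b T'] (boxMap b f) := .box b [] h

/-- Distinct boxes can be split off together, so a common key of their contents would occur twice in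
the state. -/
theorem two_boxes {L r T r' T' : W.St} {b b'} {σ : W.ctx L ⟶ W.ctx (cat [.box b T] r)}
    {σ' : W.ctx L ⟶ W.ctx (cat [.box b' T'] r')} (h : W.Str L (cat [.box b T] r) σ)
    (h' : W.Str L (cat [.box b' T'] r') σ') (hb : b ≠ b') (hn : (labs L).Nodup) {k}
    (hk : k ∈ labs T) (hk' : k ∈ labs T') : False := by
  obtain ⟨s, hs, -⟩ := h.symm
  have hnt : (tops L).Nodup := by rw [WireSig.labs_eq] at hn; exact (Multiset.nodup_add.1 hn).1
  obtain ⟨r₀, _, _, h₁, -⟩ := (hs.trans h').split_disjoint (h.tops_eq ▸ hnt) (by simpa [eq_comm] using hb)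
  rw [h.labs_eq, labs_cat, h₁.labs_eq, labs_cat] at hn
  refine Multiset.disjoint_left.1 (Multiset.nodup_add.1 hn).2.2 (?_ : k ∈ _) ?_ <;> simp [hk, hk']

/-- Two steps for the same event from the same state agree. -/
theorem Fire.agree {e} {L L₁ L₂ : W.St} {f₁ f₂} (h₁ : N.Fire e L L₁ f₁) (h₂ : N.Fire e L L₂ f₂)
    (hn : (labs L).Nodup) : ∃ s, W.Str L₁ L₂ s ∧ f₁ ≫ s = f₂ := by
  have hnt : (tops L).Nodup := by rw [WireSig.labs_eq] at hn; exact (Multiset.nodup_add.1 hn).1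
  induction h₁ generalizing L₂ with
  | gate g r hR hσ hτ =>
    obtain ⟨σ', hσ', -⟩ := hσ.symm
    cases h₂ with
    | gate _ r₂ hR₂ hσ₂ hτ₂ =>
      obtain ⟨_, hr⟩ := (hσ'.trans hσ₂).cancel_cat (hσ.tops_eq ▸ hnt)
      exact agree_aux hσ hτ hσ₂ hτ₂ (.refl _) (.refl _) hr (by simp) hn
    | inBox b r₂ h hσ₂ hτ₂ =>
      -- The anchor of the gate would lie at the top level and also inside the box.
      refine (tops_inners_disjoint hn ?_ (box_inners hσ₂ h.anc_mem)).elim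
      rcases N.anc_mem g with h | h
      · rw [hσ.tops_eq, tops_cat]; exact Multiset.mem_add.2 (.inl h)
      · exact hR _ h
  | cls b T r hσ hτ =>
    obtain ⟨σ', hσ', -⟩ := hσ.symm
    cases h₂ with
    | cls _ T₂ r₂ hσ₂ hτ₂ =>
      obtain ⟨⟨t, ht⟩, _, hr⟩ := str_cancel_box (hσ'.trans hσ₂) (hσ.labs_eq ▸ hn)
      have hn' : (tops (.wire (N.last b) :: T)).Nodup := by
        rw [hσ.labs_eq, labs_cat, labs_cons, inner_box, WireSig.labs_eq (_ :: T)] at hn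
        exact (Multiset.nodup_add.1 (Multiset.nodup_add.1 (Multiset.nodup_add.1
          (Multiset.nodup_add.1 hn).1).1).2.1).1
      obtain ⟨s, hs⟩ := Str.cancel_cat (I := [.wire (N.last b)]) ht hn'
      exact agree_aux hσ hτ hσ₂ hτ₂ (str_inBox b (.cons _ hs)) hs hr (close_natural b s) hn
    | inBox b' r₂ h hσ₂ hτ₂ =>
      refine (tops_inners_disjoint hn ?_ (box_inners hσ₂ h.anc_mem)).elim
      rw [hσ.tops_eq]; simp [Ev.anc]
  | @inBox b e L _ T T₁ f r σ τ h hσ hτ ih =>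
    obtain ⟨σ', hσ', -⟩ := hσ.symm
    cases h₂ with
    | gate g r₂ hR₂ hσ₂ hτ₂ =>
      refine (tops_inners_disjoint hn ?_ (box_inners hσ h.anc_mem)).elim
      rcases N.anc_mem g with h | h
      · rw [hσ₂.tops_eq, tops_cat]; exact Multiset.mem_add.2 (.inl h)
      · exact hR₂ _ h
    | cls b' T₂ r₂ hσ₂ hτ₂ =>
      refine (tops_inners_disjoint hn ?_ (box_inners hσ h.anc_mem)).elim
      rw [hσ₂.tops_eq]; simp [Ev.anc]
    | inBox b' r₂ h' hσ₂ hτ₂ =>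
      by_cases hb : b = b'
      · subst hb
        obtain ⟨⟨t, ht⟩, _, hr⟩ := str_cancel_box (hσ'.trans hσ₂) (hσ.labs_eq ▸ hn)
        have hn' : (labs T).Nodup := by
          rw [hσ.labs_eq, labs_cat, labs_cons, inner_box] at hn
          exact (Multiset.nodup_add.1 (Multiset.nodup_add.1 (Multiset.nodup_add.1 hn).1).1).2.1
        have hn'' : (tops T).Nodup := by
          rw [WireSig.labs_eq] at hn'; exact (Multiset.nodup_add.1 hn').1
        obtain ⟨s, hs, e⟩ := ih (h'.str ht (.refl _)) hn' hn''
        refine agree_aux hσ hτ hσ₂ hτ₂ (str_inBox b ht) (str_inBox b hs) hr ?_ hn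
        rw [← boxMap_comp, ← boxMap_comp, e, Category.comp_id]
      -- The anchor determines the box in which the event takes place.
      · exact (two_boxes hσ hσ₂ hb hn h.anc_mem h'.anc_mem).elim

/-- Reassociation of a concatenation of states. -/
def asc (X r : W.St) : ∀ I : W.St, W.ctx (cat (cat I X) r) ⟶ W.ctx (cat I (cat X r))
  | [] => 𝟙 _
  | i :: I => asc X r I ▷ W.obj i

theorem str_asc (X r I : W.St) : W.Str (cat (cat I X) r) (cat I (cat X r)) (asc X r I) := by
  induction I with
  | nil => exact .refl _
  | cons i I ih => exact .cons i ih

theorem jn_asc (X r I : W.St) :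
    W.ctx r ◁ (jn X I).hom ≫ (jn r (cat I X)).hom ≫ asc X r I =
      (α_ _ _ _).inv ≫ (jn r X).hom ▷ W.ctx I ≫ (jn (cat X r) I).hom := by
  induction I with
  | nil => simp [jn, asc]
  | cons i I ih =>
    simp only [jn_cons_hom, asc, Category.assoc, MonoidalCategory.whiskerLeft_comp,
      ← comp_whiskerRight]
    rw [associator_inv_naturality_middle_assoc, ← comp_whiskerRight, ih]
    simp

theorem wh_asc (X r : W.St) {I O : W.St} (φ : W.ctx I ⟶ W.ctx O) :
    wh r (wh X φ) ≫ asc X r O = asc X r I ≫ wh (cat X r) φ := by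
  have h := jn_asc X r I
  have h' := jn_asc X r O
  rw [← cancel_epi (jn r (cat I X)).hom, ← cancel_epi (W.ctx r ◁ (jn X I).hom)]
  simp only [wh, Category.assoc, Iso.hom_inv_id_assoc, MonoidalCategory.whiskerLeft_comp]
  rw [h', reassoc_of% h, ← MonoidalCategory.whiskerLeft_comp_assoc, Iso.hom_inv_id]
  simp only [MonoidalCategory.whiskerLeft_id, Category.id_comp, Iso.hom_inv_id_assoc]
  rw [← whisker_exchange_assoc]
  simp

theorem pre_asc {r r' : W.St} (f : W.ctx r ⟶ W.ctx r') (X I : W.St) :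
    pre f (cat I X) ≫ asc X r' I = asc X r I ≫ pre (pre f X) I := by
  induction I with
  | nil => simp [asc, pre]
  | cons i I ih => simp only [asc, pre, ← comp_whiskerRight, ih]

theorem Fire.wh {e} {I O : W.St} {f} (h : N.Fire e I O f) (r : W.St) :
    N.Fire e (cat I r) (cat O r) (WireSig.wh r f) := by
  obtain ⟨I₀, O₀, R, φ, x, σ, τ, hl, hR, hσ, hτ, rfl⟩ := h.loc
  obtain ⟨u, hu, e1, -⟩ := (str_asc x r O₀).symm
  have := hl.fire (r := cat x r) (L := cat I r) (fun k hk => by simp [hR k hk])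
    ((hσ.wh r).trans (str_asc x r I₀)) (hu.trans (hτ.wh r))
  have e : (WireSig.wh r σ ≫ asc x r I₀) ≫ WireSig.wh (cat x r) φ ≫ u ≫ WireSig.wh r τ =
      WireSig.wh r (σ ≫ WireSig.wh x φ ≫ τ) := by
    rw [wh_comp, wh_comp, Category.assoc, ← Category.assoc (asc _ _ _), ← wh_asc]
    simp [reassoc_of% e1]
  rwa [e] at this

theorem inr_notMem_key_wire (b : W.Box) (l) : Sum.inr b ∉ key (W := W) (.wire l) := by
  by_cases h : W.Triv l
  · simp [key_triv h]
  · simp [key_wire h]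

/-- A closing and a step in an inner box consume a box at the top level, never a wire; only for a
gate is the independence from the closing of `b` needed. -/
theorem Loc.disjoint_wire {e I O R φ} (h : N.Loc e I O R φ) (b)
    (hd : Disjoint e.ins (Ev.ins (N := N) (.cls b))) :
    Disjoint (tops I) (tops (W := W) [.wire (N.last b)]) ∧
      ∀ k ∈ R, k ∉ tops (W := W) [.wire (N.last b)] := by
  cases h with
  | gate g =>
    refine ⟨Multiset.disjoint_left.2 fun {k} hk hk' => Multiset.disjoint_left.1 hd
      (?_ : k ∈ labs (N.ins g)) ?_, fun k hk => by simpa using N.rd_last g b k hk⟩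
    · rw [WireSig.labs_eq]; exact Multiset.mem_add.2 (.inl hk)
    · exact Multiset.mem_add.2 (.inr (by simpa using hk'))
  | cls b' T => simp [inr_notMem_key_wire]
  | inBox b' h => simp [inr_notMem_key_wire]

/-- A step inside `b` that leaves the last wire alone acts on the other factor of the content. Since
the transpose is natural in its codomain, the step can equally be made after the box has been
closed. -/
theorem Fire.diamond_box {e b} {L L₁ L₂ T r₁ T₂ T₂' r₂ : W.St}
    {σ₁ : W.ctx L ⟶ W.ctx (cat [.box b (.wire (N.last b) :: T)] r₁)}
    {τ₁ : W.ctx (cat T r₁) ⟶ W.ctx L₁}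
    {σ₂ : W.ctx L ⟶ W.ctx (cat [.box b T₂] r₂)} {τ₂ : W.ctx (cat [.box b T₂'] r₂) ⟶ W.ctx L₂} {f}
    (hσ₁ : W.Str L (cat [.box b (.wire (N.last b) :: T)] r₁) σ₁)
    (hτ₁ : W.Str (cat T r₁) L₁ τ₁) (h : N.Fire e T₂ T₂' f)
    (hσ₂ : W.Str L (cat [.box b T₂] r₂) σ₂) (hτ₂ : W.Str (cat [.box b T₂'] r₂) L₂ τ₂)
    (hn : (labs L).Nodup) (hd : Disjoint e.ins (Ev.ins (N := N) (.cls b))) :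
    ∃ L₃ g₁ g₂, N.Fire e L₁ L₃ g₁ ∧ N.Fire (.cls b) L₂ L₃ g₂ ∧
      (σ₁ ≫ WireSig.wh r₁ (N.close b T) ≫ τ₁) ≫ g₁ =
        (σ₂ ≫ WireSig.wh r₂ (boxMap b f) ≫ τ₂) ≫ g₂ := by
  obtain ⟨σ', hσ', -⟩ := hσ₁.symm
  obtain ⟨τ₁', hτ₁', e1, -⟩ := hτ₁.symm
  obtain ⟨τ₂', hτ₂', e2, -⟩ := hτ₂.symm
  obtain ⟨⟨t, ht⟩, g, hr⟩ := str_cancel_box (hσ'.trans hσ₂) (hσ₁.labs_eq ▸ hn)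
  obtain ⟨g', hg', -, -⟩ := hr.symm
  have hn' : (labs (.wire (N.last b) :: T)).Nodup := by
    rw [hσ₁.labs_eq, labs_cat, labs_cons, inner_box] at hn
    exact (Multiset.nodup_add.1 (Multiset.nodup_add.1 (Multiset.nodup_add.1 hn).1).1).2.1
  obtain ⟨I, O, R, φ, r, σ, τ, hl, hR, hσ, hτ, e3⟩ := (h.str ht (.refl _)).loc
  obtain ⟨hd₁, hd₂⟩ := hl.disjoint_wire b hd
  obtain ⟨r', f₀, s, hf₀, hs, e4⟩ := hl.factor (I₂ := [.wire (N.last b)]) (r₂ := T) hR hσ hτ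
    (.refl _) hn' hd₁ hd₂
  refine ⟨_, _, _, (hf₀.wh r₁).str hτ₁' (.refl _), .cls b r' r₁
    (hτ₂'.trans (((str_inBox b hs).wh r₂).trans (hg'.pre _))) (.refl _), ?_⟩
  have u : σ₁ ≫ WireSig.wh r₁ (boxMap b t) = σ₂ ≫ pre g' [.box b T₂] :=
    Str.unique hn (hσ₁.trans ((str_inBox b ht).wh r₁)) (hσ₂.trans (hg'.pre _))
  have e5 : boxMap b t ≫ boxMap b f ≫ boxMap b s = boxMap (T := .wire (N.last b) :: T)
      (T' := .wire (N.last b) :: r') b (f₀ ▷ W.ob (N.last b)) := by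
    rw [← boxMap_comp, ← boxMap_comp]
    congr 1
    rw [← e3] at e4
    simpa [pre] using e4
  simp only [Category.assoc, reassoc_of% e1, reassoc_of% e2, Category.comp_id]
  rw [← wh_comp, ← close_natural, ← e5, ← Category.assoc (WireSig.wh r₂ (boxMap b s)), wh_pre,
    Category.assoc]
  simp only [Category.assoc]
  rw [← Category.assoc (WireSig.wh r₂ (boxMap b f)), wh_pre]
  simp only [Category.assoc, wh_comp, reassoc_of% u]

/-- Two steps for independent events commute. -/
theorem Fire.diamond {e₁ e₂} {L L₁ L₂ : W.St} {f₁ f₂} (h₁ : N.Fire e₁ L L₁ f₁)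
    (h₂ : N.Fire e₂ L L₂ f₂) (hn : (labs L).Nodup) (hd : Disjoint e₁.ins e₂.ins) :
    ∃ L₃ g₁ g₂, N.Fire e₂ L₁ L₃ g₁ ∧ N.Fire e₁ L₂ L₃ g₂ ∧ f₁ ≫ g₁ = f₂ ≫ g₂ := by
  induction h₁ generalizing L₂ with
  | gate g r hR hσ hτ =>
    cases h₂ with
    | gate g' r₂ hR₂ hσ₂ hτ₂ =>
      refine Loc.diamond (.gate g) (.gate g') hR hσ hτ hR₂ hσ₂ hτ₂ hn
        (Multiset.disjoint_left.2 fun {k} hk hk' => Multiset.disjoint_left.1 hd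
          (?_ : k ∈ labs (N.ins g)) (?_ : k ∈ labs (N.ins g'))) (N.rd_ins _ _) (N.rd_ins _ _) <;>
      · rw [WireSig.labs_eq]; exact Multiset.mem_add.2 (.inl ‹_›)
    | cls b T r₂ hσ₂ hτ₂ =>
      refine Loc.diamond (.gate g) (.cls b T) hR hσ hτ (by simp) hσ₂ hτ₂ hn
        (by simpa using N.box_ins g b) ?_ (by simp)
      rintro k hk h
      simp at h
      exact N.rd_box g b (h ▸ hk)
    | inBox b r₂ h hσ₂ hτ₂ =>
      refine Loc.diamond (.gate g) (.inBox b h) hR hσ hτ (by simp) hσ₂ hτ₂ hn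
        (by simpa using N.box_ins g b) ?_ (by simp)
      rintro k hk h
      simp at h
      exact N.rd_box g b (h ▸ hk)
  | cls b T r hσ hτ =>
    cases h₂ with
    | gate g r₂ hR₂ hσ₂ hτ₂ =>
      refine Loc.diamond (.cls b T) (.gate g) (by simp) hσ hτ hR₂ hσ₂ hτ₂ hn
        (by simpa using N.box_ins g b) (by simp) ?_
      rintro k hk h
      simp at h
      exact N.rd_box g b (h ▸ hk)
    | cls b' T' r₂ hσ₂ hτ₂ =>
      have hb : b' ≠ b := by
        rintro rfl
        exact Multiset.disjoint_left.1 hd (Multiset.mem_add.2 (.inl (Multiset.mem_singleton_self _)))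
          (Multiset.mem_add.2 (.inl (Multiset.mem_singleton_self _)))
      exact Loc.diamond (.cls b T) (.cls b' T') (by simp) hσ hτ (by simp) hσ₂ hτ₂ hn
        (by simpa using hb) (by simp) (by simp)
    | inBox b' r₂ h hσ₂ hτ₂ =>
      by_cases hb : b = b'
      · subst hb
        exact Fire.diamond_box hσ hτ h hσ₂ hτ₂ hn hd.symm
      · exact Loc.diamond (.cls b T) (.inBox b' h) (by simp) hσ hτ (by simp) hσ₂ hτ₂ hn
          (by simpa [eq_comm] using hb) (by simp) (by simp)
  | @inBox b e L _ T T₁ f r σ τ h hσ hτ ih =>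
    obtain ⟨σ', hσ', -⟩ := hσ.symm
    cases h₂ with
    | gate g r₂ hR₂ hσ₂ hτ₂ =>
      refine Loc.diamond (.inBox b h) (.gate g) (by simp) hσ hτ hR₂ hσ₂ hτ₂ hn
        (by simpa using N.box_ins g b) (by simp) ?_
      rintro k hk h
      simp at h
      exact N.rd_box g b (h ▸ hk)
    | cls b' T₂ r₂ hσ₂ hτ₂ =>
      by_cases hb : b = b'
      · subst hb
        obtain ⟨L₃, g₁, g₂, h₁, h₂, e⟩ := Fire.diamond_box hσ₂ hτ₂ h hσ hτ hn hd
        exact ⟨L₃, g₂, g₁, h₂, h₁, e.symm⟩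
      · exact Loc.diamond (.inBox b h) (.cls b' T₂) (by simp) hσ hτ (by simp) hσ₂ hτ₂ hn
          (by simpa [eq_comm] using hb) (by simp) (by simp)
    | @inBox b' _ _ _ T₂ T₂' f' r₂ σ₂ τ₂ h' hσ₂ hτ₂ =>
      by_cases hb : b = b'
      · subst hb
        obtain ⟨⟨t, ht⟩, g, hr⟩ := str_cancel_box (hσ'.trans hσ₂) (hσ.labs_eq ▸ hn)
        have hn' : (labs T).Nodup := by
          rw [hσ.labs_eq, labs_cat, labs_cons, inner_box] at hn
          exact (Multiset.nodup_add.1 (Multiset.nodup_add.1 (Multiset.nodup_add.1 hn).1).1).2.1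
        obtain ⟨T₃, g₁, g₂, h₁, h₂, e⟩ := ih (h'.str ht (.refl _)) hn' hd
        obtain ⟨g', hg', -, -⟩ := hr.symm
        obtain ⟨τ₁', hτ₁', e1, -⟩ := hτ.symm
        obtain ⟨τ₂', hτ₂', e2, -⟩ := hτ₂.symm
        have u : σ ≫ WireSig.wh r (boxMap b t) = σ₂ ≫ pre g' [.box b T₂] :=
          Str.unique hn (hσ.trans ((str_inBox b ht).wh r)) (hσ₂.trans (hg'.pre _))
        refine ⟨_, _, _, .inBox b r h₁ hτ₁' (.refl _),
          .inBox b r h₂ (hτ₂'.trans (hg'.pre _)) (.refl _), ?_⟩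
        simp only [Category.assoc, reassoc_of% e1, reassoc_of% e2, Category.comp_id]
        rw [← wh_comp, ← boxMap_comp, e, ← Category.assoc (WireSig.wh r₂ (boxMap b f')), wh_pre]
        simp only [Category.assoc, wh_comp, boxMap_comp, Category.comp_id]
        rw [reassoc_of% u]
      · exact Loc.diamond (.inBox b h) (.inBox b' h') (by simp) hσ hτ (by simp) hσ₂ hτ₂ hn
          (by simpa [eq_comm] using hb) (by simp) (by simp)

/-! ### Runs -/

variable (N) in
/-- `Run L E T f`: the events `E` take place one after the other and turn `L` into `T`. -/
inductive Run : ∀ (L : W.St) (_ : Multiset N.Ev) (T : W.St), (W.ctx L ⟶ W.ctx T) → Prop where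
  | nil {L T f} : W.Str L T f → Run L 0 T f
  | cons {e} {L L₁ : W.St} {f} {E T g} : N.Fire e L L₁ f → Run L₁ E T g →
      Run L (e ::ₘ E) T (f ≫ g)

/-- The keys consumed by events. -/
noncomputable def insSum (E : Multiset N.Ev) : Multiset W.Key := (E.map Ev.ins).sum

/-- The keys produced by events. -/
noncomputable def outsSum (E : Multiset N.Ev) : Multiset W.Key := (E.map Ev.outs).sum

@[simp] theorem insSum_zero : insSum (0 : Multiset N.Ev) = 0 := rfl
@[simp] theorem outsSum_zero : outsSum (0 : Multiset N.Ev) = 0 := rfl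
@[simp] theorem insSum_cons (e) (E : Multiset N.Ev) : insSum (e ::ₘ E) = e.ins + insSum E := by
  simp [insSum]
@[simp] theorem outsSum_cons (e) (E : Multiset N.Ev) :
    outsSum (e ::ₘ E) = e.outs + outsSum E := by
  simp [outsSum]

theorem Run.labs_eq {L T : W.St} {E f} (h : N.Run L E T f) :
    labs T + insSum E = labs L + outsSum E := by
  induction h with
  | nil h => simp [h.labs_eq]
  | @cons e L L₁ f E T g h _ ih =>
    have := h.labs_eq
    rw [insSum_cons, outsSum_cons]
    calc _ = (labs T + insSum E) + e.ins := by abel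
      _ = (labs L₁ + e.ins) + outsSum E := by rw [ih]; abel
      _ = _ := by rw [this]; abel

theorem Run.str {L₀ L T T₁ : W.St} {E s f t} (h : N.Run L E T f) (hs : W.Str L₀ L s)
    (ht : W.Str T T₁ t) : N.Run L₀ E T₁ (s ≫ f ≫ t) := by
  induction h generalizing L₀ with
  | nil h => exact .nil (hs.trans (h.trans ht))
  | cons h _ ih =>
    have := Run.cons (h.str hs (.refl _)) (ih (.refl _) ht)
    simpa using this

theorem Run.trans {L T U : W.St} {E E' f g} (h : N.Run L E T f) (h' : N.Run T E' U g) :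
    N.Run L (E + E') U (f ≫ g) := by
  induction h with
  | nil h => rw [zero_add]; simpa using h'.str h (.refl _)
  | cons h _ ih => rw [Multiset.cons_add, Category.assoc]; exact .cons h (ih h')

theorem Run.fire {L T : W.St} {e f} (h : N.Fire e L T f) : N.Run L {e} T f := by
  have := Run.cons h (.nil (.refl _)); simpa using this

theorem Run.pre {L T : W.St} {E f} (h : N.Run L E T f) (J : W.St) :
    N.Run (cat J L) E (cat J T) (WireSig.pre f J) := by
  induction h with
  | nil h => exact .nil (h.pre J)
  | cons h _ ih => rw [pre_comp]; exact .cons (h.frame J) ih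

theorem Run.inBox (b) (r : W.St) {T T' : W.St} {E f} (h : N.Run T E T' f) :
    N.Run (cat [.box b T] r) E (cat [.box b T'] r) (WireSig.wh r (boxMap b f)) := by
  induction h with
  | nil h => exact .nil ((str_inBox b h).wh r)
  | cons h _ ih =>
    rw [boxMap_comp, wh_comp]
    refine .cons ?_ ih
    have := Fire.inBox b r h (.refl _) (.refl _)
    simpa using this

open Classical in
/-- An event of a run may take place first. -/
theorem Run.pull {L T : W.St} {E f} (h : N.Run L E T f) {e} (he : e ∈ E) {L' g}
    (hg : N.Fire e L L' g) (hn : (labs L + outsSum E).Nodup) (hi : (insSum E).Nodup) :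
    ∃ f', N.Run L' (E.erase e) T f' ∧ f = g ≫ f' := by
  induction h generalizing L' with
  | nil => simp at he
  | @cons e₀ L L₁ f₀ E T g₀ h hr ih =>
    have hnL := (Multiset.nodup_add.1 hn).1
    rw [insSum_cons, Multiset.nodup_add] at hi
    by_cases h0 : e = e₀
    · subst h0
      -- If the run begins with `e`, the two first steps agree up to a structural morphism, which
      -- the rest of the run absorbs.
      obtain ⟨s, hs, e1⟩ := hg.agree h hnL
      refine ⟨s ≫ g₀, ?_, ?_⟩
      · rw [Multiset.erase_cons_head]; simpa using hr.str hs (.refl _)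
      · simp [← e1]
    · have he' : e ∈ E := by simpa [h0] using he
      have hd : Disjoint e₀.ins e.ins := by
        refine hi.2.2.mono_right ?_
        obtain ⟨E', rfl⟩ := Multiset.exists_cons_of_mem he'
        simp
      -- Otherwise `e` is moved to the front of the remaining run and then commuted with the first
      -- step.
      obtain ⟨L₃, g₁, g₂, h₁, h₂, e1⟩ := h.diamond hg hnL hd
      obtain ⟨f', hf', rfl⟩ := ih he' h₁ (by
        -- By conservation of labels, distinctness passes on to the state `L₁`.
        rw [outsSum_cons, ← add_assoc, ← h.labs_eq, add_right_comm] at hn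
        exact (Multiset.nodup_add.1 hn).1) hi.2.1
      refine ⟨g₂ ≫ f', ?_, ?_⟩
      · rw [Multiset.erase_cons_tail _ (by simpa using Ne.symm h0)]; exact .cons h₂ hf'
      · rw [← Category.assoc, e1, Category.assoc]

/-- All runs of given events between given states are interpreted by the same morphism. -/
theorem Run.unique {L T : W.St} {E f g} (h : N.Run L E T f) (h' : N.Run L E T g)
    (hn : (labs L + outsSum E).Nodup) (hi : (insSum E).Nodup) : f = g := by
  classical
  induction h with
  | nil h =>
    generalize hE : (0 : Multiset N.Ev) = E at h'
    cases h' with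
    | nil h' => exact Str.unique (Multiset.nodup_add.1 hn).1 h h'
    | cons => simp at hE
  | @cons e₀ L L₁ f₀ E T g₀ h hr ih =>
    -- The second run is rearranged so as to begin with the very first step of the first run.
    obtain ⟨f', hf', rfl⟩ := h'.pull (Multiset.mem_cons_self _ _) h hn hi
    rw [Multiset.erase_cons_head] at hf'
    rw [insSum_cons, Multiset.nodup_add] at hi
    rw [ih hf' (by
        rw [outsSum_cons, ← add_assoc, ← h.labs_eq, add_right_comm] at hn
        exact (Multiset.nodup_add.1 hn).1) hi.2.1]

end Net
end CoILL

namespace CoILL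

universe u

set_option linter.unusedSectionVars false

/-! ### Tokens -/

variable {C : Type*} [Category C] [MonoidalCategory C] [SymmetricCategory C] [LeftClosed C]

open WireSig

/-- Wires that mark locations: their objects are units, but they are not trivial. -/
structure Tokens (W : WireSig.{u} C) where
  Name : Type u
  wire : Name → W.Wire
  not_triv : ∀ v, ¬ W.Triv (wire v)
  unit : ∀ v, 𝟙_ C ≅ W.ob (wire v)

namespace Tokens

variable {W : WireSig.{u} C} (K : Tokens W)

/-- The key of a token. -/
def key (v : K.Name) : W.Key := .inl (K.wire v)

theorem key_wire (v : K.Name) : WireSig.key (W := W) (.wire (K.wire v)) = {K.key v} :=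
  WireSig.key_wire (K.not_triv v)

/-- Insertion of a token. -/
def new (v : K.Name) (r : W.St) : W.ctx r ⟶ W.ctx (.wire (K.wire v) :: r) :=
  (ρ_ (W.ctx r)).inv ≫ W.ctx r ◁ (K.unit v).hom

/-- `K.Ins ts r r' t`: the tokens `ts` are added to the state `r`. -/
inductive Ins : List K.Name → ∀ r r' : W.St, (W.ctx r ⟶ W.ctx r') → Prop
  | nil (r) : Ins [] r r (𝟙 _)
  | cons (v) {ts} {r r' : W.St} {t} : Ins ts r r' t →
      Ins (v :: ts) r (.wire (K.wire v) :: r') (t ≫ K.new v r')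

variable {K}

theorem Ins.trans {ts ts'} {r r' r'' : W.St} {t t'} (h : K.Ins ts r r' t)
    (h' : K.Ins ts' r' r'' t') : K.Ins (ts' ++ ts) r r'' (t ≫ t') := by
  induction h' with
  | nil => simpa using h
  | cons v _ ih => rw [← Category.assoc]; exact .cons v (ih h)

theorem Ins.tops_eq {ts} {r r' : W.St} {t} (h : K.Ins ts r r' t) :
    tops r' = tops r + (ts : Multiset K.Name).map K.key := by
  induction h with
  | nil => simp
  | cons v _ ih =>
    rw [tops_cons, ih, key_wire, ← Multiset.cons_coe, Multiset.map_cons,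
      ← Multiset.singleton_add]
    abel

variable (K) in
theorem Ins.exists (ts : List K.Name) (r : W.St) : ∃ r' t, K.Ins ts r r' t := by
  induction ts with
  | nil => exact ⟨_, _, .nil r⟩
  | cons v ts ih => obtain ⟨_, _, h⟩ := ih; exact ⟨_, _, .cons v h⟩

theorem Ins.unique {ts} {r r₁ r₂ : W.St} {t₁ t₂} (h : K.Ins ts r r₁ t₁)
    (h' : K.Ins ts r r₂ t₂) : ∃ e : r₁ = r₂, e ▸ t₁ = t₂ := by
  induction h generalizing r₂ with
  | nil => cases h'; exact ⟨rfl, rfl⟩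
  | cons v _ ih =>
    cases h' with
    | cons _ h' => obtain ⟨rfl, rfl⟩ := ih h'; exact ⟨rfl, rfl⟩

theorem new_natural (v : K.Name) {r r' : W.St} (f : W.ctx r ⟶ W.ctx r') :
    f ≫ K.new v r' = K.new v r ≫ f ▷ W.ob (K.wire v) := by
  simp only [new, Category.assoc]
  rw [rightUnitor_inv_naturality_assoc, whisker_exchange]

theorem new_sw (v : K.Name) (i) (r : W.St) :
    K.new v (i :: r) ≫ sw (W.ctx r) (W.obj i) (W.ob (K.wire v)) = K.new v r ▷ W.obj i := by
  rw [new, Category.assoc]; exact ins_sw _ _ _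

theorem new_new (v w : K.Name) (r : W.St) :
    K.new w r ≫ K.new v (.wire (K.wire w) :: r) ≫ sw (W.ctx r) (W.ob (K.wire w)) (W.ob (K.wire v))
      = K.new v r ≫ K.new w (.wire (K.wire v) :: r) := by
  have := new_sw v (.wire (K.wire w)) r
  rw [new_natural w (K.new v r)]
  exact congr(K.new w r ≫ $this)

/-- Insertions of unit wires slide past each other, so the order of tokens matters only up to swaps.
-/
theorem Ins.perm {ts ts'} {r r₁ r₂ : W.St} {t₁ t₂} (p : ts.Perm ts') (h : K.Ins ts r r₁ t₁)
    (h' : K.Ins ts' r r₂ t₂) : ∃ s, W.Str r₁ r₂ s ∧ t₁ ≫ s = t₂ := by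
  induction p generalizing r₁ r₂ with
  | nil => obtain ⟨rfl, rfl⟩ := h.unique h'; exact ⟨_, .refl _, by simp⟩
  | cons v _ ih =>
    cases h with
    | cons _ h =>
      cases h' with
      | cons _ h' =>
        obtain ⟨s, hs, rfl⟩ := ih h h'
        exact ⟨_, .cons _ hs, by rw [Category.assoc, Category.assoc, new_natural]⟩
  | swap v w ts =>
    cases h with
    | cons _ h =>
      cases h with
      | cons _ h =>
        cases h' with
        | cons _ h' =>
          cases h' with
          | cons _ h' =>
            obtain ⟨rfl, rfl⟩ := h.unique h'
            refine ⟨_, .swap _ _ _, ?_⟩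
            simp only [Category.assoc, new_new]
  | trans _ _ ih ih' =>
    rename_i l₁ l₂ l₃ _ _
    obtain ⟨r', t', h₂⟩ := Ins.exists K l₂ r
    obtain ⟨s, hs, rfl⟩ := ih h h₂
    obtain ⟨s', hs', rfl⟩ := ih' h₂ h'
    exact ⟨_, hs.trans hs', by simp⟩

theorem pre_new (v : K.Name) (r X : W.St) :
    pre (K.new v r) X ≫ WireSig.pull (.wire (K.wire v)) r X = K.new v (cat X r) := by
  induction X with
  | nil => simp [pre, WireSig.pull]
  | cons i X ih =>
    simp only [pre, WireSig.pull, ← Category.assoc, ← comp_whiskerRight, ih]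
    rw [← new_sw, Category.assoc, sw_sw, Category.comp_id]

/-- A token inserted in front of the prefix `X` is moved below it by swaps, with which its insertion
is compatible. -/
theorem Ins.frame {ts} {X r R : W.St} {t} (h : K.Ins ts (cat X r) R t) :
    ∃ r' t' s, K.Ins ts r r' t' ∧ W.Str R (cat X r') s ∧ t ≫ s = pre t' X := by
  induction ts generalizing R with
  | nil => cases h; exact ⟨_, _, _, .nil r, .refl _, by simp⟩
  | cons v ts ih =>
    cases h with | cons _ h' =>
    obtain ⟨r', t', s, h, hs, e⟩ := ih h'
    obtain ⟨u, hu, e1, e2⟩ := (Str.pull (.wire (K.wire v)) r' X).symm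
    refine ⟨_, _, _, .cons v h, (Str.cons _ hs).trans hu, ?_⟩
    rw [pre_comp, ← e, Category.assoc, Category.assoc]
    have : pre (K.new v r') X = K.new v (cat X r') ≫ u := by
      rw [← pre_new, Category.assoc, e1, Category.comp_id]
    rw [this, ← Category.assoc (K.new v _), ← new_natural, Category.assoc]

/-! ### Simulation by runs -/

variable (K) in
/-- `K.Sim N v I L g ts E`: where the token `v` is present, the events `E` turn `I` into `L` and
produce the tokens `ts`; this is interpreted by `g`. -/
def Sim (N : Net W) (v : K.Name) (I L : W.St) (g : W.ctx I ⟶ W.ctx L) (ts : List K.Name)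
    (E : Multiset N.Ev) : Prop :=
  ∀ r : W.St, K.key v ∈ tops r → ∃ r' t, K.Ins ts r r' t ∧
    N.Run (cat I r) E (cat L r') (wh r g ≫ pre t L)

variable {N : Net W}

/-- The second simulation may be located at the original token or at one that the first simulation
has produced; either is present when it starts. -/
theorem Sim.trans {v w : K.Name} {I L L' : W.St} {g g' ts ts' E E'} (h : K.Sim N v I L g ts E)
    (h' : K.Sim N w L L' g' ts' E') (hw : w = v ∨ w ∈ ts) :
    K.Sim N v I L' (g ≫ g') (ts' ++ ts) (E + E') := by
  intro r hr
  obtain ⟨r₁, t₁, i₁, h₁⟩ := h r hr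
  obtain ⟨r₂, t₂, i₂, h₂⟩ := h' r₁ (by
    rw [i₁.tops_eq, Multiset.mem_add]
    rcases hw with rfl | hw
    · exact .inl hr
    · exact .inr (Multiset.mem_map_of_mem _ hw))
  refine ⟨_, _, i₁.trans i₂, ?_⟩
  have := h₁.trans h₂
  rwa [Category.assoc, ← Category.assoc (pre t₁ L), ← wh_pre, Category.assoc, ← pre_comp,
    ← Category.assoc, ← wh_comp] at this

/-- The wires `X` are counted among the surroundings while the events take place; afterwards
`Ins.frame` moves the new tokens below them. -/
theorem Sim.frame {v : K.Name} {I L : W.St} {g ts E} (h : K.Sim N v I L g ts E) (X : W.St) :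
    K.Sim N v (cat I X) (cat L X) (wh X g) ts E := by
  intro r hr
  obtain ⟨R, t, i, h⟩ := h (cat X r) (by simp [hr])
  obtain ⟨r', t', s, i', hs, e⟩ := i.frame
  obtain ⟨u, hu, e1, -⟩ := (Net.str_asc X r' L).symm
  refine ⟨r', t', i', ?_⟩
  have := h.str (Net.str_asc X r I) ((hs.pre L).trans hu)
  have e' : Net.asc X r I ≫ (wh (cat X r) g ≫ pre t L) ≫ pre s L ≫ u =
      wh r (wh X g) ≫ pre t' (cat L X) := by
    simp only [Category.assoc]
    rw [← Category.assoc (pre t L), ← pre_comp, e, ← Category.assoc, ← Net.wh_asc, Category.assoc,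
      ← Category.assoc (Net.asc X r L), ← Net.pre_asc, Category.assoc, e1, Category.comp_id]
  rwa [e'] at this

theorem Sim.cons {v : K.Name} {I L : W.St} {g ts E} (h : K.Sim N v I L g ts E) (j) :
    K.Sim N v (j :: I) (j :: L) (g ▷ W.obj j) ts E := by
  intro r hr
  obtain ⟨r', t, i, h⟩ := h r hr
  refine ⟨r', t, i, ?_⟩
  have := h.pre [j]
  rw [wh_whiskerRight]
  simpa [pre] using this

theorem Sim.str {I L : W.St} {g} (v : K.Name) (h : W.Str I L g) : K.Sim N v I L g [] 0 := by
  intro r _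
  exact ⟨r, _, .nil r, by simpa using Net.Run.nil (h.wh r)⟩

theorem Sim.fire {v : K.Name} {I L : W.St} {g ts} {e : N.Ev}
    (h : ∀ r : W.St, K.key v ∈ tops r → ∃ r' t, K.Ins ts r r' t ∧
      N.Fire e (cat I r) (cat L r') (wh r g ≫ pre t L)) : K.Sim N v I L g ts {e} := by
  intro r hr
  obtain ⟨r', t, i, h⟩ := h r hr
  exact ⟨r', t, i, .fire h⟩

theorem wh_new (v : K.Name) (r I : W.St) : wh r (K.new v I) = K.new v (cat I r) :=
  wh_ins _ _ _

theorem Ins.wh {ts} {X T : W.St} {t} (h : K.Ins ts X T t) (r : W.St) :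
    K.Ins ts (cat X r) (cat T r) (WireSig.wh r t) := by
  induction h with
  | nil => rw [wh_id]; exact .nil _
  | cons v _ ih => rw [wh_comp, wh_new]; exact .cons v ih

/-- Insertion of a state below another. -/
def put {T : W.St} (n : 𝟙_ C ⟶ W.ctx T) : ∀ L : W.St, W.ctx L ⟶ W.ctx (cat L T)
  | [] => n
  | i :: L => put n L ▷ W.obj i

theorem jn_nil_pre {T : W.St} (n : 𝟙_ C ⟶ W.ctx T) (L : W.St) :
    (λ_ (W.ctx L)).inv ≫ (jn [] L).hom ≫ pre n L = put n L := by
  induction L with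
  | nil =>
    simp only [jn, pre, put]
    rw [unitors_inv_equal]
    simp
  | cons i L ih =>
    simp only [jn_cons_hom, pre, put, ← ih]
    simp

theorem wh_put_asc {T : W.St} (n : 𝟙_ C ⟶ W.ctx T) (r L : W.St) :
    wh r (put n L) ≫ Net.asc T r L = pre (wh (I := []) r n) L := by
  induction L with
  | nil => simp [put, Net.asc, pre]
  | cons i L ih =>
    simp only [put, Net.asc, pre, wh_whiskerRight, ← comp_whiskerRight, ih]

theorem jn_nil_single (i : Item W.Wire W.Box) : (jn (W := W) [] [i]).hom = (λ_ _).hom := by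
  simp [jn]

/-- Removal of a token. -/
def del (v : K.Name) (r : W.St) : W.ctx (.wire (K.wire v) :: r) ⟶ W.ctx r :=
  W.ctx r ◁ (K.unit v).inv ≫ (ρ_ (W.ctx r)).hom

theorem del_new (v : K.Name) (r : W.St) : K.del v r ≫ K.new v r = 𝟙 _ := by
  simp [del, new, ← MonoidalCategory.whiskerLeft_comp]

theorem new_del (v : K.Name) (r : W.St) : K.new v r ≫ K.del v r = 𝟙 _ := by
  simp [del, new, ← MonoidalCategory.whiskerLeft_comp_assoc]

/-- Events inside a box, and the closing of the box. -/
theorem Sim.box {y : K.Name} {b : W.Box} {a} {L : W.St} {g ts E}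
    (h : K.Sim N y [.wire a] (.wire (N.last b) :: L) g ts E) (v : K.Name) :
    K.Sim N v [.box b [.wire a, .wire (K.wire y)]] L
      (𝟙_ C ◁ (LeftClosed.coexp (W.boxOb b)).map (K.del y [] ▷ W.ob a) ≫ (λ_ _).hom ≫
        Structure.postpHom (g ≫ W.ctx L ◁ N.cls b)) (ts ++ [y]) (E + {.cls b}) := by
  -- Inside the box the surroundings consist of the token `y` alone.
  obtain ⟨T, t, i, h⟩ := h [.wire (K.wire y)] (by simp [key_wire])
  intro r _
  -- Closing the box releases its content: `y` and the tokens produced inside now belong to the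
  -- surroundings outside.
  refine ⟨cat T r, _, (Ins.cons y (Ins.nil r)).trans (i.wh r), ?_⟩
  have h₂ := (h.inBox b r).trans (.fire (.cls b (cat L T) r (.refl _) (.refl _)))
  have h₃ := h₂.str (.refl _) (Net.str_asc T r L)
  have e : (K.new y [] ▷ W.ob a) ≫ wh [.wire (K.wire y)] g ≫ pre t (.wire (N.last b) :: L) =
      g ≫ put (K.new y [] ≫ t) L ▷ W.ob (N.last b) := by
    have e1 := wh_pre g (K.new y [])
    have e2 : K.new y [] ▷ W.ob a = pre (K.new y []) [.wire a] := rfl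
    have e3 := jn_nil_pre (K.new y [] ≫ t) (.wire (N.last b) :: L)
    have e4 : wh [] g = g ≫ (λ_ _).inv ≫ (jn [] (.wire (N.last b) :: L)).hom := by
      rw [wh, Iso.inv_comp_eq, jn_nil_single]
      rw [← leftUnitor_naturality_assoc, Iso.hom_inv_id_assoc]
    rw [e2, ← Category.assoc, ← e1, Category.assoc, ← pre_comp, e4, Category.assoc, Category.assoc,
      e3]
    rfl
  have e' : Net.boxMap b (wh [.wire (K.wire y)] g ≫ pre t (.wire (N.last b) :: L)) ≫
      N.close b (cat L T) = (𝟙_ C ◁ (LeftClosed.coexp (W.boxOb b)).map (K.del y [] ▷ W.ob a) ≫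
        (λ_ _).hom ≫ Structure.postpHom (g ≫ W.ctx L ◁ N.cls b)) ≫ put (K.new y [] ≫ t) L := by
    have e5 : wh [.wire (K.wire y)] g ≫ pre t (.wire (N.last b) :: L) =
        K.del y [] ▷ W.ob a ≫ g ≫ put (K.new y [] ≫ t) L ▷ W.ob (N.last b) := by
      rw [← e, ← comp_whiskerRight_assoc, del_new]
      simp
    rw [e5, Net.boxMap, Net.close, leftUnitor_naturality_assoc, leftUnitor_naturality_assoc,
      Category.assoc, Category.assoc, Structure.postpHom_comp, Structure.map_postpHom,
      Structure.map_postpHom, Category.assoc, Category.assoc, Category.assoc, whisker_exchange]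
  have e'' : 𝟙 _ ≫ (wh r (Net.boxMap b (wh [.wire (K.wire y)] g ≫
      pre t (.wire (N.last b) :: L))) ≫ 𝟙 _ ≫ wh r (N.close b (cat L T)) ≫ 𝟙 _) ≫
        Net.asc T r L = wh r (𝟙_ C ◁ (LeftClosed.coexp (W.boxOb b)).map (K.del y [] ▷ W.ob a) ≫
        (λ_ _).hom ≫ Structure.postpHom (g ≫ W.ctx L ◁ N.cls b)) ≫
        pre ((𝟙 _ ≫ K.new y r) ≫ wh r t) L := by
    have e6 := wh_put_asc (K.new y [] ≫ t) r L
    rw [wh_comp r (I := []), wh_new] at e6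
    simp only [Category.id_comp, Category.comp_id]
    rw [← wh_comp, e', wh_comp, Category.assoc, e6]
  rwa [e''] at h₃

end Tokens
end CoILL

namespace CoILL

universe u

set_option linter.unusedSectionVars false

/-! ### Wire terms -/

/-- Terms that label wires; in `conn v`, the name `v` stands for the link of a `connect to`. -/
inductive Wr (G : Type u) : Type u where
  | var (v : Var G)
  | app (y : Var G) (W : Wr G)
  | conn (v : Var G)
  | par (W₀ W₁ : Wr G)
  | casel (W : Wr G)
  | caser (W : Wr G)
  | mkc (W : Wr G) (y : Var G)

/-- The name that locates a wire. -/
def Wr.hd {G : Type u} : Wr G → Var G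
  | .var v => v
  | .app y _ => y
  | .conn v => v
  | .par W₀ _ => W₀.hd
  | .casel W => W.hd
  | .caser W => W.hd
  | .mkc _ y => y

/-- The wires that are built from links only. -/
def Wr.Link {G : Type u} : Wr G → Prop
  | .conn _ => True
  | .par W₀ W₁ => W₀.Link ∧ W₁.Link
  | .casel W => W.Link
  | .caser W => W.Link
  | _ => False

/-- The formulas built from `⊥` by `⅋`. -/
def Ty.Trivial {G : Type u} : Ty G → Prop
  | .bot => True
  | .par A B => A.Trivial ∧ B.Trivial
  | _ => False

/-- The wire term of a term, in an environment. -/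
def Tm.wr {G : Type u} (ρ : Var G → Wr G) : Tm G → Wr G
  | .var y => ρ y
  | .app y M => .app y (M.wr ρ)
  | .connect R => .conn (R.wr ρ).hd
  | .par M N => .par (M.wr ρ) (N.wr ρ)
  | .casel M => .casel (M.wr ρ)
  | .caser M => .caser (M.wr ρ)
  | .mkc M y => .mkc (M.wr ρ) y
  -- A p-term occupies no wire. Only the head of its value matters: it names the token at which a
  -- link to the p-term is located.
  | .postp₂ y _ _ => .conn y
  | .postp M => .conn (M.wr ρ).hd

open Classical in
/-- Update of an environment. -/
noncomputable def upd {G : Type u} (ρ : Var G → Wr G) (x : Var G) (W : Wr G) : Var G → Wr G :=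
  fun v => if v = x then W else ρ v

@[simp] theorem upd_self {G : Type u} (ρ : Var G → Wr G) (x : Var G) (W : Wr G) :
    upd ρ x W x = W := by simp [upd]

/-- Substitution turns into a change of environment. No freshness is needed, since the value of a
`postp₂` ignores its subterms. -/
theorem Tm.wr_subst {G : Type u} (ρ : Var G → Wr G) (x : Var G) (M t : Tm G) :
    (Tm.subst x M t).wr ρ = t.wr (upd ρ x (M.wr ρ)) := by
  induction t with
  | var y =>
    by_cases h : y = x <;> simp [Tm.subst, Tm.wr, upd, h]
  | _ => simp_all [Tm.subst, Tm.wr]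

/-- Labels of wires: typed wire terms, and tokens that mark locations. -/
inductive Lab (G : Type u) : Type u where
  | w (W : Wr G) (A : Ty G)
  | tok (v : Var G)

/-- The box of `postp(y ↦ N, M)`, where `M : y.ty ∖ B`. -/
structure Bx (G : Type u) : Type u where
  y : Var G
  W : Wr G
  N : Wr G
  B : Ty G

variable {G : Type u} {C : Type*} [Category C] [MonoidalCategory C] [SymmetricCategory C]
  [LeftClosed C]

open WireSig Classical

namespace Structure

/-- The gates: the steps of a derivation that are not structural. -/
inductive Gt (G : Type u) : Type u where
  | split (W : Wr G) (A B : Ty G)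
  | join (W₀ W₁ : Wr G) (A B : Ty G)
  | mk (W : Wr G) (A : Ty G) (y : Var G)
  | kill (W : Wr G)
  | opn (b : Bx G)

/-- The name that locates a gate. -/
def Gt.hd : Gt G → Var G
  | .split W _ _ => W.hd
  | .join W _ _ _ => W.hd
  | .mk W _ _ => W.hd
  | .kill W => W.hd
  | .opn b => b.W.hd

/-- The box opened by an elimination of `∖`. -/
noncomputable def bx (ρ : Var G → Wr G) (y : Var G) (N M : Tm G) (B : Ty G) : Bx G :=
  -- Inside the box the bound variable stands for the wire `y(M)`. The label already names the wire
  -- on which the box will be closed.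
  ⟨y, M.wr ρ, N.wr (upd ρ y (.app y (M.wr ρ))), B⟩

variable (S : Structure G C)

/-- The objects built from the unit by tensor products are isomorphic to the unit. -/
def unitIso : ∀ A : Ty G, A.Trivial → (S.ty A ≅ 𝟙_ C)
  | .bot, _ => Iso.refl _
  | .par A B, h => (unitIso A h.1 ⊗ᵢ unitIso B h.2) ≪≫ λ_ _

/-- The signature of labelled wires. -/
def sig : WireSig.{u} C where
  Wire := Lab G
  Box := Bx G
  ob
    | .w _ A => S.ty A
    | .tok _ => 𝟙_ C
  boxOb b := S.ty b.B
  Triv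
    -- Both conditions matter: a wire that descends from a variable or a function keeps its key even
    -- if its object is isomorphic to the unit, so that its removal counts as an event.
    | .w W A => W.Link ∧ A.Trivial
    | .tok _ => False
  unitIso
    | .w _ A, h => S.unitIso A h.2

/-- The label of a typed wire. -/
def wl (W : Wr G) (A : Ty G) : S.sig.Wire := Lab.w W A

/-- A typed wire. -/
abbrev wi (W : Wr G) (A : Ty G) : Item S.sig.Wire S.sig.Box := .wire (S.wl W A)

/-- The tokens are the names. -/
@[reducible]
def toks : Tokens S.sig where
  Name := Var G
  wire := Lab.tok
  not_triv _ h := h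
  unit _ := Iso.refl _

/-- A token. -/
abbrev tk (v : Var G) : Item S.sig.Wire S.sig.Box := .wire (S.toks.wire v)

/-- A box. -/
abbrev bo (b : Bx G) (L : S.sig.St) : Item S.sig.Wire S.sig.Box := .box b L

/-- The wires consumed by a gate. -/
def gin : Gt G → S.sig.St
  | .split W A B => [S.wi W (.par A B)]
  | .join W₀ W₁ A B => [S.wi W₁ B, S.wi W₀ A]
  | .mk W A _ => [S.wi W A]
  | .kill W => [S.wi W .bot]
  | .opn b => [S.wi b.W (.sub b.y.ty b.B)]

/-- The wires and boxes produced by a gate. -/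
def gout : Gt G → S.sig.St
  | .split W A B => [S.wi (.caser W) B, S.wi (.casel W) A]
  | .join W₀ W₁ A B => [S.wi (.par W₀ W₁) (.par A B)]
  | .mk W A y => [S.wi (.mkc W y) (.sub A y.ty), S.wi (.app y W) y.ty, S.tk y]
  | .kill _ => []
  -- The box receives a token of its own, so that gates fed by links can be located inside it.
  | .opn b => [S.bo b [S.wi (.app b.y b.W) b.y.ty, S.tk b.y]]

/-- The interpretation of a split. -/
def splitMor (W : Wr G) (A B : Ty G) :
    S.sig.ctx [S.wi W (.par A B)] ⟶ S.sig.ctx [S.wi (.caser W) B, S.wi (.casel W) A] :=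
  (α_ (𝟙_ C) (S.ty A) (S.ty B)).inv

/-- The interpretation of a join. -/
def joinMor (W₀ W₁ : Wr G) (A B : Ty G) :
    S.sig.ctx [S.wi W₁ B, S.wi W₀ A] ⟶ S.sig.ctx [S.wi (.par W₀ W₁) (.par A B)] :=
  (α_ (𝟙_ C) (S.ty A) (S.ty B)).hom

/-- The interpretation of a make-coroutine gate, up to a token. -/
def mkMor (W : Wr G) (A : Ty G) (y : Var G) : S.sig.ctx [S.wi W A] ⟶
    S.sig.ctx [S.wi (.mkc W y) (.sub A y.ty), S.wi (.app y W) y.ty] :=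
  𝟙_ C ◁ mkcHom (S.ty A) (S.ty y.ty) ≫ (α_ (𝟙_ C) (S.ty y.ty) (S.ty (.sub A y.ty))).inv

/-- The interpretation of the removal of a wire of type `⊥`. -/
def killMor (W : Wr G) : S.sig.ctx [S.wi W .bot] ⟶ S.sig.ctx [] := (ρ_ (𝟙_ C)).hom

/-- The interpretation of the opening of a box. -/
def opnMor (b : Bx G) : S.sig.ctx [S.wi b.W (.sub b.y.ty b.B)] ⟶
    S.sig.ctx [S.bo b [S.wi (.app b.y b.W) b.y.ty, S.tk b.y]] :=
  𝟙_ C ◁ (LeftClosed.coexp (S.ty b.B)).map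
    ((λ_ (S.ty b.y.ty)).inv ≫ S.toks.new b.y [] ▷ S.ty b.y.ty)

/-- The interpretation of a gate. -/
def gmor : ∀ g : Gt G, S.sig.ctx (S.gin g) ⟶ S.sig.ctx (S.gout g)
  | .split W A B => S.splitMor W A B
  | .join W₀ W₁ A B => S.joinMor W₀ W₁ A B
  | .mk W A y => S.mkMor W A y ≫
      pre (S.toks.new y []) [S.wi (.mkc W y) (.sub A y.ty), S.wi (.app y W) y.ty]
  | .kill W => S.killMor W
  | .opn b => S.opnMor b

theorem key_wi {W : Wr G} {A : Ty G} (h : ¬ (W.Link ∧ A.Trivial)) :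
    key (S.wi W A) = {.inl (S.wl W A)} := key_wire h

theorem key_wi_triv {W : Wr G} {A : Ty G} (h : W.Link ∧ A.Trivial) : key (S.wi W A) = 0 :=
  key_triv h

theorem key_wi_le (W : Wr G) (A : Ty G) : key (S.wi W A) ≤ {.inl (S.wl W A)} := by
  by_cases h : W.Link ∧ A.Trivial
  · simp [key_wi_triv, h]
  · rw [key_wi _ h]

theorem tok_notMem_wi (v : Var G) (W A) : S.toks.key v ∉ key (S.wi W A) := by
  intro h
  have := Multiset.mem_of_le (S.key_wi_le W A) h
  have e : (Lab.tok v : Lab G) = .w W A := Sum.inl.inj (Multiset.mem_singleton.1 this)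
  cases e

theorem tok_notMem_gin (v : Var G) (g : Gt G) : S.toks.key v ∉ tops (S.gin g) := by
  cases g <;> simp only [gin, tops_cons, tops_nil, add_zero, Multiset.mem_add, tok_notMem_wi,
    or_self, not_false_eq_true]

theorem box_notMem_gin (b : S.sig.Box) (g : Gt G) : (.inr b : S.sig.Key) ∉ tops (S.gin g) := by
  have h : ∀ W A, (.inr b : S.sig.Key) ∉ key (S.wi W A) := fun W A => Net.inr_notMem_key_wire _ _
  cases g <;> simp only [gin, tops_cons, tops_nil, add_zero, Multiset.mem_add, h, or_self,
    not_false_eq_true]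

/-- The net of the calculus. -/
noncomputable def net : Net S.sig where
  Gate := Gt G
  ins := S.gin
  outs := S.gout
  mor := S.gmor
  -- A gate that consumes no key would not be tied to any place. It reads the token of its head name
  -- instead, and this token is then its anchor.
  rd g := if tops (S.gin g) = 0 then {S.toks.key g.hd} else 0
  anc g := if h : ∃ k, k ∈ tops (S.gin g) then h.choose else S.toks.key g.hd
  last b := S.wl b.N b.B
  cls b := 𝟙 (S.ty b.B)
  anc_mem g := by
    by_cases h : tops (S.gin g) = 0
    · simp [h]
    · obtain ⟨k, hk⟩ := Multiset.exists_mem_of_ne_zero h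
      left
      rw [dif_pos ⟨k, hk⟩]
      exact (⟨k, hk⟩ : ∃ k, k ∈ tops (S.gin g)).choose_spec
  box_ins g b := S.box_notMem_gin b g
  rd_ins g g' k hk := by
    split_ifs at hk
    · rw [Multiset.mem_singleton.1 hk]; exact S.tok_notMem_gin _ _
    · simp at hk
  rd_last g b k hk := by
    split_ifs at hk
    · rw [Multiset.mem_singleton.1 hk]; exact S.tok_notMem_wi _ _ _
    · simp at hk
  rd_box g b hk := by
    split_ifs at hk
    · have := Multiset.mem_singleton.1 hk
      cases this
    · simp at hk

/-- The event of a gate. -/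
noncomputable def ge (g : Gt G) : S.net.Ev := .gate g

/-- The event that closes a box. -/
noncomputable def ce (b : Bx G) : S.net.Ev := .cls b

/-- The event of a gate, unless the gate is structural. -/
noncomputable def gev (g : Gt G) : Multiset S.net.Ev :=
  -- Splits, joins and removals of trivial wires are composites of structural insertions and
  -- deletions, hence no events.
  if tops (S.gin g) = 0 then 0 else {S.ge g}

/-- The events of a derivation. -/
noncomputable def events {x : Var G} {κ : Cx G} {Γ : List (Ty G)} :
    Deriv x κ Γ → (Var G → Wr G) → Multiset S.net.Ev
  | .ax _, _ => 0
  | .exch _ d, ρ => events d ρ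
  | .cut (x := x) (M := M) d e _, ρ => events d ρ + events e (upd ρ x (M.wr ρ))
  | .parI (M₀ := M₀) (M₁ := M₁) (A := A) (B := B) d, ρ =>
      events d ρ + S.gev (.join (M₀.wr ρ) (M₁.wr ρ) A B)
  | .parE (x := x) (y := y) (N := N) d e f _ _ _, ρ =>
      events d ρ + (S.gev (.split (N.wr ρ) x.ty y.ty) + (events e (upd ρ x (.casel (N.wr ρ))) +
        events f (upd ρ y (.caser (N.wr ρ)))))
  | .subI (y := y) (M := M) (A := A) d e _, ρ =>
      events d ρ + ({S.ge (.mk (M.wr ρ) A y)} + events e (upd ρ y (.app y (M.wr ρ))))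
  | .subE (y := y) (M := M) (N := N) (B := B) d e _, ρ =>
      events d ρ + ({S.ge (.opn (bx ρ y N M B))} +
        (events e (upd ρ y (.app y (M.wr ρ))) + {S.ce (bx ρ y N M B)}))
  | .botI d _, ρ => events d ρ
  | .botE n, ρ => S.gev (.kill (ρ ⟨n, .bot⟩))

/-! ### Simulation of derivations by runs -/

/-- `S.Lift Ws Γ L i`: the state `L` consists of the wires `Ws` of types `Γ`. -/
inductive Lift : List (Wr G) → ∀ (Γ : List (Ty G)) (L : S.sig.St), (S.ctx Γ ⟶ S.sig.ctx L) → Prop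
  | nil : Lift [] [] [] (𝟙 (𝟙_ C))
  | cons (W A) {Ws Γ L i} : Lift Ws Γ L i →
      Lift (W :: Ws) (A :: Γ) (S.wi W A :: L) (i ▷ S.ty A)

variable {S}

theorem whisker_aux {X Y U V A : C} (i : X ⟶ U) (j : Y ⟶ V) {R T : C} (m : X ⊗ Y ⟶ R)
    (k : R ⟶ T) (J : U ⊗ V ⟶ T) (h : m ≫ k = (i ⊗ₘ j) ≫ J) :
    ((α_ X Y A).inv ≫ m ▷ A) ≫ k ▷ A = (i ⊗ₘ (j ▷ A)) ≫ (α_ U V A).inv ≫ J ▷ A := by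
  rw [Category.assoc, ← comp_whiskerRight, h]
  simp [MonoidalCategory.tensorHom_def]

theorem Lift.append {Ws Γ L i Vs Δ L' j} (h : S.Lift Ws Γ L i) (h' : S.Lift Vs Δ L' j) :
    ∃ k, S.Lift (Vs ++ Ws) (Δ ++ Γ) (cat L' L) k ∧
      S.join Γ Δ ≫ k = (i ⊗ₘ j) ≫ (jn L L').hom := by
  induction h' with
  | nil =>
    refine ⟨i, h, ?_⟩
    have : (ρ_ (S.ctx Γ)).hom ≫ i = (i ⊗ₘ 𝟙 (𝟙_ C)) ≫ (ρ_ (S.sig.ctx L)).hom := by simp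
    exact this
  | cons W A _ ih =>
    obtain ⟨k, hk, e⟩ := ih
    exact ⟨_, .cons W A hk, whisker_aux _ _ _ _ _ e⟩

theorem sw_aux {X U : C} (i : X ⟶ U) (A B : C) :
    (i ▷ A ▷ B) ≫ sw U A B = sw X A B ≫ i ▷ B ▷ A := by
  simpa using sw_naturality i (𝟙 A) (𝟙 B)

theorem Lift.swapAt {Ws Γ L i} (n : ℕ) (h : S.Lift Ws Γ L i) :
    ∃ L' i' s, S.Lift (swapAt n Ws) (swapAt n Γ) L' i' ∧ S.sig.Str L L' s ∧
      i ≫ s = S.swapHom n Γ ≫ i' := by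
  induction n generalizing Ws Γ L with
  | zero =>
    cases h with
    | nil => exact ⟨_, _, _, .nil, .refl _, (Category.comp_id _).trans (Category.id_comp _).symm⟩
    | cons W A h =>
      cases h with
      | nil => exact ⟨_, _, _, .cons W A .nil, .refl _,
        (Category.comp_id _).trans (Category.id_comp _).symm⟩
      | cons W' A' h =>
        exact ⟨_, _, _, .cons _ _ (.cons _ _ h), .swap _ _ _, sw_aux _ _ _⟩
  | succ n ih =>
    cases h with
    | nil => exact ⟨_, _, _, .nil, .refl _, (Category.comp_id _).trans (Category.id_comp _).symm⟩
    | cons W A h =>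
      obtain ⟨L', i', s, h', hs, e⟩ := ih h
      refine ⟨_, _, _, .cons W A h', .cons _ hs, ?_⟩
      exact (comp_whiskerRight _ _ _).symm.trans
        ((congrArg (· ▷ S.ty A) e).trans (comp_whiskerRight _ _ _))

theorem Lift.unique {Ws Γ L i L' i'} (h : S.Lift Ws Γ L i) (h' : S.Lift Ws Γ L' i') :
    ∃ e : L = L', e ▸ i = i' := by
  induction h generalizing L' with
  | nil => cases h'; exact ⟨rfl, rfl⟩
  | cons W A _ ih =>
    cases h' with
    | cons _ _ h' => obtain ⟨rfl, rfl⟩ := ih h'; exact ⟨rfl, rfl⟩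

theorem Lift.isIso {Ws Γ L i} (h : S.Lift Ws Γ L i) : IsIso i := by
  induction h with
  | nil => exact inferInstanceAs (IsIso (𝟙 (𝟙_ C)))
  | cons W A _ ih => exact inferInstanceAs (IsIso (_ ▷ S.ty A))

end Structure
end CoILL

-- Simulation of single gates and of boxes

namespace CoILL

universe u

set_option linter.unusedSectionVars false

variable {G : Type u} {C : Type*} [Category C] [MonoidalCategory C] [SymmetricCategory C]
  [LeftClosed C]

open WireSig Classical

theorem WireSig.wh_single {W : WireSig.{u} C} (r : W.St) {i} {O : W.St} (f : W.obj i ⟶ W.ctx O) :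
    wh (I := [i]) r ((λ_ (W.obj i)).hom ≫ f) = W.ctx r ◁ f ≫ (jn r O).hom := by
  rw [wh, Iso.inv_comp_eq]
  simp [jn]

namespace Structure

variable {S : Structure G C}

theorem trivial_of_key_wi {W : Wr G} {A : Ty G} (h : key (S.wi W A) = 0) :
    W.Link ∧ A.Trivial := by
  by_contra h'
  rw [S.key_wi h'] at h
  simp at h

theorem gate_rd {g : Gt G} {k} (h : k ∈ S.net.rd g) : k = S.toks.key g.hd := by
  change k ∈ (if tops (S.gin g) = 0 then {S.toks.key g.hd} else 0) at h
  split_ifs at h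
  · exact Multiset.mem_singleton.1 h
  · simp at h

theorem fire_gate (g : Gt G) {r : S.sig.St} (hr : S.toks.key g.hd ∈ tops r) :
    S.net.Fire (S.ge g) (cat (S.gin g) r) (cat (S.gout g) r) (wh r (S.gmor g)) := by
  have := Net.Fire.gate (N := S.net) g (L := cat (S.gin g) r) (L' := cat (S.gout g) r) r
    (fun k hk => by
      rw [gate_rd hk, tops_cat, Multiset.mem_add]; exact .inr hr) (.refl _) (.refl _)
  have e : wh r (S.gmor g) = 𝟙 _ ≫ wh r (S.gmor g) ≫ 𝟙 _ := by simp
  rw [e]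
  exact this

theorem sim_gate (g : Gt G) : S.toks.Sim S.net g.hd (S.gin g) (S.gout g) (S.gmor g) [] {S.ge g} :=
  .fire fun r hr => ⟨r, _, .nil r, by rw [pre_id, Category.comp_id]; exact fire_gate g hr⟩

theorem sim_gev (g : Gt G) (h : tops (S.gin g) = 0 → S.sig.Str (S.gin g) (S.gout g) (S.gmor g)) :
    S.toks.Sim S.net g.hd (S.gin g) (S.gout g) (S.gmor g) [] (S.gev g) := by
  by_cases hg : tops (S.gin g) = 0
  · rw [gev, if_pos hg]; exact .str _ (h hg)
  · rw [gev, if_neg hg]; exact sim_gate g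

/-- The isomorphism of a trivial `A ⊗ B` with the unit is composed from those of `A` and `B`. So
splitting a trivial wire amounts to deleting it and inserting its two components; `join_aux` is the
inverse statement. -/
theorem split_aux {A B : C} (a : A ≅ 𝟙_ C) (b : B ≅ 𝟙_ C) (X : C) :
    (X ◁ ((a ⊗ᵢ b) ≪≫ λ_ _).hom ≫ (ρ_ _).hom) ≫ ((ρ_ _).inv ≫ X ◁ a.inv) ≫
      (ρ_ _).inv ≫ (X ⊗ A) ◁ b.inv = (α_ X A B).inv := by
  rw [← cancel_mono ((X ⊗ A) ◁ b.hom), ← cancel_mono (ρ_ _).hom, ← cancel_mono (X ◁ a.hom)]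
  simp only [Category.assoc, ← MonoidalCategory.whiskerLeft_comp, Iso.inv_hom_id, Iso.trans_hom,
    tensorIso_hom]
  simp [tensorHom_def', unitors_equal]

theorem join_aux {A B : C} (a : A ≅ 𝟙_ C) (b : B ≅ 𝟙_ C) (X : C) :
    ((X ⊗ A) ◁ b.hom ≫ (ρ_ _).hom) ≫ (X ◁ a.hom ≫ (ρ_ _).hom) ≫
      (ρ_ _).inv ≫ X ◁ ((a ⊗ᵢ b) ≪≫ λ_ _).inv = (α_ X A B).hom := by
  rw [← cancel_epi (α_ X A B).inv, Iso.inv_hom_id, ← split_aux a b]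
  simp only [Category.assoc, ← MonoidalCategory.whiskerLeft_comp_assoc, Iso.inv_hom_id,
    MonoidalCategory.whiskerLeft_id, Category.id_comp, Iso.inv_hom_id_assoc, Iso.hom_inv_id_assoc,
    ← MonoidalCategory.whiskerLeft_comp, Iso.hom_inv_id]

theorem sim_split (W : Wr G) (A B : Ty G) :
    S.toks.Sim S.net W.hd [S.wi W (.par A B)] [S.wi (.caser W) B, S.wi (.casel W) A]
      (S.splitMor W A B) [] (S.gev (.split W A B)) :=
  sim_gev (.split W A B) fun h => by
    have h : W.Link ∧ (Ty.par A B).Trivial := trivial_of_key_wi (by simpa [gin] using h)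
    have h₁ := Str.del (W := S.sig) [] (S.wl W (.par A B)) h
    have h₂ := Str.ins (W := S.sig) [] (S.wl (.casel W) A) ⟨h.1, h.2.1⟩
    have h₃ := Str.ins (W := S.sig) [S.wi (.casel W) A] (S.wl (.caser W) B) ⟨h.1, h.2.2⟩
    have e := split_aux (S.unitIso A h.2.1) (S.unitIso B h.2.2) (𝟙_ C)
    exact (congrArg (S.sig.Str _ _) e).mp (h₁.trans (h₂.trans h₃))

theorem sim_join (W₀ W₁ : Wr G) (A B : Ty G) :
    S.toks.Sim S.net W₀.hd [S.wi W₁ B, S.wi W₀ A] [S.wi (.par W₀ W₁) (.par A B)]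
      (S.joinMor W₀ W₁ A B) [] (S.gev (.join W₀ W₁ A B)) :=
  sim_gev (.join W₀ W₁ A B) fun h => by
    have h' : key (S.wi W₁ B) = 0 ∧ key (S.wi W₀ A) = 0 := by simpa [gin] using h
    have t₀ := trivial_of_key_wi h'.2
    have t₁ := trivial_of_key_wi h'.1
    have h₁ := Str.del (W := S.sig) [S.wi W₀ A] (S.wl W₁ B) t₁
    have h₂ := Str.del (W := S.sig) [] (S.wl W₀ A) t₀
    have h₃ := Str.ins (W := S.sig) [] (S.wl (.par W₀ W₁) (.par A B)) ⟨⟨t₀.1, t₁.1⟩, t₀.2, t₁.2⟩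
    have e := join_aux (S.unitIso A t₀.2) (S.unitIso B t₁.2) (𝟙_ C)
    exact (congrArg (S.sig.Str _ _) e).mp (h₁.trans (h₂.trans h₃))

theorem sim_kill (W : Wr G) :
    S.toks.Sim S.net W.hd [S.wi W .bot] [] (S.killMor W) [] (S.gev (.kill W)) :=
  sim_gev (.kill W) fun h => by
    have t : W.Link ∧ (Ty.bot : Ty G).Trivial := trivial_of_key_wi (by simpa [gin] using h)
    have h₁ := Str.del (W := S.sig) [] (S.wl W .bot) t
    have e : 𝟙_ C ◁ 𝟙 (𝟙_ C) ≫ (ρ_ (𝟙_ C)).hom = (ρ_ (𝟙_ C)).hom := by simp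
    exact (congrArg (S.sig.Str _ _) e).mp h₁

/-- The gate makes its token below the two new wires, so in the simulation it counts as an addition
to the surroundings. -/
theorem sim_mk (W : Wr G) (A : Ty G) (y : Var G) :
    S.toks.Sim S.net W.hd [S.wi W A] [S.wi (.mkc W y) (.sub A y.ty), S.wi (.app y W) y.ty]
      (S.mkMor W A y) [y] {S.ge (.mk W A y)} :=
  .fire fun r hr => by
    refine ⟨_, _, .cons (K := S.toks) y (.nil r), ?_⟩
    have := fire_gate (.mk W A y) (r := r) hr
    have e : wh r (S.gmor (.mk W A y)) = wh r (S.mkMor W A y) ≫ pre (𝟙 _ ≫ S.toks.new y r)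
        [S.wi (.mkc W y) (.sub A y.ty), S.wi (.app y W) y.ty] := by
      have e₁ := wh_whiskerRight r (S.toks.new y []) (S.wi (.app y W) y.ty)
      have e₂ := wh_whiskerRight r (I := [S.wi (.app y W) y.ty])
        (J := [S.wi (.app y W) y.ty, S.tk y]) (S.toks.new y [] ▷ S.sig.obj (S.wi (.app y W) y.ty))
        (S.wi (.mkc W y) (.sub A y.ty))
      rw [e₁, Tokens.wh_new] at e₂
      rw [Category.id_comp]
      exact (wh_comp r _ _).trans (congrArg (wh r (S.mkMor W A y) ≫ ·) e₂)
    rw [e] at this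
    exact this

theorem sim_opn (b : Bx G) :
    S.toks.Sim S.net b.W.hd [S.wi b.W (.sub b.y.ty b.B)]
      [S.bo b [S.wi (.app b.y b.W) b.y.ty, S.tk b.y]] (S.opnMor b) [] {S.ge (.opn b)} :=
  sim_gate (.opn b)

/-- The token inserted on opening cancels against its removal in `Tokens.Sim.box`; what is left is
the transpose of the morphism computed inside. -/
theorem sim_box {b : Bx G} {L : S.sig.St}
    {f : S.sig.ob (S.wl (.app b.y b.W) b.y.ty) ⟶ S.sig.ctx (S.wi b.N b.B :: L)} {ts E}
    (h : S.toks.Sim S.net b.y [S.wi (.app b.y b.W) b.y.ty] (S.wi b.N b.B :: L)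
      ((λ_ _).hom ≫ f) ts E) {p : S.sig.ob (S.wl b.W (.sub b.y.ty b.B)) ⟶ S.sig.ctx L}
    (hp : p = postpHom (A := S.ty b.y.ty) (B := S.ty b.B) f) :
    S.toks.Sim S.net b.W.hd [S.wi b.W (.sub b.y.ty b.B)] L ((λ_ _).hom ≫ p)
      (ts ++ [b.y]) ({S.ge (.opn b)} + (E + {S.ce b})) := by
  have h₁ := (sim_opn b).trans (h.box b.W.hd) (.inl rfl)
  rw [List.append_nil] at h₁
  have e : ∀ {A Y Z B : C} (u : 𝟙_ C ⊗ A ⟶ Z) (v : Z ⟶ 𝟙_ C ⊗ A) (f : A ⟶ Y ⊗ B),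
      u ≫ v = 𝟙 _ → 𝟙_ C ◁ (LeftClosed.coexp B).map ((λ_ A).inv ≫ u) ≫
        𝟙_ C ◁ (LeftClosed.coexp B).map v ≫ (λ_ _).hom ≫
          postpHom (((λ_ A).hom ≫ f) ≫ Y ◁ 𝟙 B) = (λ_ _).hom ≫ postpHom f := by
    intro A Y Z B u v f h
    rw [leftUnitor_naturality_assoc, leftUnitor_naturality_assoc, map_postpHom, map_postpHom]
    simp [reassoc_of% h]
  have e' := e (S.toks.new b.y [] ▷ S.ty b.y.ty) (S.toks.del b.y [] ▷ S.ty b.y.ty) f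
    (by
      have := congrArg (· ▷ S.ty b.y.ty) (S.toks.new_del b.y [])
      exact (comp_whiskerRight _ _ _).symm.trans (this.trans (id_whiskerRight _ _)))
  subst hp
  exact (congrArg (fun g => S.toks.Sim S.net b.W.hd [S.wi b.W (.sub b.y.ty b.B)] L g
    (ts ++ [b.y]) ({S.ge (.opn b)} + (E + {S.ce b}))) e').mp h₁

/-- The identification of sequences with states passes through a cut by the interchange law.
`whisker_subI` and `whisker_parE` do the same for the other composite rules. -/
theorem whisker_cut {P X Y D U V R T : C} (d : P ⟶ X ⊗ Y) (e : Y ⟶ D) (i : X ⟶ U) (j : D ⟶ V)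
    (m : X ⊗ D ⟶ R) (k : R ⟶ T) (J : U ⊗ V ⟶ T) (h : m ≫ k = (i ⊗ₘ j) ≫ J) :
    (d ≫ i ▷ Y) ≫ U ◁ (e ≫ j) ≫ J = (d ≫ X ◁ e ≫ m) ≫ k := by
  simp only [Category.assoc, h, MonoidalCategory.tensorHom_def, MonoidalCategory.whiskerLeft_comp]
  rw [whisker_exchange_assoc]

theorem whisker_subI {P X A Y D E U V R T : C} (d : P ⟶ X ⊗ A) (m : A ⟶ Y ⊗ D) (e : Y ⟶ E)
    (i : X ⟶ U) (j : E ⟶ V) (n : X ⊗ E ⟶ R) (k : R ⟶ T) (J : U ⊗ V ⟶ T)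
    (h : n ≫ k = (i ⊗ₘ j) ≫ J) :
    (d ≫ i ▷ A) ≫ (U ◁ m ≫ (α_ _ _ _).inv) ≫ (U ◁ (e ≫ j) ≫ J) ▷ D =
      (d ≫ X ◁ m ≫ X ◁ (e ▷ D) ≫ (α_ _ _ _).inv ≫ n ▷ D) ≫ k ▷ D := by
  have h' := congrArg (· ▷ D) h
  simp only [comp_whiskerRight] at h'
  simp only [Category.assoc, h', MonoidalCategory.tensorHom_def, comp_whiskerRight,
    MonoidalCategory.whiskerLeft_comp]
  rw [← whisker_exchange_assoc, ← associator_inv_naturality_middle_assoc,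
    ← whisker_exchange_assoc, associator_inv_naturality_left_assoc]

theorem whisker_parE {P X A B E F U V V' R R' T T' : C} (d : P ⟶ X ⊗ (A ⊗ B)) (e : A ⟶ E)
    (f : B ⟶ F) (i : X ⟶ U) (j : E ⟶ V) (j' : F ⟶ V') (m : X ⊗ E ⟶ R) (k : R ⟶ T)
    (J : U ⊗ V ⟶ T) (h : m ≫ k = (i ⊗ₘ j) ≫ J) (m' : R ⊗ F ⟶ R') (k' : R' ⟶ T')
    (J' : T ⊗ V' ⟶ T') (h' : m' ≫ k' = (k ⊗ₘ j') ≫ J') :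
    (d ≫ i ▷ (A ⊗ B)) ≫ (α_ _ _ _).inv ≫ (U ◁ (e ≫ j) ≫ J) ▷ B ≫ T ◁ (f ≫ j') ≫ J' =
      (d ≫ X ◁ (e ⊗ₘ f) ≫ (α_ _ _ _).inv ≫ m ▷ F ≫ m') ≫ k' := by
  have h₁ := congrArg (· ▷ F) h
  simp only [comp_whiskerRight] at h₁
  simp only [Category.assoc, h', MonoidalCategory.tensorHom_def, comp_whiskerRight,
    MonoidalCategory.whiskerLeft_comp, reassoc_of% h₁]
  rw [← whisker_exchange_assoc, ← whisker_exchange_assoc, ← whisker_exchange_assoc,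
    ← associator_inv_naturality_right_assoc, ← associator_inv_naturality_middle_assoc,
    ← associator_inv_naturality_left_assoc, whisker_exchange_assoc, whisker_exchange_assoc,
    ← MonoidalCategory.whiskerLeft_comp_assoc, ← MonoidalCategory.whiskerLeft_comp_assoc,
    whisker_exchange]

variable (S) in
/-- The interpretation of a split in a state. -/
def splitHom (W : Wr G) (A B : Ty G) (r : S.sig.St) : S.sig.ctx (S.wi W (.par A B) :: r) ⟶
    S.sig.ctx (S.wi (.caser W) B :: S.wi (.casel W) A :: r) :=
  (α_ (S.sig.ctx r) (S.ty A) (S.ty B)).inv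

variable (S) in
/-- The interpretation of a join in a state. -/
def joinHom (W₀ W₁ : Wr G) (A B : Ty G) (r : S.sig.St) :
    S.sig.ctx (S.wi W₁ B :: S.wi W₀ A :: r) ⟶ S.sig.ctx (S.wi (.par W₀ W₁) (.par A B) :: r) :=
  (α_ (S.sig.ctx r) (S.ty A) (S.ty B)).hom

variable (S) in
/-- The interpretation of a make-coroutine gate in a state, up to a token. -/
def mkHom (W : Wr G) (A : Ty G) (y : Var G) (r : S.sig.St) : S.sig.ctx (S.wi W A :: r) ⟶
    S.sig.ctx (S.wi (.mkc W y) (.sub A y.ty) :: S.wi (.app y W) y.ty :: r) :=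
  S.sig.ctx r ◁ mkcHom (S.ty A) (S.ty y.ty) ≫
    (α_ (S.sig.ctx r) (S.ty y.ty) (S.ty (.sub A y.ty))).inv

theorem wh_splitMor (W : Wr G) (A B : Ty G) (r : S.sig.St) :
    wh r (S.splitMor W A B) = S.splitHom W A B r := by
  have e : ∀ X A B : C, ((α_ X (𝟙_ C) (A ⊗ B)).symm ≪≫ whiskerRightIso (ρ_ X) (A ⊗ B)).inv ≫
      X ◁ (α_ (𝟙_ C) A B).inv ≫ ((α_ X (𝟙_ C ⊗ A) B).symm ≪≫
        whiskerRightIso ((α_ X (𝟙_ C) A).symm ≪≫ whiskerRightIso (ρ_ X) A) B).hom =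
      (α_ X A B).inv := by
    intro X A B; simp
  exact e _ _ _

theorem wh_joinMor (W₀ W₁ : Wr G) (A B : Ty G) (r : S.sig.St) :
    wh r (S.joinMor W₀ W₁ A B) = S.joinHom W₀ W₁ A B r := by
  have e : ∀ X A B : C, ((α_ X (𝟙_ C ⊗ A) B).symm ≪≫
        whiskerRightIso ((α_ X (𝟙_ C) A).symm ≪≫ whiskerRightIso (ρ_ X) A) B).inv ≫
      X ◁ (α_ (𝟙_ C) A B).hom ≫ ((α_ X (𝟙_ C) (A ⊗ B)).symm ≪≫
        whiskerRightIso (ρ_ X) (A ⊗ B)).hom = (α_ X A B).hom := by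
    intro X A B; simp
  exact e _ _ _

theorem wh_mkMor (W : Wr G) (A : Ty G) (y : Var G) (r : S.sig.St) :
    wh r (S.mkMor W A y) = S.mkHom W A y r := by
  have e : ∀ {X A Y D : C} (m : A ⟶ Y ⊗ D), ((α_ X (𝟙_ C) A).symm ≪≫ whiskerRightIso (ρ_ X) A).inv ≫
      X ◁ (𝟙_ C ◁ m ≫ (α_ (𝟙_ C) Y D).inv) ≫ ((α_ X (𝟙_ C ⊗ Y) D).symm ≪≫
        whiskerRightIso ((α_ X (𝟙_ C) Y).symm ≪≫ whiskerRightIso (ρ_ X) Y) D).hom =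
      X ◁ m ≫ (α_ X Y D).inv := by
    intro X A Y D m; simp
  exact e _

end Structure
end CoILL

-- Simulation of the rules of derivation

namespace CoILL

universe u

set_option linter.unusedSectionVars false

variable {G : Type u} {C : Type*} [Category C] [MonoidalCategory C] [SymmetricCategory C]
  [LeftClosed C]

open WireSig Classical

namespace Cx

theorem has_snoc {κ : Cx G} {M t : Tm G} : (κ.snoc M).Has t ↔ t = M ∨ κ.Has t := by
  simp only [Has, snoc, List.mem_cons]; tauto

theorem has_addP {κ : Cx G} {P t : Tm G} : (κ.addP P).Has t ↔ t = P ∨ κ.Has t := by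
  simp only [Has, addP, Multiset.mem_cons]; tauto

theorem has_append {κ ζ : Cx G} {t : Tm G} : (κ.append ζ).Has t ↔ κ.Has t ∨ ζ.Has t := by
  simp only [Has, append, Multiset.mem_add, List.mem_append]; tauto

theorem has_subst {κ : Cx G} {x M} {t : Tm G} :
    (κ.subst x M).Has t ↔ ∃ t', κ.Has t' ∧ Tm.subst x M t' = t := by
  simp only [Has, subst, Multiset.mem_map, List.mem_map]
  constructor
  · rintro (⟨t', h, rfl⟩ | ⟨t', h, rfl⟩)
    · exact ⟨t', .inl h, rfl⟩
    · exact ⟨t', .inr h, rfl⟩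
  · rintro ⟨t', h | h, rfl⟩
    · exact .inl ⟨t', h, rfl⟩
    · exact .inr ⟨t', h, rfl⟩

theorem mem_swapAt {α : Type*} {n : ℕ} {l : List α} {a : α} :
    a ∈ CoILL.swapAt n l ↔ a ∈ l := by
  induction n generalizing l with
  | zero =>
    match l with
    | [] => rfl
    | [_] => rfl
    | b :: c :: l => simp only [CoILL.swapAt, List.mem_cons]; tauto
  | succ n ih =>
    match l with
    | [] => rfl
    | b :: l => simp only [CoILL.swapAt, List.mem_cons, ih]

theorem has_swapAt {κ : Cx G} {n} {t : Tm G} : (κ.swapAt n).Has t ↔ κ.Has t := by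
  simp only [Has, swapAt, mem_swapAt]

theorem map_wr_subst (κ : Cx G) (x : Var G) (M : Tm G) (ρ : Var G → Wr G) :
    (κ.subst x M).terms.map (Tm.wr ρ) = κ.terms.map (Tm.wr (upd ρ x (M.wr ρ))) := by
  simp [subst, Tm.wr_subst, Function.comp_def]

theorem wr_of_has_subst {κ : Cx G} {x : Var G} {M t : Tm G} {ρ : Var G → Wr G}
    (h : (κ.subst x M).Has t) : ∃ t', κ.Has t' ∧ t.wr ρ = t'.wr (upd ρ x (M.wr ρ)) := by
  obtain ⟨t', h', rfl⟩ := has_subst.1 h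
  exact ⟨t', h', Tm.wr_subst _ _ _ _⟩

theorem map_swapAt {α β : Type*} (f : α → β) (n : ℕ) (l : List α) :
    (CoILL.swapAt n l).map f = CoILL.swapAt n (l.map f) := by
  induction n generalizing l with
  | zero =>
    match l with
    | [] => rfl
    | [_] => rfl
    | b :: c :: l => rfl
  | succ n ih =>
    match l with
    | [] => rfl
    | b :: l => simp only [CoILL.swapAt, List.map_cons, ih]

end Cx

namespace Structure

variable {S : Structure G C}

variable (S) in
/-- The events of the derivation compute its interpretation. -/
def Simulates {x : Var G} {κ : Cx G} {Γ : List (Ty G)} (d : Deriv x κ Γ) (ρ : Var G → Wr G)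
    (W : Wr G) : Prop :=
  ∃ (L : S.sig.St) (i : S.ctx Γ ⟶ S.sig.ctx L) (f : S.sig.ob (S.wl W x.ty) ⟶ S.sig.ctx L)
    (ts : List (Var G)), S.Lift (κ.terms.map (Tm.wr ρ)) Γ L i ∧
    -- Each term is located at the root or at a token made on the way. This ensures that whatever is
    -- later plugged into the term finds the token it needs.
    (∀ t, κ.Has t → (t.wr ρ).hd = W.hd ∨ (t.wr ρ).hd ∈ ts) ∧ f = S.interp d ≫ i ∧
    S.toks.Sim S.net W.hd [S.wi W x.ty] L ((λ_ _).hom ≫ f) ts (S.events d ρ)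

/-- The second derivation is run on the wire of `M`, at the location of `M`, with `x` bound to that
wire. -/
theorem simulates_cut {z x : Var G} {κ ζ : Cx G} {M : Tm G} {Γ Δ : List (Ty G)} {ρ W}
    {d : Deriv z (κ.snoc M) (x.ty :: Γ)} {e : Deriv x ζ Δ} (h : Apart z (κ.snoc M) x ζ)
    (hd : S.Simulates d ρ W) (he : S.Simulates e (upd ρ x (M.wr ρ)) (M.wr ρ)) :
    S.Simulates (d.cut e h) ρ W := by
  obtain ⟨L, i, f, ts, hl, hh, hf, hs⟩ := hd
  obtain ⟨L', i', f', ts', hl', hh', hf', hs'⟩ := he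
  change S.Lift (M.wr ρ :: κ.terms.map (Tm.wr ρ)) (x.ty :: Γ) L i at hl
  rw [← Cx.map_wr_subst] at hl'
  cases hl with | cons _ _ hl =>
  rename_i L i
  obtain ⟨k, hk, ek⟩ := hl.append hl'
  have hs'' := hs'.frame L
  rw [wh_single] at hs''
  have := hs.trans hs'' (hh M (Cx.has_snoc.2 (.inl rfl)))
  rw [Category.assoc] at this
  refine ⟨_, k, _, _, ?_, ?_, ?_, this⟩
  · rw [← List.map_append] at hk; exact hk
  · intro t ht
    rcases Cx.has_append.1 ht with ht | ht
    · rcases hh t (Cx.has_snoc.2 (.inr ht)) with h | h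
      · exact .inl h
      · exact .inr (List.mem_append_right _ h)
    · obtain ⟨t', ht', e⟩ := Cx.wr_of_has_subst (ρ := ρ) ht
      rw [e]
      rcases hh' t' ht' with h | h
      · rw [h]
        rcases hh M (Cx.has_snoc.2 (.inl rfl)) with h | h
        · exact .inl h
        · exact .inr (List.mem_append_right _ h)
      · exact .inr (List.mem_append_left _ h)
  · subst hf hf'
    exact whisker_cut _ _ _ _ _ _ _ ek

theorem simulates_ax (x : Var G) (ρ : Var G → Wr G) : S.Simulates (.ax x) ρ (ρ x) := by
  refine ⟨[S.wi (ρ x) x.ty], 𝟙 (𝟙_ C) ▷ S.ty x.ty, (λ_ (S.ty x.ty)).inv, [],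
    .cons (ρ x) x.ty .nil, ?_, ?_, ?_⟩
  · rintro t (ht | ht)
    · simp at ht
    · obtain rfl := List.mem_singleton.1 ht
      exact .inl rfl
  · have e : ∀ A : C, (λ_ A).inv = (λ_ A).inv ≫ 𝟙 (𝟙_ C) ▷ A := by simp
    exact e _
  · have h := Tokens.Sim.str (K := S.toks) (N := S.net) (ρ x).hd (Str.refl [S.wi (ρ x) x.ty])
    rw [← Iso.hom_inv_id (λ_ (S.sig.obj (S.wi (ρ x) x.ty)))] at h
    exact h

theorem simulates_exch {x : Var G} {κ : Cx G} {Γ : List (Ty G)} {ρ W} (n : ℕ) {d : Deriv x κ Γ}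
    (hd : S.Simulates d ρ W) : S.Simulates (d.exch n) ρ W := by
  obtain ⟨L, i, f, ts, hl, hh, hf, hs⟩ := hd
  obtain ⟨L', i', s, hl', hs', e⟩ := hl.swapAt n
  have := hs.trans (Tokens.Sim.str W.hd hs') (.inl rfl)
  rw [Category.assoc, List.nil_append, add_zero] at this
  refine ⟨L', i', _, ts, ?_, fun t ht => hh t (Cx.has_swapAt.1 ht), ?_, this⟩
  · rw [← Cx.map_swapAt] at hl'; exact hl'
  · subst hf
    exact (Category.assoc _ _ _).trans ((congrArg (S.interp d ≫ ·) e).trans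
      (Category.assoc _ _ _).symm)

theorem simulates_parI {x : Var G} {κ : Cx G} {M₀ M₁ : Tm G} {A B : Ty G} {Θ : List (Ty G)} {ρ W}
    {d : Deriv x ((κ.snoc M₀).snoc M₁) (B :: A :: Θ)} (hd : S.Simulates d ρ W) :
    S.Simulates d.parI ρ W := by
  obtain ⟨L, i, f, ts, hl, hh, hf, hs⟩ := hd
  change S.Lift (M₁.wr ρ :: M₀.wr ρ :: κ.terms.map (Tm.wr ρ)) (B :: A :: Θ) L i at hl
  cases hl with | cons _ _ hl =>
  cases hl with | cons _ _ hl =>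
  rename_i L i
  have h₁ := (sim_join (S := S) (M₀.wr ρ) (M₁.wr ρ) A B).frame L
  rw [wh_joinMor] at h₁
  have := hs.trans h₁ (hh M₀ (Cx.has_snoc.2 (.inr (Cx.has_snoc.2 (.inl rfl)))))
  rw [Category.assoc] at this
  refine ⟨S.wi (.par (M₀.wr ρ) (M₁.wr ρ)) (.par A B) :: L, i ▷ S.ty (.par A B), _, ts,
    .cons _ _ hl, fun t ht => ?_, ?_, this⟩
  · rcases Cx.has_snoc.1 ht with rfl | ht
    · exact hh M₀ (Cx.has_snoc.2 (.inr (Cx.has_snoc.2 (.inl rfl))))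
    · exact hh t (Cx.has_snoc.2 (.inr (Cx.has_snoc.2 (.inr ht))))
  · subst hf
    have e : ∀ {P X U A B : C} (g : P ⟶ (X ⊗ A) ⊗ B) (i : X ⟶ U),
        (g ≫ i ▷ A ▷ B) ≫ (α_ U A B).hom = (g ≫ (α_ X A B).hom) ≫ i ▷ (A ⊗ B) := by
      intro P X U A B g i; simp
    exact e _ _

theorem simulates_parE {z x y : Var G} {κ ζ ξ : Cx G} {N : Tm G} {Υ Γ Δ : List (Ty G)} {ρ W}
    {d : Deriv z (κ.snoc N) (.par x.ty y.ty :: Υ)} {e : Deriv x ζ Γ} {f : Deriv y ξ Δ}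
    (h₁ : Apart z (κ.snoc N) x ζ) (h₂ : Apart z (κ.snoc N) y ξ) (h₃ : Apart x ζ y ξ)
    (hd : S.Simulates d ρ W)
    (he : S.Simulates e (upd ρ x (.casel (N.wr ρ))) (.casel (N.wr ρ)))
    (hf : S.Simulates f (upd ρ y (.caser (N.wr ρ))) (.caser (N.wr ρ))) :
    S.Simulates (d.parE e f h₁ h₂ h₃) ρ W := by
  obtain ⟨L, i, g, ts, hl, hh, hg, hs⟩ := hd
  obtain ⟨L', i', g', ts', hl', hh', hg', hs'⟩ := he
  obtain ⟨L'', i'', g'', ts'', hl'', hh'', hg'', hs''⟩ := hf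
  change S.Lift (N.wr ρ :: κ.terms.map (Tm.wr ρ)) (.par x.ty y.ty :: Υ) L i at hl
  have hl' : S.Lift ((ζ.subst x (.casel N)).terms.map (Tm.wr ρ)) Γ L' i' := by
    rw [Cx.map_wr_subst]; exact hl'
  have hl'' : S.Lift ((ξ.subst y (.caser N)).terms.map (Tm.wr ρ)) Δ L'' i'' := by
    rw [Cx.map_wr_subst]; exact hl''
  cases hl with | cons _ _ hl =>
  rename_i L i
  obtain ⟨k, hk, ek⟩ := hl.append hl'
  obtain ⟨k', hk', ek'⟩ := hk.append hl''
  have hN := hh N (Cx.has_snoc.2 (.inl rfl))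
  have s₁ := (sim_split (S := S) (N.wr ρ) x.ty y.ty).frame L
  have s₂ := (hs'.frame L).cons (S.wi (.caser (N.wr ρ)) y.ty)
  have s₃ := hs''.frame (cat L' L)
  rw [wh_splitMor] at s₁
  rw [wh_single] at s₂ s₃
  have := hs.trans (s₁.trans (s₂.trans s₃ (.inl rfl)) (.inl rfl)) hN
  rw [Category.assoc, List.append_nil] at this
  refine ⟨_, k', _, _, ?_, ?_, ?_, this⟩
  · rw [← List.map_append, ← List.map_append] at hk'; exact hk'
  · have hN' : (N.wr ρ).hd = W.hd ∨ (N.wr ρ).hd ∈ (ts'' ++ ts') ++ ts :=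
      hN.imp_right fun h => List.mem_append_right _ h
    intro t ht
    rcases Cx.has_append.1 ht with ht | ht
    · rcases Cx.has_append.1 ht with ht | ht
      · exact (hh t (Cx.has_snoc.2 (.inr ht))).imp_right fun h => List.mem_append_right _ h
      · obtain ⟨t', ht', e⟩ := Cx.wr_of_has_subst (ρ := ρ) ht
        rw [e]
        rcases hh' t' ht' with h | h
        · exact (congrArg (fun v => v = W.hd ∨ v ∈ (ts'' ++ ts') ++ ts) h).mpr hN'
        · exact .inr (List.mem_append_left _ (List.mem_append_right _ h))
    · obtain ⟨t', ht', e⟩ := Cx.wr_of_has_subst (ρ := ρ) ht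
      rw [e]
      rcases hh'' t' ht' with h | h
      · exact (congrArg (fun v => v = W.hd ∨ v ∈ (ts'' ++ ts') ++ ts) h).mpr hN'
      · exact .inr (List.mem_append_left _ (List.mem_append_left _ h))
  · subst hg hg' hg''
    exact whisker_parE _ _ _ _ _ _ _ _ _ ek _ _ _ ek'

/-- The gate produces the token `y`, at which the second derivation is then located. -/
theorem simulates_subI {x y : Var G} {κ ζ : Cx G} {M : Tm G} {A : Ty G} {Γ Δ : List (Ty G)} {ρ W}
    {d : Deriv x (κ.snoc M) (A :: Γ)} {e : Deriv y ζ Δ} (h : Apart x (κ.snoc M) y ζ)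
    (hd : S.Simulates d ρ W)
    (he : S.Simulates e (upd ρ y (.app y (M.wr ρ))) (.app y (M.wr ρ))) :
    S.Simulates (d.subI e h) ρ W := by
  obtain ⟨L, i, f, ts, hl, hh, hf, hs⟩ := hd
  obtain ⟨L', i', f', ts', hl', hh', hf', hs'⟩ := he
  change S.Lift (M.wr ρ :: κ.terms.map (Tm.wr ρ)) (A :: Γ) L i at hl
  have hl' : S.Lift ((ζ.subst y (.app y M)).terms.map (Tm.wr ρ)) Δ L' i' := by
    rw [Cx.map_wr_subst]; exact hl'
  cases hl with | cons _ _ hl =>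
  rename_i L i
  obtain ⟨k, hk, ek⟩ := hl.append hl'
  have hM := hh M (Cx.has_snoc.2 (.inl rfl))
  have s₁ := (sim_mk (S := S) (M.wr ρ) A y).frame L
  have s₂ := (hs'.frame L).cons (S.wi (.mkc (M.wr ρ) y) (.sub A y.ty))
  rw [wh_mkMor] at s₁
  rw [wh_single] at s₂
  have := hs.trans (s₁.trans s₂ (.inr (List.mem_singleton_self y))) hM
  rw [Category.assoc] at this
  refine ⟨S.wi (.mkc (M.wr ρ) y) (.sub A y.ty) :: cat L' L, k ▷ S.ty (.sub A y.ty), _, _, ?_, ?_, ?_, this⟩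
  · rw [← List.map_append] at hk; exact .cons _ _ hk
  · have hy : y ∈ (ts' ++ [y]) ++ ts := by simp
    intro t ht
    rcases Cx.has_snoc.1 ht with rfl | ht
    · exact .inr hy
    rcases Cx.has_append.1 ht with ht | ht
    · exact (hh t (Cx.has_snoc.2 (.inr ht))).imp_right fun h => List.mem_append_right _ h
    · obtain ⟨t', ht', e⟩ := Cx.wr_of_has_subst (ρ := ρ) ht
      rw [e]
      rcases hh' t' ht' with h | h
      · exact .inr ((congrArg (· ∈ (ts' ++ [y]) ++ ts) h).mpr hy)
      · exact .inr (List.mem_append_left _ (List.mem_append_left _ h))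
  · subst hf hf'
    exact whisker_subI _ _ _ _ _ _ _ _ ek

/-- The second derivation is run inside the box that the rule opens. On closing, the wire of `N` is
absorbed by the transpose and the other wires come out. -/
theorem simulates_subE {x y : Var G} {κ ξ : Cx G} {M N : Tm G} {B : Ty G} {Γ Δ : List (Ty G)}
    {ρ W} {d : Deriv x (κ.snoc M) (.sub y.ty B :: Γ)} {e : Deriv y (ξ.snoc N) (B :: Δ)}
    (h : Apart x (κ.snoc M) y (ξ.snoc N)) (hd : S.Simulates d ρ W)
    (he : S.Simulates e (upd ρ y (.app y (M.wr ρ))) (.app y (M.wr ρ))) :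
    S.Simulates (d.subE e h) ρ W := by
  obtain ⟨L, i, f, ts, hl, hh, hf, hs⟩ := hd
  obtain ⟨L', i', f', ts', hl', hh', hf', hs'⟩ := he
  change S.Lift (M.wr ρ :: κ.terms.map (Tm.wr ρ)) (.sub y.ty B :: Γ) L i at hl
  change S.Lift (N.wr _ :: ξ.terms.map (Tm.wr _)) (B :: Δ) L' i' at hl'
  cases hl' with | cons _ _ hl' =>
  rename_i L' i'
  have hl' : S.Lift ((ξ.subst y (.app y M)).terms.map (Tm.wr ρ)) Δ L' i' := by
    rw [Cx.map_wr_subst]; exact hl'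
  cases hl with | cons _ _ hl =>
  rename_i L i
  obtain ⟨k, hk, ek⟩ := hl.append hl'
  have hM := hh M (Cx.has_snoc.2 (.inl rfl))
  subst hf'
  obtain ⟨p, hp⟩ : ∃ p : S.sig.ob (S.wl (M.wr ρ) (.sub y.ty B)) ⟶ S.sig.ctx L',
    p = postpHom (S.interp e) ≫ i' := ⟨_, rfl⟩
  have s₀ : S.toks.Sim S.net (M.wr ρ).hd [S.wi (M.wr ρ) (.sub y.ty B)] L' ((λ_ _).hom ≫ p)
      (ts' ++ [y]) ({S.ge (.opn (bx ρ y N M B))} +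
        (S.events e (upd ρ y (.app y (M.wr ρ))) + {S.ce (bx ρ y N M B)})) :=
    sim_box (b := bx ρ y N M B) hs' (p := p) (hp.trans (postpHom_comp _ _))
  have s₁ := s₀.frame L
  rw [wh_single] at s₁
  have := hs.trans s₁ hM
  rw [Category.assoc] at this
  refine ⟨_, k, _, _, ?_, ?_, ?_, this⟩
  · rw [← List.map_append] at hk; exact hk
  · have hy : y ∈ (ts' ++ [y]) ++ ts := by simp
    intro t ht
    rcases Cx.has_addP.1 ht with rfl | ht
    · exact .inr hy
    rcases Cx.has_append.1 ht with ht | ht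
    · exact (hh t (Cx.has_snoc.2 (.inr ht))).imp_right fun h => List.mem_append_right _ h
    · obtain ⟨t, ht', rfl⟩ := Cx.has_subst.1 ht
      rw [Tm.wr_subst]
      rcases hh' t (Cx.has_snoc.2 (.inr ht')) with h | h
      · exact .inr ((congrArg (· ∈ (ts' ++ [y]) ++ ts) h).mpr hy)
      · exact .inr (List.mem_append_left _ (List.mem_append_left _ h))
  · subst hf hp
    exact whisker_cut _ _ _ _ _ _ _ ek

/-- A link is a trivial wire, so it is inserted structurally and without an event; `R` serves only
to locate it. -/
theorem simulates_botI {x : Var G} {κ : Cx G} {R : Tm G} {Γ : List (Ty G)} {ρ W}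
    {d : Deriv x κ Γ} (h : κ.Has R) (hd : S.Simulates d ρ W) : S.Simulates (d.botI h) ρ W := by
  obtain ⟨L, i, f, ts, hl, hh, hf, hs⟩ := hd
  have := hs.trans (Tokens.Sim.str W.hd
    (Str.ins L (S.wl (Tm.wr ρ (.connect R)) .bot) ⟨trivial, trivial⟩)) (.inl rfl)
  rw [Category.assoc, List.nil_append, add_zero] at this
  refine ⟨S.wi (Tm.wr ρ (.connect R)) .bot :: L, i ▷ S.ty .bot, _, ts, .cons _ _ hl, fun t ht => ?_, ?_, this⟩
  · rcases Cx.has_snoc.1 ht with rfl | ht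
    · exact hh R h
    · exact hh t ht
  · subst hf
    have e : ∀ {P X U : C} (g : P ⟶ X) (i : X ⟶ U),
        (g ≫ i) ≫ (ρ_ U).inv ≫ U ◁ 𝟙 (𝟙_ C) = (g ≫ (ρ_ X).inv) ≫ i ▷ 𝟙_ C := by
      intro P X U g i; simp
    exact e _ _

theorem simulates_botE (n : ℕ) (ρ : Var G → Wr G) :
    S.Simulates (.botE n) ρ (ρ ⟨n, .bot⟩) := by
  refine ⟨[], 𝟙 (𝟙_ C), 𝟙 (𝟙_ C), [], .nil, ?_, (Category.id_comp _).symm, ?_⟩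
  · rintro t (ht | ht)
    · obtain rfl := Multiset.mem_singleton.1 ht
      exact .inl rfl
    · simp at ht
  · have e : (ρ_ (𝟙_ C)).hom = (λ_ (𝟙_ C)).hom ≫ 𝟙 _ := by simp [unitors_equal]
    have h := sim_kill (S := S) (ρ ⟨n, .bot⟩)
    exact (congrArg (fun g => S.toks.Sim S.net _ _ [] g [] _) e).mp h

/-- The events of a derivation compute its interpretation. -/
theorem simulates {x : Var G} {κ : Cx G} {Γ : List (Ty G)} (d : Deriv x κ Γ) (ρ : Var G → Wr G) :
    S.Simulates d ρ (ρ x) := by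
  induction d generalizing ρ with
  | ax x => exact simulates_ax x ρ
  | exch n d ih => exact simulates_exch n (ih ρ)
  | @cut z x κ ζ M Γ Δ d e h ih ih' =>
    have := ih' (upd ρ x (M.wr ρ))
    rw [upd_self] at this
    exact simulates_cut h (ih ρ) this
  | parI d ih => exact simulates_parI (ih ρ)
  | @parE z x y κ ζ ξ N Υ Γ Δ d e f h₁ h₂ h₃ ih ih' ih'' =>
    have i₁ := ih' (upd ρ x (.casel (N.wr ρ)))
    have i₂ := ih'' (upd ρ y (.caser (N.wr ρ)))
    rw [upd_self] at i₁ i₂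
    exact simulates_parE h₁ h₂ h₃ (ih ρ) i₁ i₂
  | @subI x y κ ζ M A Γ Δ d e h ih ih' =>
    have := ih' (upd ρ y (.app y (M.wr ρ)))
    rw [upd_self] at this
    exact simulates_subI h (ih ρ) this
  | @subE x y κ ξ M N B Γ Δ d e h ih ih' =>
    have := ih' (upd ρ y (.app y (M.wr ρ)))
    rw [upd_self] at this
    exact simulates_subE h (ih ρ) this
  | botI d h ih => exact simulates_botI h (ih ρ)
  | botE n => exact simulates_botE n ρ

end Structure
end CoILL

namespace CoILL

universe u

set_option linter.unusedSectionVars false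

/-! ### The events of a derivation are determined by its term -/

variable {G : Type u} {C : Type*} [Category C] [MonoidalCategory C] [SymmetricCategory C]
  [LeftClosed C]

open WireSig Classical

/-- The first component of a type `A ⅋ B`. -/
def Ty.left : Ty G → Ty G
  | .par A _ => A
  | _ => .bot

/-- The second component of a type `A ⅋ B`. -/
def Ty.right : Ty G → Ty G
  | .par _ B => B
  | _ => .bot

/-- The type of a wire term. -/
def Wr.ty : Wr G → Ty G
  | .var v => v.ty
  | .app y _ => y.ty
  | .conn _ => .bot
  | .par W₀ W₁ => .par W₀.ty W₁.ty
  | .casel W => W.ty.left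
  | .caser W => W.ty.right
  | .mkc W y => .sub W.ty y.ty

theorem upd_comm (ρ : Var G → Wr G) {x y : Var G} (h : x ≠ y) (W W' : Wr G) :
    upd (upd ρ x W) y W' = upd (upd ρ y W') x W := by
  funext v
  by_cases hx : v = x <;> by_cases hy : v = y <;> simp_all [upd]

theorem upd_upd (ρ : Var G → Wr G) (x : Var G) (W W' : Wr G) :
    upd (upd ρ x W) x W' = upd ρ x W' := by
  funext v
  by_cases hx : v = x <;> simp_all [upd]

theorem Tm.wr_congr {ρ ρ' : Var G → Wr G} {t : Tm G} (h : ∀ v ∈ t.names, ρ v = ρ' v) :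
    t.wr ρ = t.wr ρ' := by
  induction t with
  | var y => exact h y rfl
  | app y M ih => simp only [Tm.wr]; rw [ih fun v hv => h v (.inr hv)]
  | connect R ih => simp only [Tm.wr]; rw [ih h]
  | par M N ih ih' =>
    simp only [Tm.wr]; rw [ih fun v hv => h v (.inl hv), ih' fun v hv => h v (.inr hv)]
  | casel M ih => simp only [Tm.wr]; rw [ih h]
  | caser M ih => simp only [Tm.wr]; rw [ih h]
  | mkc M y ih => simp only [Tm.wr]; rw [ih fun v hv => h v (.inr hv)]
  | postp₂ y N M _ _ => rfl
  | postp M ih => simp only [Tm.wr]; rw [ih h]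

theorem Tm.wr_upd {ρ : Var G → Wr G} {t : Tm G} {y : Var G} (h : y ∉ t.names) (W : Wr G) :
    t.wr (upd ρ y W) = t.wr ρ := by
  apply Tm.wr_congr
  intro v hv
  have : v ≠ y := by rintro rfl; exact h hv
  simp [upd, this]

namespace Apart

theorem symm {x y : Var G} {κ ζ : Cx G} (h : Apart x κ y ζ) : Apart y ζ x κ := Disjoint.symm h

theorem notMem {x y : Var G} {κ ζ : Cx G} (h : Apart x κ y ζ) {v : Var G} (hv : v ∈ ζ.names)
    {M : Tm G} (hM : κ.Has M) : v ∉ M.names := fun h' =>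
  Set.disjoint_left.1 h (.inr ⟨M, hM, h'⟩) (.inr hv)

end Apart

namespace Deriv

/-- The types of the terms are determined by the type of the root. -/
theorem types_eq {x : Var G} {κ : Cx G} {Γ : List (Ty G)} (d : Deriv x κ Γ) {ρ : Var G → Wr G}
    (h : (ρ x).ty = x.ty) : (κ.terms.map (Tm.wr ρ)).map Wr.ty = Γ := by
  induction d generalizing ρ with
  | ax x => simp [Tm.wr, h]
  | exch n d ih =>
    rw [Cx.swapAt, Cx.map_swapAt, Cx.map_swapAt, ih h]
  | @cut z x κ ζ M Γ Δ d e _ ih ih' =>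
    have i := ih h
    simp only [Cx.snoc, List.map_cons, List.cons.injEq] at i
    simp only [Cx.append, List.map_append, Cx.map_wr_subst]
    rw [i.2, ih' (by simpa using i.1)]
  | parI d ih =>
    have i := ih h
    simp only [Cx.snoc, List.map_cons, List.cons.injEq] at i ⊢
    simp [Tm.wr, Wr.ty, i]
  | @parE z x y κ ζ ξ N Υ Γ Δ d e f h₁ h₂ h₃ ih ih' ih'' =>
    have i := ih h
    simp only [Cx.snoc, List.map_cons, List.cons.injEq] at i
    simp only [Cx.append, List.map_append, Cx.map_wr_subst]
    rw [i.2, ih' (by simp [Tm.wr, Wr.ty, i.1, Ty.left]),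
      ih'' (by simp [Tm.wr, Wr.ty, i.1, Ty.right])]
  | @subI x y κ ζ M A Γ Δ d e h ih ih' =>
    have i := ih ‹_›
    simp only [Cx.snoc, List.map_cons, List.cons.injEq] at i
    simp only [Cx.append, Cx.snoc, List.map_cons, List.map_append, Cx.map_wr_subst]
    rw [i.2, ih' (by simp [Tm.wr, Wr.ty])]
    simp [Tm.wr, Wr.ty, i.1]
  | @subE x y κ ξ M N B Γ Δ d e h ih ih' =>
    have i := ih ‹_›
    have i' := ih' (ρ := upd ρ y (.app y (M.wr ρ))) (by simp [Wr.ty])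
    simp only [Cx.snoc, List.map_cons, List.cons.injEq] at i i'
    simp only [Cx.append, Cx.addP, List.map_append, Cx.map_wr_subst, Tm.wr]
    rw [i.2, i'.2]
  | botI d _ ih => simp [Cx.snoc, Tm.wr, Wr.ty, ih h]
  | botE n => rfl

end Deriv

/-- The p-terms. -/
def Tm.IsP : Tm G → Prop
  | .postp₂ _ _ _ => True
  | .postp _ => True
  | _ => False

theorem Tm.IsP.subst {t : Tm G} (h : t.IsP) (x : Var G) (M : Tm G) : (Tm.subst x M t).IsP := by
  cases t <;> first | exact h.elim | trivial

theorem Deriv.isP {x : Var G} {κ : Cx G} {Γ : List (Ty G)} (d : Deriv x κ Γ) :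
    ∀ P ∈ κ.ctrl, P.IsP := by
  have hs : ∀ (κ : Cx G) (x M), (∀ P ∈ κ.ctrl, P.IsP) → ∀ P ∈ (κ.subst x M).ctrl, P.IsP := by
    intro κ x M h P hP
    obtain ⟨Q, hQ, rfl⟩ := Multiset.mem_map.1 hP
    exact (h Q hQ).subst _ _
  have ha : ∀ κ ζ : Cx G, (∀ P ∈ κ.ctrl, P.IsP) → (∀ P ∈ ζ.ctrl, P.IsP) →
      ∀ P ∈ (κ.append ζ).ctrl, P.IsP := by
    intro κ ζ h h' P hP
    exact (Multiset.mem_add.1 hP).elim (h P) (h' P)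
  induction d with
  | ax x => simp
  | exch n d ih => exact ih
  | cut d e _ ih ih' => exact ha _ _ ih (hs _ _ _ ih')
  | parI d ih => exact ih
  | parE d e f _ _ _ ih ih' ih'' => exact ha _ _ (ha _ _ ih (hs _ _ _ ih')) (hs _ _ _ ih'')
  | subI d e _ ih ih' => exact ha _ _ ih (hs _ _ _ ih')
  | subE d e _ ih ih' =>
    intro P hP
    rcases Multiset.mem_cons.1 hP with rfl | hP
    · trivial
    · exact ha _ _ ih (hs _ _ _ ih') P hP
  | botI d _ ih => exact ih
  | botE n =>
    intro P hP
    rw [Multiset.mem_singleton.1 hP]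
    trivial

namespace Structure

variable (S : Structure G C)

/-- The events that a wire term records. -/
def wev : Wr G → Set S.net.Ev
  | .var _ => ∅
  -- The event that introduces the function is recorded by the corresponding `mkc` or `postp₂`.
  | .app _ W => wev W
  -- Links record nothing, which is why rewiring does not change the events.
  | .conn _ => ∅
  | .par W₀ W₁ => {e | e ∈ S.gev (.join W₀ W₁ W₀.ty W₁.ty)} ∪ (wev W₀ ∪ wev W₁)
  | .casel W => {e | ∃ A B, W.ty = .par A B ∧ e ∈ S.gev (.split W A B)} ∪ wev W
  | .caser W => {e | ∃ A B, W.ty = .par A B ∧ e ∈ S.gev (.split W A B)} ∪ wev W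
  | .mkc W y => {S.ge (.mk W W.ty y)} ∪ wev W

/-- The events that a p-term records. -/
noncomputable def pev (ρ : Var G → Wr G) : Tm G → Set S.net.Ev
  | .postp₂ y N M => {e | ∃ B, (M.wr ρ).ty = .sub y.ty B ∧
      (e = S.ge (.opn (bx ρ y N M B)) ∨ e = S.ce (bx ρ y N M B))} ∪
        (S.wev (M.wr ρ) ∪ S.wev (N.wr (upd ρ y (.app y (M.wr ρ)))))
  | .postp M => {e | e ∈ S.gev (.kill (M.wr ρ))} ∪ S.wev (M.wr ρ)
  | _ => ∅

/-- The events that a context records. -/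
def cev (ρ : Var G → Wr G) (κ : Cx G) : Set S.net.Ev :=
  {e | (∃ P ∈ κ.ctrl, e ∈ S.pev ρ P) ∨ ∃ M ∈ κ.terms, e ∈ S.wev (M.wr ρ)}

variable {S} {ρ : Var G → Wr G} {κ ζ : Cx G} {e : S.net.Ev}

theorem mem_cev_snoc {M : Tm G} :
    e ∈ S.cev ρ (κ.snoc M) ↔ e ∈ S.cev ρ κ ∨ e ∈ S.wev (M.wr ρ) := by
  simp only [cev, Cx.snoc, Set.mem_ofPred_eq, List.mem_cons, exists_eq_or_imp]
  rw [or_left_comm, or_comm]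

theorem mem_cev_addP {P : Tm G} :
    e ∈ S.cev ρ (κ.addP P) ↔ e ∈ S.cev ρ κ ∨ e ∈ S.pev ρ P := by
  simp only [cev, Cx.addP, Set.mem_ofPred_eq, Multiset.mem_cons, exists_eq_or_imp]
  rw [or_assoc, or_comm]

theorem mem_cev_append :
    e ∈ S.cev ρ (κ.append ζ) ↔ e ∈ S.cev ρ κ ∨ e ∈ S.cev ρ ζ := by
  simp only [cev, Cx.append, Set.mem_ofPred_eq, Multiset.mem_add, List.mem_append, or_and_right,
    exists_or]
  have h : ∀ a b c d : Prop, ((a ∨ b) ∨ c ∨ d) ↔ ((a ∨ d) ∨ b ∨ c) := by tauto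
  exact h _ _ _ _

theorem mem_cev_swapAt {n : ℕ} : e ∈ S.cev ρ (κ.swapAt n) ↔ e ∈ S.cev ρ κ := by
  simp only [cev, Cx.swapAt, Set.mem_ofPred_eq, Cx.mem_swapAt]

/-- The hypothesis `h` stands for the absence of capture: binding a variable of `t` does not affect
`M`, so the binding commutes with the substitution. -/
theorem pev_subst {x : Var G} {M t : Tm G} (ht : t.IsP)
    (h : ∀ y ∈ t.names, ∀ W, M.wr (upd ρ y W) = M.wr ρ) :
    S.pev ρ (Tm.subst x M t) = S.pev (upd ρ x (M.wr ρ)) t := by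
  cases t with
  | postp₂ y N L =>
    have e : (if y = x then N else Tm.subst x M N).wr (upd ρ y (.app y (L.wr (upd ρ x (M.wr ρ)))))
        = N.wr (upd (upd ρ x (M.wr ρ)) y (.app y (L.wr (upd ρ x (M.wr ρ))))) := by
      by_cases hy : y = x
      · subst hy; rw [if_pos rfl, upd_upd]
      · rw [if_neg hy, Tm.wr_subst, h y (.inl rfl), upd_comm _ hy]
    simp only [Tm.subst, pev, bx, Tm.wr_subst, e]
  | postp L => simp only [Tm.subst, pev, Tm.wr_subst]
  | _ => exact ht.elim

theorem mem_cev_subst {x : Var G} {M : Tm G} (hκ : ∀ P ∈ κ.ctrl, P.IsP)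
    (h : ∀ y ∈ κ.names, ∀ W, M.wr (upd ρ y W) = M.wr ρ) :
    e ∈ S.cev ρ (κ.subst x M) ↔ e ∈ S.cev (upd ρ x (M.wr ρ)) κ := by
  have h' : ∀ P ∈ κ.ctrl, S.pev ρ (Tm.subst x M P) = S.pev (upd ρ x (M.wr ρ)) P :=
    fun P hP => pev_subst (hκ P hP) fun y hy => h y ⟨P, .inl hP, hy⟩
  simp only [cev, Cx.subst, Set.mem_ofPred_eq, Multiset.mem_map, List.mem_map,
    exists_exists_and_eq_and, Tm.wr_subst]
  refine or_congr_left (exists_congr fun P => and_congr_right fun hP => ?_)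
  rw [h' P hP]

variable (S) in
/-- The events of a derivation are the events that its terms record. -/
theorem mem_events {x : Var G} {κ : Cx G} {Γ : List (Ty G)} (d : Deriv x κ Γ) {ρ : Var G → Wr G}
    (h : (ρ x).ty = x.ty) {e : S.net.Ev} :
    e ∈ S.events d ρ ∨ e ∈ S.wev (ρ x) ↔ e ∈ S.cev ρ κ := by
  -- If the root is bound to a composite wire, the terms also record the events that produced this
  -- wire; this is the second disjunct on the left. Only membership is compared, because a wire that
  -- is used by several terms is recorded by each of them.
  induction d generalizing ρ with
  | ax x => simp [events, cev, Tm.wr]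
  | exch n d ih => rw [mem_cev_swapAt, ← ih h, events]
  | @cut z x κ ζ M Γ Δ d d' ha ih ih' =>
    have t := d.types_eq h
    simp only [Cx.snoc, List.map_cons, List.cons.injEq] at t
    have i := ih h
    have i' := ih' (ρ := upd ρ x (M.wr ρ)) (by simpa using t.1)
    rw [mem_cev_snoc] at i
    rw [upd_self] at i'
    rw [mem_cev_append, mem_cev_subst d'.isP fun y hy W =>
      Tm.wr_upd (ha.notMem hy (Cx.has_snoc.2 (.inl rfl))) W, events, Multiset.mem_add]
    grind
  | @parI x κ M₀ M₁ A B Θ d ih =>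
    have t := d.types_eq h
    simp only [Cx.snoc, List.map_cons, List.cons.injEq] at t
    have i := ih h
    rw [mem_cev_snoc, mem_cev_snoc] at i
    rw [mem_cev_snoc, events, Multiset.mem_add]
    simp only [Tm.wr, wev, Set.mem_union, Set.mem_ofPred_eq, t]
    grind
  | @parE z x y κ ζ ξ N Υ Γ Δ d d' d'' h₁ h₂ h₃ ih ih' ih'' =>
    have t := d.types_eq h
    simp only [Cx.snoc, List.map_cons, List.cons.injEq] at t
    have i := ih h
    have i' := ih' (ρ := upd ρ x (.casel (N.wr ρ))) (by simp [Wr.ty, t.1, Ty.left])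
    have i'' := ih'' (ρ := upd ρ y (.caser (N.wr ρ))) (by simp [Wr.ty, t.1, Ty.right])
    rw [mem_cev_snoc] at i
    rw [upd_self] at i' i''
    rw [mem_cev_append, mem_cev_append, mem_cev_subst (M := .casel N) d'.isP fun v hv W =>
      congrArg Wr.casel
        (Tm.wr_upd (h₁.notMem hv (Cx.has_snoc.2 (.inl rfl))) W),
      mem_cev_subst (M := .caser N) d''.isP fun v hv W =>
      congrArg Wr.caser
        (Tm.wr_upd (h₂.notMem hv (Cx.has_snoc.2 (.inl rfl))) W), events]
    simp only [Multiset.mem_add]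
    have hs : (∃ A B, (N.wr ρ).ty = .par A B ∧ e ∈ S.gev (.split (N.wr ρ) A B)) ↔
        e ∈ S.gev (.split (N.wr ρ) x.ty y.ty) := by
      rw [t.1]
      constructor
      · rintro ⟨A, B, hAB, he⟩; cases hAB; exact he
      · exact fun he => ⟨_, _, rfl, he⟩
    simp only [wev, Set.mem_union, Set.mem_ofPred_eq, hs] at i' i''
    simp only [Tm.wr]
    grind
  | @subI x y κ ζ M A Γ Δ d d' ha ih ih' =>
    have t := d.types_eq h
    simp only [Cx.snoc, List.map_cons, List.cons.injEq] at t
    have i := ih h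
    have i' := ih' (ρ := upd ρ y (.app y (M.wr ρ))) (by simp [Wr.ty])
    rw [mem_cev_snoc] at i
    rw [upd_self] at i'
    rw [mem_cev_snoc, mem_cev_append, mem_cev_subst (M := .app y M) d'.isP fun v hv W => congrArg (Wr.app y)
      (Tm.wr_upd (ha.notMem hv (Cx.has_snoc.2 (.inl rfl))) W), events]
    simp only [Multiset.mem_add, Multiset.mem_singleton, Tm.wr, wev, Set.mem_union,
      Set.mem_singleton_iff, t.1] at i' ⊢
    grind
  | @subE x y κ ξ M N B Γ Δ d d' ha ih ih' =>
    have t := d.types_eq h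
    simp only [Cx.snoc, List.map_cons, List.cons.injEq] at t
    have i := ih h
    have i' := ih' (ρ := upd ρ y (.app y (M.wr ρ))) (by simp [Wr.ty])
    rw [mem_cev_snoc] at i i'
    rw [upd_self] at i'
    have hn : ∀ v ∈ ξ.names, v ∈ (ξ.snoc N).names := fun v ⟨R, hR, hv⟩ =>
      ⟨R, Cx.has_snoc.2 (.inr hR), hv⟩
    rw [mem_cev_addP, mem_cev_append, mem_cev_subst (κ := ξ) (M := .app y M) (fun P hP => d'.isP P hP) fun v hv W =>
      congrArg (Wr.app y) (Tm.wr_upd (ha.notMem (hn v hv) (Cx.has_snoc.2 (.inl rfl))) W), events]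
    have hs : (∃ B', (M.wr ρ).ty = .sub y.ty B' ∧
        (e = S.ge (.opn (bx ρ y N M B')) ∨ e = S.ce (bx ρ y N M B'))) ↔
        (e = S.ge (.opn (bx ρ y N M B)) ∨ e = S.ce (bx ρ y N M B)) := by
      rw [t.1]
      constructor
      · rintro ⟨A, hAB, he⟩; cases hAB; exact he
      · exact fun he => ⟨_, rfl, he⟩
    simp only [Multiset.mem_add, Multiset.mem_singleton, Tm.wr, wev, pev, Set.mem_union,
      Set.mem_ofPred_eq, hs] at i' ⊢
    grind
  | botI d _ ih =>
    rw [mem_cev_snoc, ← ih h, events]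
    simp [Tm.wr, wev]
  | botE n =>
    simp only [events, cev, Set.mem_ofPred_eq, Multiset.mem_singleton, exists_eq_left, pev, Tm.wr,
      Set.mem_union]
    simp

end Structure
end CoILL

namespace CoILL

universe u

set_option linter.unusedSectionVars false

/-! ### The labels of a run are pairwise distinct -/

variable {G : Type u} {C : Type*} [Category C] [MonoidalCategory C] [SymmetricCategory C]
  [LeftClosed C]

open WireSig Classical

/-- The variable `v` occurs free in a term. -/
def Tm.Free (v : Var G) : Tm G → Prop
  | .var y => y = v
  | .app _ N => N.Free v
  | .connect R => R.Free v
  | .par M N => M.Free v ∨ N.Free v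
  | .casel N => N.Free v
  | .caser N => N.Free v
  | .mkc N _ => N.Free v
  | .postp₂ y N M => (y ≠ v ∧ N.Free v) ∨ M.Free v
  | .postp N => N.Free v

theorem Tm.Free.subst {x v : Var G} {M t : Tm G} (h : t.Free x) (hM : M.Free v)
    (hv : v ∉ t.names) : (Tm.subst x M t).Free v := by
  induction t with
  | var y => rw [Tm.subst, if_pos (show y = x from h)]; exact hM
  | app y N ih => exact ih h fun h' => hv (.inr h')
  | connect R ih => exact ih h hv
  | par N N' ih ih' =>
    exact h.imp (fun h => ih h fun h' => hv (.inl h')) (fun h => ih' h fun h' => hv (.inr h'))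
  | casel N ih => exact ih h hv
  | caser N ih => exact ih h hv
  | mkc N y ih => exact ih h fun h' => hv (.inr h')
  | postp₂ y N L ih ih' =>
    rcases h with ⟨h₁, h⟩ | h
    · refine .inl ⟨fun e => hv (.inl e.symm), ?_⟩
      rw [if_neg h₁]
      exact ih h fun h' => hv (.inr (.inl h'))
    · exact .inr (ih' h fun h' => hv (.inr (.inr h')))
  | postp N ih => exact ih h hv

theorem Tm.Free.names_subset {x v : Var G} {M t : Tm G} (h : t.Free x) (hv : v ∈ M.names) :
    v ∈ (Tm.subst x M t).names := by
  induction t with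
  | var y => rw [Tm.subst, if_pos (show y = x from h)]; exact hv
  | app y N ih => exact .inr (ih h)
  | connect R ih => exact ih h
  | par N N' ih ih' => exact h.imp ih ih'
  | casel N ih => exact ih h
  | caser N ih => exact ih h
  | mkc N y ih => exact .inr (ih h)
  | postp₂ y N L ih ih' =>
    rcases h with ⟨h₁, h⟩ | h
    · refine .inr (.inl ?_)
      rw [if_neg h₁]
      exact ih h
    · exact .inr (.inr (ih' h))
  | postp N ih => exact ih h

theorem Tm.mem_names_subst {x v : Var G} {M t : Tm G} (h : v ∈ t.names) (hv : v ≠ x) :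
    v ∈ (Tm.subst x M t).names := by
  induction t with
  | var y =>
    obtain rfl : v = y := h
    rw [Tm.subst, if_neg hv]; rfl
  | app y N ih => exact h.imp id ih
  | connect R ih => exact ih h
  | par N N' ih ih' => exact h.imp ih ih'
  | casel N ih => exact ih h
  | caser N ih => exact ih h
  | mkc N y ih => exact h.imp id ih
  | postp₂ y N L ih ih' =>
    refine h.imp id (Or.imp (fun h => ?_) ih')
    by_cases hy : y = x
    · rw [if_pos hy]; exact h
    · rw [if_neg hy]; exact ih h
  | postp N ih => exact ih h

namespace Cx

/-- The variable `v` occurs free in a context. -/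
def Free (v : Var G) (κ : Cx G) : Prop := ∃ t, κ.Has t ∧ t.Free v

/-- As the root of a derivation occurs free in its context, a cut loses no name of the term that is
substituted for it. -/
theorem Free.names_subset {x v : Var G} {M : Tm G} {κ : Cx G} (h : κ.Free x) (hv : v ∈ M.names) :
    v ∈ (κ.subst x M).names := by
  obtain ⟨t, ht, h⟩ := h
  exact ⟨_, has_subst.2 ⟨t, ht, rfl⟩, h.names_subset hv⟩

theorem Free.subst {x v : Var G} {M : Tm G} {κ : Cx G} (h : κ.Free x) (hM : M.Free v)
    (hv : v ∉ κ.names) : (κ.subst x M).Free v := by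
  obtain ⟨t, ht, h⟩ := h
  exact ⟨_, has_subst.2 ⟨t, ht, rfl⟩, h.subst hM fun h' => hv ⟨t, ht, h'⟩⟩

theorem mem_names_subst {x v : Var G} {M : Tm G} {κ : Cx G} (h : v ∈ κ.names) (hv : v ≠ x) :
    v ∈ (κ.subst x M).names := by
  obtain ⟨t, ht, h⟩ := h
  exact ⟨_, has_subst.2 ⟨t, ht, rfl⟩, Tm.mem_names_subst h hv⟩

theorem names_snoc (κ : Cx G) (M : Tm G) : (κ.snoc M).names = M.names ∪ κ.names := by
  ext v; simp only [names, has_snoc, Set.mem_ofPred_eq, Set.mem_union, or_and_right, exists_or,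
    exists_eq_left]

theorem names_addP (κ : Cx G) (P : Tm G) : (κ.addP P).names = P.names ∪ κ.names := by
  ext v; simp only [names, has_addP, Set.mem_ofPred_eq, Set.mem_union, or_and_right, exists_or,
    exists_eq_left]

theorem names_append (κ ζ : Cx G) : (κ.append ζ).names = κ.names ∪ ζ.names := by
  ext v; simp only [names, has_append, Set.mem_ofPred_eq, Set.mem_union, or_and_right, exists_or]

theorem names_swapAt (κ : Cx G) (n : ℕ) : (κ.swapAt n).names = κ.names := by
  ext v; simp only [names, has_swapAt]

end Cx

theorem Apart.left_notMem {x y : Var G} {κ ζ : Cx G} (h : Apart x κ y ζ) : x ∉ ζ.names :=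
  fun h' => Set.disjoint_left.1 h (.inl rfl) (.inr h')

/-- The root of a derivation occurs free in its context. -/
theorem Deriv.free {x : Var G} {κ : Cx G} {Γ : List (Ty G)} (d : Deriv x κ Γ) : κ.Free x := by
  induction d with
  | ax x => exact ⟨_, .inr (List.mem_singleton_self _), rfl⟩
  | exch n d ih => obtain ⟨t, ht, h⟩ := ih; exact ⟨t, Cx.has_swapAt.2 ht, h⟩
  | cut d e ha ih ih' =>
    obtain ⟨t, ht, h⟩ := ih
    rcases Cx.has_snoc.1 ht with rfl | ht
    · obtain ⟨t', ht', h'⟩ := ih'.subst h ha.left_notMem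
      exact ⟨t', Cx.has_append.2 (.inr ht'), h'⟩
    · exact ⟨t, Cx.has_append.2 (.inl ht), h⟩
  | parI d ih =>
    obtain ⟨t, ht, h⟩ := ih
    rcases Cx.has_snoc.1 ht with rfl | ht
    · exact ⟨_, Cx.has_snoc.2 (.inl rfl), .inr h⟩
    rcases Cx.has_snoc.1 ht with rfl | ht
    · exact ⟨_, Cx.has_snoc.2 (.inl rfl), .inl h⟩
    · exact ⟨t, Cx.has_snoc.2 (.inr ht), h⟩
  | @parE z x y κ ζ ξ N Υ Γ Δ d e f h₁ _ _ ih ih' _ =>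
    obtain ⟨t, ht, h⟩ := ih
    rcases Cx.has_snoc.1 ht with rfl | ht
    · obtain ⟨t', ht', h'⟩ := ih'.subst (M := .casel t) h h₁.left_notMem
      exact ⟨t', Cx.has_append.2 (.inl (Cx.has_append.2 (.inr ht'))), h'⟩
    · exact ⟨t, Cx.has_append.2 (.inl (Cx.has_append.2 (.inl ht))), h⟩
  | subI d e ha ih _ =>
    obtain ⟨t, ht, h⟩ := ih
    rcases Cx.has_snoc.1 ht with rfl | ht
    · exact ⟨_, Cx.has_snoc.2 (.inl rfl), h⟩
    · exact ⟨t, Cx.has_snoc.2 (.inr (Cx.has_append.2 (.inl ht))), h⟩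
  | subE d e ha ih _ =>
    obtain ⟨t, ht, h⟩ := ih
    rcases Cx.has_snoc.1 ht with rfl | ht
    · exact ⟨_, Cx.has_addP.2 (.inl rfl), .inr h⟩
    · exact ⟨t, Cx.has_addP.2 (.inr (Cx.has_append.2 (.inl ht))), h⟩
  | botI d _ ih => obtain ⟨t, ht, h⟩ := ih; exact ⟨t, Cx.has_snoc.2 (.inr ht), h⟩
  | botE n => exact ⟨_, .inl (Multiset.mem_singleton_self _), rfl⟩

namespace Structure

variable {S : Structure G C}

/-- The function names that a gate introduces. -/
def Gt.fns : Gt G → Multiset (Var G)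
  | .mk _ _ y => {y}
  | .opn b => {b.y}
  | _ => 0

variable (S) in
/-- The function names that an event introduces. -/
def evFns : S.net.Ev → Multiset (Var G)
  | .gate g => Gt.fns g
  | .cls _ => 0

variable (S) in
/-- The function names that events introduce. -/
def fns (E : Multiset S.net.Ev) : Multiset (Var G) := (E.map S.evFns).sum

@[simp] theorem fns_add (E E' : Multiset S.net.Ev) : S.fns (E + E') = S.fns E + S.fns E' := by
  simp [fns]

@[simp] theorem fns_zero : S.fns 0 = 0 := rfl

@[simp] theorem fns_gate (g : Gt G) : S.fns {S.ge g} = g.fns := by simp [fns, ge, evFns]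

@[simp] theorem fns_close (b : Bx G) : S.fns {S.ce b} = 0 := by simp [fns, ce, evFns]

theorem fns_gev {g : Gt G} (h : g.fns = 0) : S.fns (S.gev g) = 0 := by
  rw [gev]; split_ifs <;> simp [h]

variable (S) in
/-- The functions of a derivation have distinct names, which occur in its context. -/
theorem fns_nodup {x : Var G} {κ : Cx G} {Γ : List (Ty G)} (d : Deriv x κ Γ) (ρ : Var G → Wr G) :
    (x ::ₘ S.fns (S.events d ρ)).Nodup ∧ ∀ v ∈ S.fns (S.events d ρ), v ∈ κ.names := by
  -- The variable convention keeps the function names of two premises apart.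
  have key : ∀ {x y : Var G} {κ ζ : Cx G} {F F' : Multiset (Var G)}, Apart x κ y ζ →
      (x ::ₘ F).Nodup → (∀ v ∈ F, v ∈ κ.names) → (y ::ₘ F').Nodup → (∀ v ∈ F', v ∈ ζ.names) →
      (x ::ₘ (F + (y ::ₘ F'))).Nodup := by
    intro x y κ ζ F F' ha h₁ h₂ h₃ h₄
    rw [← Multiset.cons_add, Multiset.nodup_add]
    refine ⟨h₁, h₃, Multiset.disjoint_left.2 fun {v} hv hv' => ?_⟩
    have i : v ∈ {x} ∪ κ.names := (Multiset.mem_cons.1 hv).imp id (h₂ v)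
    exact Set.disjoint_left.1 ha i ((Multiset.mem_cons.1 hv').imp id (h₄ v))
  -- Substitution for `y` can remove no name but `y`, which is not among the function names.
  have sub : ∀ {y : Var G} {ζ : Cx G} {M : Tm G} {F' : Multiset (Var G)},
      (y ::ₘ F').Nodup → (∀ v ∈ F', v ∈ ζ.names) → ∀ v ∈ F', v ∈ (ζ.subst y M).names := by
    intro y ζ M F' h h' v hv
    refine Cx.mem_names_subst (h' v hv) ?_
    rintro rfl
    exact (Multiset.nodup_cons.1 h).1 hv
  induction d generalizing ρ with
  | ax x => simp [events]
  | exch n d ih => rw [events, Cx.names_swapAt]; exact ih ρ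
  | @cut z x κ ζ M Γ Δ d e ha ih ih' =>
    obtain ⟨h₁, h₂⟩ := ih ρ
    obtain ⟨h₃, h₄⟩ := ih' (upd ρ x (M.wr ρ))
    rw [events, fns_add, Cx.names_append]
    constructor
    · refine Multiset.nodup_of_le ?_ (key ha h₁ h₂ h₃ h₄)
      exact Multiset.cons_le_cons _ (add_le_add_right (Multiset.le_cons_self _ _) _)
    · intro v hv
      rcases Multiset.mem_add.1 hv with hv | hv
      · have := h₂ v hv
        rw [Cx.names_snoc] at this
        exact this.symm.imp id e.free.names_subset
      · exact .inr (sub h₃ h₄ v hv)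
  | parI d ih =>
    obtain ⟨h₁, h₂⟩ := ih ρ
    rw [events, fns_add, fns_gev rfl, add_zero]
    refine ⟨h₁, fun v hv => ?_⟩
    have := h₂ v hv
    simp only [Cx.names_snoc, Tm.names, Set.mem_union] at this ⊢
    tauto
  | @parE z x y κ ζ ξ N Υ Γ Δ d e f ha hb hc ih ih' ih'' =>
    obtain ⟨h₁, h₂⟩ := ih ρ
    obtain ⟨h₃, h₄⟩ := ih' (upd ρ x (.casel (N.wr ρ)))
    obtain ⟨h₅, h₆⟩ := ih'' (upd ρ y (.caser (N.wr ρ)))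
    rw [events, fns_add, fns_add, fns_add, fns_gev rfl, zero_add, Cx.names_append, Cx.names_append]
    constructor
    · rw [← add_assoc, ← Multiset.cons_add, Multiset.nodup_add]
      refine ⟨?_, (Multiset.nodup_cons.1 h₅).2, ?_⟩
      · refine Multiset.nodup_of_le ?_ (key ha h₁ h₂ h₃ h₄)
        exact Multiset.cons_le_cons _ (add_le_add_right (Multiset.le_cons_self _ _) _)
      · refine Multiset.disjoint_left.2 fun {v} hv hv' => ?_
        rw [← Multiset.cons_add] at hv
        rcases Multiset.mem_add.1 hv with hv | hv
        · exact Set.disjoint_left.1 hb ((Multiset.mem_cons.1 hv).imp id (h₂ v)) (.inr (h₆ v hv'))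
        · exact Set.disjoint_left.1 hc (.inr (h₄ v hv)) (.inr (h₆ v hv'))
    · intro v hv
      rcases Multiset.mem_add.1 hv with hv | hv
      · have := h₂ v hv
        rw [Cx.names_snoc] at this
        exact .inl (this.symm.imp id (e.free.names_subset (M := .casel N)))
      rcases Multiset.mem_add.1 hv with hv | hv
      · exact .inl (.inr (sub h₃ h₄ v hv))
      · exact .inr (sub h₅ h₆ v hv)
  | @subI x y κ ζ M A Γ Δ d e ha ih ih' =>
    obtain ⟨h₁, h₂⟩ := ih ρ
    obtain ⟨h₃, h₄⟩ := ih' (upd ρ y (.app y (M.wr ρ)))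
    rw [events, fns_add, fns_add, fns_gate, Gt.fns, Multiset.singleton_add, Cx.names_snoc,
      Cx.names_append]
    refine ⟨key ha h₁ h₂ h₃ h₄, fun v hv => ?_⟩
    rcases Multiset.mem_add.1 hv with hv | hv
    · have := h₂ v hv
      rw [Cx.names_snoc] at this
      exact this.imp .inr .inl
    rcases Multiset.mem_cons.1 hv with rfl | hv
    · exact .inl (.inl rfl)
    · exact .inr (.inr (sub h₃ h₄ v hv))
  | @subE x y κ ξ M N B Γ Δ d e ha ih ih' =>
    obtain ⟨h₁, h₂⟩ := ih ρ
    obtain ⟨h₃, h₄⟩ := ih' (upd ρ y (.app y (M.wr ρ)))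
    rw [events, fns_add, fns_add, fns_add, fns_gate, fns_close, add_zero, Gt.fns,
      Multiset.singleton_add, Cx.names_addP, Cx.names_append]
    refine ⟨key ha h₁ h₂ h₃ h₄, fun v hv => ?_⟩
    rcases Multiset.mem_add.1 hv with hv | hv
    · have := h₂ v hv
      rw [Cx.names_snoc] at this
      exact this.imp (fun h => .inr (.inr h)) .inl
    rcases Multiset.mem_cons.1 hv with rfl | hv
    · exact .inl (.inl rfl)
    · have := h₄ v hv
      rw [Cx.names_snoc] at this
      have hvy : v ≠ y := by rintro rfl; exact (Multiset.nodup_cons.1 h₃).1 hv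
      exact this.imp (fun h => .inr (.inl h)) fun h => .inr (Cx.mem_names_subst h hvy)
  | botI d _ ih =>
    obtain ⟨h₁, h₂⟩ := ih ρ
    rw [Cx.names_snoc]
    exact ⟨h₁, fun v hv => .inr (h₂ v hv)⟩
  | botE n => rw [events, fns_gev rfl]; simp

end Structure
end CoILL

-- Counting labels: each is produced at most once

namespace CoILL

universe u

set_option linter.unusedSectionVars false

variable {G : Type u} {C : Type*} [Category C] [MonoidalCategory C] [SymmetricCategory C]
  [LeftClosed C]

open WireSig Classical

theorem Multiset.count_sum_map_le {α β γ : Type*} [DecidableEq β] [DecidableEq γ] {s : Multiset α} {f : α → Multiset β}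
    {g : α → Multiset γ} {b : β} {c : γ} (h : ∀ a ∈ s, (f a).count b ≤ (g a).count c) :
    (s.map f).sum.count b ≤ (s.map g).sum.count c := by
  induction s using Multiset.induction with
  | empty => simp
  | cons a s ih =>
    simp only [Multiset.map_cons, Multiset.sum_cons, Multiset.count_add]
    exact add_le_add (h a (Multiset.mem_cons_self _ _))
      (ih fun a ha => h a (Multiset.mem_cons_of_mem ha))

namespace Structure

variable (S : Structure G C)

/-- A gate is proper if its types fit and it is not structural. -/
def Gt.Proper : Gt G → Prop
  | .split W A B => W.ty = .par A B ∧ tops (S.gin (.split W A B)) ≠ 0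
  | .join W₀ W₁ A B => (W₀.ty = A ∧ W₁.ty = B) ∧ tops (S.gin (.join W₀ W₁ A B)) ≠ 0
  | .kill W => tops (S.gin (.kill W)) ≠ 0
  | _ => True

/-- Proper events. -/
def EvProper : S.net.Ev → Prop
  | .gate g => Gt.Proper S g
  | .cls _ => True

variable {S}

theorem mem_gev {g : Gt G} {e : S.net.Ev} : e ∈ S.gev g ↔ tops (S.gin g) ≠ 0 ∧ e = S.ge g := by
  rw [gev]; split_ifs with h <;> simp [h]

theorem wev_proper {W : Wr G} {e : S.net.Ev} (h : e ∈ S.wev W) : S.EvProper e := by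
  induction W with
  | var => exact h.elim
  | app y W ih => exact ih h
  | conn => exact h.elim
  | par W₀ W₁ ih ih' =>
    rcases h with h | h | h
    · obtain ⟨h', rfl⟩ := mem_gev.1 h; exact ⟨⟨rfl, rfl⟩, h'⟩
    · exact ih h
    · exact ih' h
  | casel W ih =>
    rcases h with ⟨A, B, e, h⟩ | h
    · obtain ⟨h', rfl⟩ := mem_gev.1 h; exact ⟨e, h'⟩
    · exact ih h
  | caser W ih =>
    rcases h with ⟨A, B, e, h⟩ | h
    · obtain ⟨h', rfl⟩ := mem_gev.1 h; exact ⟨e, h'⟩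
    · exact ih h
  | mkc W y ih =>
    rcases h with rfl | h
    · trivial
    · exact ih h

theorem cev_proper {ρ : Var G → Wr G} {κ : Cx G} {e : S.net.Ev} (h : e ∈ S.cev ρ κ) :
    S.EvProper e := by
  rcases h with ⟨P, hP, h⟩ | ⟨M, hM, h⟩
  · cases P with
    | postp₂ y N M =>
      rcases h with ⟨B, -, rfl | rfl⟩ | h | h
      · trivial
      · trivial
      · exact wev_proper h
      · exact wev_proper h
    | postp M =>
      rcases h with h | h
      · obtain ⟨h', rfl⟩ := mem_gev.1 h; exact h'
      · exact wev_proper h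
    | _ => exact h.elim
  · exact wev_proper h

variable (S) in
/-- The key of a typed wire. -/
def kw (W : Wr G) (A : Ty G) : S.sig.Key := .inl (S.wl W A)

variable (S) in
/-- The key of a token. -/
def kt (v : Var G) : S.sig.Key := S.toks.key v

variable (S) in
/-- The key of a box. -/
def kb (b : Bx G) : S.sig.Key := .inr b

theorem kw_inj {W W' : Wr G} {A A' : Ty G} : S.kw W A = S.kw W' A' ↔ W = W' ∧ A = A' := by
  constructor
  · intro h
    have : (Lab.w W A : Lab G) = .w W' A' := Sum.inl.inj h
    cases this; exact ⟨rfl, rfl⟩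
  · rintro ⟨rfl, rfl⟩; rfl

theorem kt_inj {v w : Var G} : S.kt v = S.kt w ↔ v = w := by
  constructor
  · intro h
    have : (Lab.tok v : Lab G) = .tok w := Sum.inl.inj h
    cases this; rfl
  · rintro rfl; rfl

theorem kb_inj {b b' : Bx G} : S.kb b = S.kb b' ↔ b = b' :=
  ⟨fun h => Sum.inr.inj h, fun h => h ▸ rfl⟩

theorem kw_ne_kt (W : Wr G) (A : Ty G) (v : Var G) : S.kw W A ≠ S.kt v := fun h => by
  have : (Lab.w W A : Lab G) = .tok v := Sum.inl.inj h
  cases this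

theorem kw_ne_kb (W : Wr G) (A : Ty G) (b : Bx G) : S.kw W A ≠ S.kb b := fun h => by cases h

theorem kt_ne_kb (v : Var G) (b : Bx G) : S.kt v ≠ S.kb b := fun h => by cases h

theorem key_cases (k : S.sig.Key) :
    (∃ W A, k = S.kw W A) ∨ (∃ v, k = S.kt v) ∨ ∃ b, k = S.kb b := by
  match k with
  | .inl (.w W A) => exact .inl ⟨W, A, rfl⟩
  | .inl (.tok v) => exact .inr (.inl ⟨v, rfl⟩)
  | .inr b => exact .inr (.inr ⟨b, rfl⟩)

theorem key_wi_eq (W : Wr G) (A : Ty G) :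
    key (S.wi W A) = if W.Link ∧ A.Trivial then 0 else {S.kw W A} := by
  split_ifs with h
  · exact key_wi_triv _ h
  · exact key_wi _ h

theorem key_tk (v : Var G) : key (S.tk v) = {S.kt v} := S.toks.key_wire v

theorem key_bo (b : Bx G) (L : S.sig.St) : key (S.bo b L) = {S.kb b} := rfl

theorem inner_bo (b : Bx G) (L : S.sig.St) : inner (S.bo b L) = labs L := inner_box _ _

theorem count_wi_kw (W W' : Wr G) (A A' : Ty G) : (key (S.wi W A)).count (S.kw W' A') =
    if (W' = W ∧ A' = A) ∧ ¬ (W.Link ∧ A.Trivial) then 1 else 0 := by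
  rw [key_wi_eq]
  by_cases h : W.Link ∧ A.Trivial
  · rw [if_pos h, if_neg fun h' => h'.2 h]; rfl
  · rw [if_neg h, Multiset.count_singleton]; simp only [kw_inj, h, not_false_eq_true, and_true]

theorem count_wi_kt (W : Wr G) (A : Ty G) (v : Var G) : (key (S.wi W A)).count (S.kt v) = 0 :=
  Multiset.count_eq_zero.2 (S.tok_notMem_wi v W A)

theorem count_wi_kb (W : Wr G) (A : Ty G) (b : Bx G) : (key (S.wi W A)).count (S.kb b) = 0 :=
  Multiset.count_eq_zero.2 (Net.inr_notMem_key_wire _ _)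

theorem ev_cases {P : S.net.Ev → Prop} (hg : ∀ g, P (S.ge g)) (hc : ∀ b, P (S.ce b)) (e) : P e :=
  match e with
  | .gate g => hg g
  | .cls b => hc b

theorem outs_gate (g : Gt G) : (S.ge g).outs = labs (S.gout g) := rfl

theorem ins_gate (g : Gt G) : (S.ge g).ins = labs (S.gin g) := rfl

theorem evFns_gate (g : Gt G) : S.evFns (S.ge g) = g.fns := rfl

theorem evProper_gate (g : Gt G) : S.EvProper (S.ge g) = g.Proper S := rfl

/-- Only a gate that introduces the function `y` makes such a label, and it makes it at most once.
The same goes for `mkc` labels, tokens and boxes. -/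
theorem count_outs_app (e : S.net.Ev) (y : Var G) (W : Wr G) (A : Ty G) :
    e.outs.count (S.kw (.app y W) A) ≤ (S.evFns e).count y := by
  induction e using ev_cases with
  | hc => rfl
  | hg g =>
    rw [outs_gate, evFns_gate]
    rcases g with _ | _ | _ | _ | _ <;>
    simp only [gout, labs_cons, labs_nil, inner_wire, inner_bo, Multiset.count_add, count_wi_kw,
      key_tk, key_bo, Multiset.count_singleton, Gt.fns, kw_ne_kt, kw_ne_kb, Multiset.count_zero,
      reduceCtorEq, false_and, if_false, add_zero, zero_add, le_refl, Wr.app.injEq]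
    · grind
    · grind

theorem count_outs_mkc (e : S.net.Ev) (y : Var G) (W : Wr G) (A : Ty G) :
    e.outs.count (S.kw (.mkc W y) A) ≤ (S.evFns e).count y := by
  induction e using ev_cases with
  | hc => rfl
  | hg g =>
    rw [outs_gate, evFns_gate]
    rcases g with _ | _ | _ | _ | _ <;>
    simp only [gout, labs_cons, labs_nil, inner_wire, inner_bo, Multiset.count_add, count_wi_kw,
      key_tk, key_bo, Multiset.count_singleton, Gt.fns, kw_ne_kt, kw_ne_kb, Multiset.count_zero,
      reduceCtorEq, false_and, if_false, add_zero, le_refl, Wr.mkc.injEq, Nat.zero_le]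
    · grind

theorem count_outs_kt (e : S.net.Ev) (y : Var G) :
    e.outs.count (S.kt y) ≤ (S.evFns e).count y := by
  induction e using ev_cases with
  | hc => rfl
  | hg g =>
    rw [outs_gate, evFns_gate]
    rcases g with _ | _ | _ | _ | _ <;>
    simp only [gout, labs_cons, labs_nil, inner_wire, inner_bo, Multiset.count_add, count_wi_kt,
      key_tk, key_bo, Multiset.count_singleton, Gt.fns, kt_inj, kt_ne_kb, Multiset.count_zero,
      if_false, add_zero, zero_add, le_refl]

theorem count_outs_kb (e : S.net.Ev) (b : Bx G) :
    e.outs.count (S.kb b) ≤ (S.evFns e).count b.y := by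
  induction e using ev_cases with
  | hc => rfl
  | hg g =>
    rw [outs_gate, evFns_gate]
    rcases g with _ | _ | _ | _ | _ <;>
    simp only [gout, labs_cons, labs_nil, inner_wire, inner_bo, Multiset.count_add, count_wi_kb,
      key_tk, key_bo, Multiset.count_singleton, Gt.fns, kb_inj, (kt_ne_kb _ _).symm,
      Multiset.count_zero, if_false, add_zero, le_refl, Nat.zero_le]
    · grind

/-- No gate makes a variable or a link: the only variable is the root, and links are inserted
structurally. -/
theorem count_outs_var (e : S.net.Ev) (v : Var G) (A : Ty G) :
    e.outs.count (S.kw (.var v) A) = 0 := by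
  induction e using ev_cases with
  | hc => rfl
  | hg g =>
    rw [outs_gate]
    rcases g with _ | _ | _ | _ | _ <;>
    simp only [gout, labs_cons, labs_nil, inner_wire, inner_bo, Multiset.count_add, count_wi_kw,
      key_tk, key_bo, Multiset.count_singleton, kw_ne_kt, kw_ne_kb, Multiset.count_zero,
      reduceCtorEq, false_and, if_false, add_zero]

theorem count_outs_conn (e : S.net.Ev) (v : Var G) (A : Ty G) :
    e.outs.count (S.kw (.conn v) A) = 0 := by
  induction e using ev_cases with
  | hc => rfl
  | hg g =>
    rw [outs_gate]
    rcases g with _ | _ | _ | _ | _ <;>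
    simp only [gout, labs_cons, labs_nil, inner_wire, inner_bo, Multiset.count_add, count_wi_kw,
      key_tk, key_bo, Multiset.count_singleton, kw_ne_kt, kw_ne_kb, Multiset.count_zero,
      reduceCtorEq, false_and, if_false, add_zero]

/-- Only a split of `W` makes this label. Properness fixes the type at which `W` is consumed, and
`W` does have a key, since a trivial wire would have trivial components. -/
theorem count_outs_casel (e : S.net.Ev) (he : S.EvProper e) (W : Wr G) (A : Ty G) :
    e.outs.count (S.kw (.casel W) A) ≤ e.ins.count (S.kw W W.ty) := by
  induction e using ev_cases with
  | hc => first | rfl | exact Nat.zero_le _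
  | hg g =>
    rw [outs_gate, ins_gate]
    rw [evProper_gate] at he
    rcases g with _ | _ | _ | _ | _ <;>
    simp only [gout, gin, labs_cons, labs_nil, inner_wire, inner_bo, Multiset.count_add,
      count_wi_kw, key_tk, key_bo, Multiset.count_singleton, kw_ne_kt, kw_ne_kb,
      Multiset.count_zero, reduceCtorEq, false_and, if_false, add_zero, zero_add, Nat.zero_le,
      Wr.casel.injEq]
    simp only [Gt.Proper] at he
    split_ifs with h₁ h₂
    · rfl
    · obtain ⟨⟨rfl, rfl⟩, h⟩ := h₁
      exact (h₂ ⟨⟨rfl, he.1⟩, fun h' => h ⟨h'.1, h'.2.1⟩⟩).elim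
    · exact Nat.zero_le _
    · exact le_rfl

theorem count_outs_caser (e : S.net.Ev) (he : S.EvProper e) (W : Wr G) (A : Ty G) :
    e.outs.count (S.kw (.caser W) A) ≤ e.ins.count (S.kw W W.ty) := by
  induction e using ev_cases with
  | hc => first | rfl | exact Nat.zero_le _
  | hg g =>
    rw [outs_gate, ins_gate]
    rw [evProper_gate] at he
    rcases g with _ | _ | _ | _ | _ <;>
    simp only [gout, gin, labs_cons, labs_nil, inner_wire, inner_bo, Multiset.count_add,
      count_wi_kw, key_tk, key_bo, Multiset.count_singleton, kw_ne_kt, kw_ne_kb,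
      Multiset.count_zero, reduceCtorEq, false_and, if_false, add_zero, Nat.zero_le,
      Wr.caser.injEq]
    simp only [Gt.Proper] at he
    split_ifs with h₁ h₂
    · rfl
    · obtain ⟨⟨rfl, rfl⟩, h⟩ := h₁
      exact (h₂ ⟨⟨rfl, he.1⟩, fun h' => h ⟨h'.1, h'.2.2⟩⟩).elim
    · exact Nat.zero_le _
    · exact le_rfl

/-- A wire produced by a join comes from one of its inputs that is not trivial. -/
theorem count_outs_par (W₀ W₁ : Wr G) (A : Ty G) : ∃ W : Wr G, (W = W₀ ∨ W = W₁) ∧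
    ∀ e : S.net.Ev, S.EvProper e → e.outs.count (S.kw (.par W₀ W₁) A) ≤
      e.ins.count (S.kw W W.ty) := by
  -- If the left input is trivial, the right one is not: otherwise the output would be trivial too
  -- and have no label.
  by_cases h₀ : W₀.Link ∧ W₀.ty.Trivial
  · refine ⟨W₁, .inr rfl, fun e he => ?_⟩
    induction e using ev_cases with
    | hc => first | rfl | exact Nat.zero_le _
    | hg g =>
      rw [outs_gate, ins_gate]
      rw [evProper_gate] at he
      rcases g with _ | ⟨V₀, V₁, A', B'⟩ | _ | _ | _ <;>
      simp only [gout, gin, labs_cons, labs_nil, inner_wire, inner_bo, Multiset.count_add,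
        count_wi_kw, key_tk, key_bo, Multiset.count_singleton, kw_ne_kt, kw_ne_kb,
        Multiset.count_zero, reduceCtorEq, false_and, if_false, add_zero, Nat.zero_le,
        Wr.par.injEq]
      simp only [Gt.Proper] at he
      obtain ⟨⟨rfl, rfl⟩, -⟩ := he
      rcases Classical.em (((W₀ = V₀ ∧ W₁ = V₁) ∧ A = V₀.ty.par V₁.ty) ∧
        ¬ ((V₀.par V₁).Link ∧ (V₀.ty.par V₁.ty).Trivial)) with h₁ | h₁
      · obtain ⟨⟨⟨rfl, rfl⟩, rfl⟩, h⟩ := h₁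
        rw [if_pos ⟨⟨⟨rfl, rfl⟩, rfl⟩, h⟩, if_pos ⟨⟨rfl, rfl⟩, fun h' => h ⟨⟨h₀.1, h'.1⟩, ⟨h₀.2, h'.2⟩⟩⟩]
        exact Nat.le_add_right _ _
      · rw [if_neg h₁]; exact Nat.zero_le _
  · refine ⟨W₀, .inl rfl, fun e he => ?_⟩
    induction e using ev_cases with
    | hc => first | rfl | exact Nat.zero_le _
    | hg g =>
      rw [outs_gate, ins_gate]
      rw [evProper_gate] at he
      rcases g with _ | ⟨V₀, V₁, A', B'⟩ | _ | _ | _ <;>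
      simp only [gout, gin, labs_cons, labs_nil, inner_wire, inner_bo, Multiset.count_add,
        count_wi_kw, key_tk, key_bo, Multiset.count_singleton, kw_ne_kt, kw_ne_kb,
        Multiset.count_zero, reduceCtorEq, false_and, if_false, add_zero, Nat.zero_le,
        Wr.par.injEq]
      simp only [Gt.Proper] at he
      obtain ⟨⟨rfl, rfl⟩, -⟩ := he
      rcases Classical.em (((W₀ = V₀ ∧ W₁ = V₁) ∧ A = V₀.ty.par V₁.ty) ∧
        ¬ ((V₀.par V₁).Link ∧ (V₀.ty.par V₁.ty).Trivial)) with h₁ | h₁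
      · obtain ⟨⟨⟨rfl, rfl⟩, rfl⟩, h⟩ := h₁
        rw [if_pos ⟨⟨⟨rfl, rfl⟩, rfl⟩, h⟩, if_pos (c := (W₀ = W₀ ∧ W₀.ty = W₀.ty) ∧ _) ⟨⟨rfl, rfl⟩, h₀⟩]
        exact Nat.le_add_left _ _
      · rw [if_neg h₁]; exact Nat.zero_le _

variable (S) in
/-- The state in which a derivation starts. -/
def start (x : Var G) : S.sig.St := [S.wi (.var x) x.ty, S.tk x]

/-- If the events introduce distinct names and are fed by the wires that they produce, then all
the labels are distinct. -/
theorem labs_nodup {x : Var G} {E : Multiset S.net.Ev} (hf : (x ::ₘ S.fns E).Nodup)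
    (hp : ∀ e ∈ E, S.EvProper e) (hi : Net.insSum E ≤ labs (S.start x) + Net.outsSum E) :
    (labs (S.start x) + Net.outsSum E).Nodup := by
  have hx : ∀ v, (S.fns E).count v + (if v = x then 1 else 0) ≤ 1 := by
    intro v
    have := Multiset.nodup_iff_count_le_one.1 hf v
    rwa [Multiset.count_cons] at this
  have fn : ∀ {k v}, (∀ e : S.net.Ev, e.outs.count k ≤ (S.evFns e).count v) →
      (Net.outsSum E).count k ≤ (S.fns E).count v :=
    fun h => Multiset.count_sum_map_le fun e _ => h e
  -- If making `k` costs a `k'`, and at most one `k'` is ever supplied, then `k` is made at most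
  -- once: by `hi`, consumption is bounded by supply.
  have inp : ∀ {k k'}, (labs (S.start x) + Net.outsSum E).count k' ≤ 1 →
      (∀ e : S.net.Ev, S.EvProper e → e.outs.count k ≤ e.ins.count k') →
      (Net.outsSum E).count k ≤ 1 := fun h h' =>
    (Multiset.count_sum_map_le fun e he => h' e (hp e he)).trans
      ((Multiset.count_le_of_le _ hi).trans h)
  have zero : ∀ {k}, (∀ e : S.net.Ev, e.outs.count k = 0) → (Net.outsSum E).count k = 0 := by
    intro k h
    have := Multiset.count_sum_map_le (s := E) (f := Net.Ev.outs) (b := k) (c := x)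
      (g := fun _ => (0 : Multiset (Var G))) fun e _ => (h e).le.trans (Nat.zero_le _)
    simpa [Net.outsSum] using this
  have init : ∀ k, (labs (S.start x)).count k =
      (key (S.wi (.var x) x.ty)).count k + (key (S.tk x)).count k := by
    intro k
    simp only [start, labs_cons, labs_nil, inner_wire, Multiset.count_add, add_zero]
  rw [Multiset.nodup_iff_count_le_one]
  intro k
  rcases key_cases k with ⟨W, A, rfl⟩ | ⟨v, rfl⟩ | ⟨b, rfl⟩
  -- Labels headed by a function are bounded by the distinctness of function names; `casel`, `caser`
  -- and `par` are reduced to the proper subterm that is consumed in making them.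
  · induction W generalizing A with
    | var v =>
      rw [Multiset.count_add, init, count_wi_kw, key_tk, Multiset.count_singleton,
        if_neg (kw_ne_kt _ _ _), zero fun e => count_outs_var e v A]
      split_ifs <;> simp
    | conn v =>
      rw [Multiset.count_add, init, count_wi_kw, key_tk, Multiset.count_singleton,
        if_neg (kw_ne_kt _ _ _), zero fun e => count_outs_conn e v A]
      simp
    | app y W _ =>
      have := fn fun e => count_outs_app e y W A
      have h := hx y
      rw [Multiset.count_add, init, count_wi_kw, key_tk, Multiset.count_singleton,
        if_neg (kw_ne_kt _ _ _), if_neg (by simp)]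
      omega
    | mkc W y _ =>
      have := fn fun e => count_outs_mkc e y W A
      have h := hx y
      rw [Multiset.count_add, init, count_wi_kw, key_tk, Multiset.count_singleton,
        if_neg (kw_ne_kt _ _ _), if_neg (by simp)]
      omega
    | casel W ih =>
      have := inp (ih W.ty) fun e he => count_outs_casel e he W A
      rw [Multiset.count_add, init, count_wi_kw, key_tk, Multiset.count_singleton,
        if_neg (kw_ne_kt _ _ _), if_neg (by simp)]
      omega
    | caser W ih =>
      have := inp (ih W.ty) fun e he => count_outs_caser e he W A
      rw [Multiset.count_add, init, count_wi_kw, key_tk, Multiset.count_singleton,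
        if_neg (kw_ne_kt _ _ _), if_neg (by simp)]
      omega
    | par W₀ W₁ ih₀ ih₁ =>
      obtain ⟨W, hW, h⟩ := count_outs_par (S := S) W₀ W₁ A
      have hW' : (labs (S.start x) + Net.outsSum E).count (S.kw W W.ty) ≤ 1 := by
        rcases hW with rfl | rfl
        · exact ih₀ _
        · exact ih₁ _
      have := inp hW' h
      rw [Multiset.count_add, init, count_wi_kw, key_tk, Multiset.count_singleton,
        if_neg (kw_ne_kt _ _ _), if_neg (by simp)]
      omega
  · have := fn fun e => count_outs_kt e v
    have h := hx v
    rw [Multiset.count_add, init, count_wi_kt, key_tk, Multiset.count_singleton]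
    simp only [kt_inj]
    omega
  · have := fn fun e => count_outs_kb e b
    have h := hx b.y
    rw [Multiset.count_add, init, count_wi_kb, key_tk, Multiset.count_singleton,
      if_neg (kt_ne_kb _ _).symm]
    omega

/-- Outputs have to be considered because a `mk` gate on a trivial wire consumes no label; it does
produce its token. -/
theorem ins_or_outs {e : S.net.Ev} (h : S.EvProper e) : e.ins ≠ 0 ∨ e.outs ≠ 0 := by
  have hl : ∀ g, tops (S.gin g) ≠ 0 → (S.ge g).ins ≠ 0 := fun g h h' => by
    rw [ins_gate, WireSig.labs_eq] at h'
    exact h (add_eq_zero.1 h').1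
  induction e using ev_cases with
  | hc b => exact .inl fun h => by simpa [ce, Net.Ev.ins] using congrArg Multiset.card h
  | hg g =>
    rw [evProper_gate] at h
    cases g with
    | split => exact .inl (hl _ h.2)
    | join => exact .inl (hl _ h.2)
    | kill => exact .inl (hl _ h)
    | mk W A y =>
      right
      rw [outs_gate]
      simp [gout, key_tk]
    | opn b =>
      right
      rw [outs_gate]
      simp [gout, key_bo]

/-- An event occurring twice would consume or produce some label twice. -/
theorem nodup_of_labs {E : Multiset S.net.Ev} (hp : ∀ e ∈ E, S.EvProper e)
    (ho : (Net.outsSum E).Nodup) (hi : (Net.insSum E).Nodup) : E.Nodup := by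
  rw [Multiset.nodup_iff_le]
  intro e h
  obtain ⟨F, rfl⟩ := Multiset.le_iff_exists_add.1 h
  have hn : ∀ {s t : Multiset S.sig.Key}, s ≠ 0 → ¬ (s + (s + t)).Nodup := by
    intro s t hs h
    obtain ⟨k, hk⟩ := Multiset.exists_mem_of_ne_zero hs
    exact Multiset.disjoint_left.1 (Multiset.nodup_add.1 h).2.2 hk (Multiset.mem_add.2 (.inl hk))
  simp only [Multiset.cons_add, Net.insSum_cons, Net.outsSum_cons] at ho hi
  rcases ins_or_outs (hp e (by simp)) with h | h
  · exact hn h hi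
  · exact hn h ho

end Structure
end CoILL

namespace CoILL

universe u

set_option linter.unusedSectionVars false

/-! ### Coherence -/

variable {G : Type u} {C : Type*} [Category C] [MonoidalCategory C] [SymmetricCategory C]
  [LeftClosed C]

open WireSig Classical

theorem WireSig.isIso_pre {W : WireSig.{u} C} {r r' : W.St} (f : W.ctx r ⟶ W.ctx r') [IsIso f]
    (J : W.St) : IsIso (pre f J) := by
  induction J with
  | nil => assumption
  | cons i J ih => exact inferInstanceAs (IsIso (pre f J ▷ W.obj i))

namespace Tokens

variable {W : WireSig.{u} C} {K : Tokens W}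

theorem Ins.labs_eq {ts} {r r' : W.St} {t} (h : K.Ins ts r r' t) :
    labs r' = labs r + (ts : Multiset K.Name).map K.key := by
  induction h with
  | nil => simp
  | cons v _ ih =>
    rw [labs_cons, ih, key_wire, inner_wire, ← Multiset.cons_coe, Multiset.map_cons,
      ← Multiset.singleton_add]
    abel

theorem Ins.isIso {ts} {r r' : W.St} {t} (h : K.Ins ts r r' t) : IsIso t := by
  induction h with
  | nil => infer_instance
  | @cons v _ _ r' _ _ ih =>
    have : IsIso (K.new v r') := ⟨K.del v r', new_del v r', del_new v r'⟩
    infer_instance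

theorem whiskerLeft_cancel {X Y Z : C} (a : X ≅ 𝟙_ C) {f g : Y ⟶ Z} (h : X ◁ f = X ◁ g) :
    f = g := by
  have e : ∀ f : Y ⟶ Z, f = (λ_ Y).inv ≫ a.inv ▷ Y ≫ X ◁ f ≫ a.hom ▷ Z ≫ (λ_ Z).hom := by
    intro f
    rw [← whisker_exchange_assoc, ← comp_whiskerRight_assoc, a.inv_hom_id]
    simp
  rw [e f, e g, h]

theorem wh_cancel {r I O : W.St} (a : W.ctx r ≅ 𝟙_ C) {f g : W.ctx I ⟶ W.ctx O}
    (h : wh r f = wh r g) : f = g := by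
  refine whiskerLeft_cancel a ?_
  simpa [wh] using h

end Tokens

namespace Structure

variable {S : Structure G C}

theorem proper_of_mem_events {x : Var G} {κ : Cx G} {Γ : List (Ty G)} (d : Deriv x κ Γ)
    {e : S.net.Ev} (h : e ∈ S.events d .var) : S.EvProper e :=
  cev_proper ((S.mem_events d (ρ := .var) rfl).1 (.inl h))

theorem mem_events_var {x : Var G} {κ : Cx G} {Γ : List (Ty G)} (d : Deriv x κ Γ)
    {e : S.net.Ev} : e ∈ S.events d .var ↔ e ∈ S.cev .var κ := by
  rw [← S.mem_events d (ρ := .var) rfl]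
  exact (or_iff_left id).symm

/-- Derivations with the same events are interpreted by the same morphism. -/
theorem interp_comp_eq {x : Var G} {κ κ' : Cx G} {Γ Γ' : List (Ty G)} (d : Deriv x κ Γ)
    (d' : Deriv x κ' Γ') {L L' : S.sig.St} {i : S.ctx Γ ⟶ S.sig.ctx L} {i' s}
    (hl : S.Lift (κ.terms.map (Tm.wr .var)) Γ L i)
    (hl' : S.Lift (κ'.terms.map (Tm.wr .var)) Γ' L' i') (hs : S.sig.Str L L' s)
    (he : ∀ e, e ∈ S.cev .var κ ↔ e ∈ S.cev .var κ') :
    S.interp d ≫ i ≫ s = S.interp d' ≫ i' := by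
  obtain ⟨L₁, i₁, f, ts, h₁, -, hf, hd⟩ := S.simulates d .var
  obtain ⟨L₂, i₂, f', ts', h₂, -, hf', hd'⟩ := S.simulates d' .var
  obtain ⟨rfl, rfl⟩ := h₁.unique hl
  obtain ⟨rfl, rfl⟩ := h₂.unique hl'
  have hx : S.toks.key x ∈ tops [S.tk x] := by
    rw [tops_cons, Tokens.key_wire]; simp
  -- Both simulations start from the same state, the root wire together with the token of the root.
  obtain ⟨r, t, ht, hr⟩ := hd [S.tk x] hx
  obtain ⟨r', t', ht', hr'⟩ := hd' [S.tk x] hx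
  -- By conservation of labels, whatever is consumed was there at the start or has been produced.
  have hi := le_add_self.trans hr.labs_eq.le
  have hn := labs_nodup (S := S) (S.fns_nodup d .var).1 (fun e => proper_of_mem_events d) hi
  have hi' := le_add_self.trans hr'.labs_eq.le
  have hn' := labs_nodup (S := S) (S.fns_nodup d' .var).1 (fun e => proper_of_mem_events d') hi'
  -- Neither multiset of events has repetitions, so each is determined by its members, and these are
  -- recorded by the terms.
  have hE : S.events d' .var = S.events d .var := by
    refine (Multiset.Nodup.ext ?_ ?_).2 fun e => ?_
    · exact nodup_of_labs (fun e => proper_of_mem_events d') (Multiset.nodup_add.1 hn').2.1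
        (Multiset.nodup_of_le hi' hn')
    · exact nodup_of_labs (fun e => proper_of_mem_events d) (Multiset.nodup_add.1 hn).2.1
        (Multiset.nodup_of_le hi hn)
    · rw [mem_events_var, mem_events_var, he]
  rw [hE] at hr'
  -- The final states have the same labels, hence the same tokens up to order.
  have hts : ts.Perm ts' := by
    have h := hr.labs_eq.trans hr'.labs_eq.symm
    rw [add_left_inj, labs_cat, labs_cat, hs.labs_eq, add_right_inj, ht.labs_eq, ht'.labs_eq,
      add_right_inj] at h
    exact Multiset.coe_eq_coe.1 (Multiset.map_injective (fun v w => kt_inj.1) h)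
  obtain ⟨u, hu, rfl⟩ := ht.perm hts ht'
  have hrun := hr.str (.refl _) ((hs.wh r).trans (hu.pre _))
  have e := hrun.unique hr' hn (Multiset.nodup_of_le hi hn)
  rw [Category.id_comp, Category.assoc, ← Category.assoc (pre t _), ← wh_pre, Category.assoc,
    ← pre_comp, ← Category.assoc, ← wh_comp] at e
  -- The inserted tokens, and after them the token of the root, have unit objects and can be
  -- cancelled.
  have : IsIso (t ≫ u) := ht'.isIso
  have := isIso_pre (t ≫ u) L₂
  rw [cancel_mono] at e
  let a : S.sig.ctx [S.tk x] ≅ 𝟙_ C := λ_ (𝟙_ C)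
  have e' := Tokens.wh_cancel a e
  rw [Category.assoc] at e'
  have e'' := (cancel_epi _).1 e'
  subst hf hf'
  exact (Category.assoc _ _ _).symm.trans e''

/-- The interpretation of a term in context does not depend on its derivation. -/
theorem coherence {x : Var G} {κ : Cx G} {Γ : List (Ty G)} (d d' : Deriv x κ Γ) :
    S.interp d = S.interp d' := by
  obtain ⟨L, i, -, -, hl, -⟩ := S.simulates d .var
  have e := interp_comp_eq d d' hl hl (.refl _) fun e => Iff.rfl
  have := hl.isIso
  rw [Category.comp_id] at e
  exact (cancel_mono i).1 e

/-- Links record no events, so the two contexts have the same ones. The final states differ by the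
deletion of one trivial wire and the insertion of another, and the composite of these is an identity
morphism. -/
theorem coherence_link {x : Var G} {κ : Cx G} {R R' : Tm G} {Γ : List (Ty G)}
    (d : Deriv x (κ.snoc (.connect R)) (.bot :: Γ))
    (d' : Deriv x (κ.snoc (.connect R')) (.bot :: Γ)) : S.interp d = S.interp d' := by
  obtain ⟨L, i, -, -, hl, -⟩ := S.simulates d .var
  cases hl with | cons _ _ hl =>
  rename_i L i
  have hs := (Str.del L (S.wl (Tm.wr .var (.connect R)) .bot) ⟨trivial, trivial⟩).trans
    (Str.ins L (S.wl (Tm.wr .var (.connect R')) .bot) ⟨trivial, trivial⟩)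
  have e := interp_comp_eq d d' (.cons _ _ hl) (.cons _ _ hl) hs fun e => by
    rw [mem_cev_snoc, mem_cev_snoc]; exact Iff.rfl
  have h : (S.sig.ctx L ◁ 𝟙 (𝟙_ C) ≫ (ρ_ _).hom) ≫ (ρ_ _).inv ≫ S.sig.ctx L ◁ 𝟙 (𝟙_ C) = 𝟙 _ := by
    simp
  have e' : (S.interp d ≫ i ▷ S.ty .bot) ≫ 𝟙 _ = S.interp d' ≫ i ▷ S.ty .bot := by
    refine Eq.trans ?_ e
    refine (Category.assoc _ _ _).trans ?_
    exact congrArg (fun g => S.interp d ≫ i ▷ S.ty .bot ≫ g) h.symm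
  rw [Category.comp_id] at e'
  have := hl.isIso
  exact (cancel_mono (i ▷ S.ty .bot)).1 e'

end Structure
end CoILL

namespace CoILL

universe u

set_option linter.unusedSectionVars false

/-! ### Soundness of the `β` and `η` equations -/

variable {G : Type u} {C : Type*} [Category C] [MonoidalCategory C] [SymmetricCategory C]
  [LeftClosed C]

open Classical

theorem Tm.finite_names (t : Tm G) : t.names.Finite := by
  induction t <;> simp only [Tm.names, Set.finite_union, Set.finite_singleton, true_and] <;> tauto

theorem Cx.finite_names (κ : Cx G) : κ.names.Finite := by
  have h : κ.names = (⋃ t ∈ {t | t ∈ κ.ctrl}, t.names) ∪ ⋃ t ∈ {t | t ∈ κ.terms}, t.names := by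
    ext v
    simp only [Cx.names, Cx.Has, Set.mem_ofPred_eq, Set.mem_union, Set.mem_iUnion, or_and_right,
      exists_or, exists_prop]
  rw [h]
  refine (Set.Finite.biUnion ?_ fun t _ => t.finite_names).union
    (Set.Finite.biUnion ?_ fun t _ => t.finite_names)
  · exact κ.ctrl.toFinset.finite_toSet.subset fun t ht => by simpa using ht
  · exact κ.terms.toFinset.finite_toSet.subset fun t ht => by simpa using ht

/-- There are infinitely many variables of each type. -/
theorem exists_fresh {s : Set (Var G)} (hs : s.Finite) (A : Ty G) : ∃ n, (⟨n, A⟩ : Var G) ∉ s := by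
  by_contra! h
  refine Set.infinite_of_injective_forall_mem (f := fun n => (⟨n, A⟩ : Var G)) ?_ h hs
  intro n m e
  exact congrArg Var.id e

theorem Tm.names_subst_subset (x : Var G) (M t : Tm G) :
    (Tm.subst x M t).names ⊆ t.names ∪ M.names := by
  induction t with
  | var y =>
    by_cases h : y = x
    · rw [Tm.subst, if_pos h]; exact Set.subset_union_right
    · rw [Tm.subst, if_neg h]; exact Set.subset_union_left
  | postp₂ y N L ih ih' =>
    have : (if y = x then N else Tm.subst x M N).names ⊆ N.names ∪ M.names := by
      by_cases h : y = x
      · rw [if_pos h]; exact Set.subset_union_left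
      · rw [if_neg h]; exact ih
    simp only [Tm.subst, Tm.names]
    grind
  | _ => simp only [Tm.subst, Tm.names]; grind

theorem Cx.names_subst_subset (x : Var G) (M : Tm G) (κ : Cx G) :
    (κ.subst x M).names ⊆ κ.names ∪ M.names := by
  rintro v ⟨t, ht, hv⟩
  obtain ⟨t, ht', rfl⟩ := Cx.has_subst.1 ht
  exact (Tm.names_subst_subset x M t hv).imp (fun h => ⟨t, ht', h⟩) id

theorem Apart.mono {x y : Var G} {κ κ' ζ ζ' : Cx G} (h : Apart x κ y ζ) (hκ : κ'.names ⊆ κ.names)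
    (hζ : ζ'.names ⊆ ζ.names) : Apart x κ' y ζ' :=
  Disjoint.mono (Set.union_subset_union_right _ hκ) (Set.union_subset_union_right _ hζ) h

theorem Apart.left_mono {x y : Var G} {κ κ' ζ : Cx G} (h : Apart x κ y ζ)
    (hκ : κ'.names ⊆ κ.names) : Apart x κ' y ζ := h.mono hκ subset_rfl

/-- Entries apart from both of two terms in context are apart from their composite. -/
theorem Apart.union {x y w : Var G} {κ ζ κ' ξ : Cx G} (h : Apart x κ w ξ) (h' : Apart y ζ w ξ)
    (hκ : κ'.names ⊆ κ.names ∪ ({y} ∪ ζ.names)) : Apart x κ' w ξ := by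
  refine Set.disjoint_left.2 fun v hv => ?_
  rcases hv with hv | hv
  · exact Set.disjoint_left.1 h (.inl hv)
  · rcases hκ hv with hv | hv
    · exact Set.disjoint_left.1 h (.inr hv)
    · exact Set.disjoint_left.1 h' hv

namespace Structure

variable (S : Structure G C)

/-- The morphism `f` interprets a derivation of the term in context `x ▷ κ : Γ`. -/
def Derives (x : Var G) (κ : Cx G) (Γ : List (Ty G)) (f : S.ty x.ty ⟶ S.ctx Γ) : Prop :=
  ∃ d : Deriv x κ Γ, S.interp d = f

/-- Sequences of exchanges, with their interpretation. -/
inductive Exch : List (Tm G) → ∀ Γ : List (Ty G), List (Tm G) → ∀ Γ' : List (Ty G),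
    (S.ctx Γ ⟶ S.ctx Γ') → Prop
  | refl (l Γ) : Exch l Γ l Γ (𝟙 _)
  | step (n) {l Γ l' Γ' f} : Exch l Γ l' Γ' f →
      Exch l Γ (swapAt n l') (swapAt n Γ') (f ≫ S.swapHom n Γ')

variable {S}

theorem Exch.trans {l Γ l' Γ' l'' Γ'' f g} (h : S.Exch l Γ l' Γ' f) (h' : S.Exch l' Γ' l'' Γ'' g) :
    S.Exch l Γ l'' Γ'' (f ≫ g) := by
  induction h' with
  | refl => rw [Category.comp_id]; exact h
  | step n _ ih => rw [← Category.assoc]; exact .step n (ih h)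

theorem Exch.cons {l Γ l' Γ' f} (h : S.Exch l Γ l' Γ' f) (M : Tm G) (A : Ty G) :
    S.Exch (M :: l) (A :: Γ) (M :: l') (A :: Γ') (f ▷ S.ty A) := by
  induction h with
  | refl => rw [id_whiskerRight]; exact .refl _ _
  | step n _ ih => rw [comp_whiskerRight]; exact .step (n + 1) ih

theorem Derives.exch {x : Var G} {c l l' Γ Γ' f g} (h : S.Derives x ⟨c, l⟩ Γ f)
    (h' : S.Exch l Γ l' Γ' g) : S.Derives x ⟨c, l'⟩ Γ' (f ≫ g) := by
  induction h' with
  | refl => rw [Category.comp_id]; exact h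
  | step n _ ih =>
    obtain ⟨d, hd⟩ := ih h
    exact ⟨d.exch n, (congrArg (· ≫ S.swapHom n _) hd).trans (Category.assoc _ _ _)⟩

variable (S) in
/-- Exchange of one entry with a sequence. -/
def bring (A : Ty G) (Γ : List (Ty G)) :
    ∀ Δ : List (Ty G), S.ctx (Δ ++ A :: Γ) ⟶ S.ctx (A :: (Δ ++ Γ))
  | [] => 𝟙 _
  | B :: Δ => bring A Γ Δ ▷ S.ty B ≫ sw (S.ctx (Δ ++ Γ)) (S.ty A) (S.ty B)

theorem exch_bring (M : Tm G) (A : Ty G) (k : List (Tm G)) (Γ : List (Ty G)) :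
    ∀ {l : List (Tm G)} {Δ : List (Ty G)}, l.length = Δ.length →
      S.Exch (l ++ M :: k) (Δ ++ A :: Γ) (M :: (l ++ k)) (A :: (Δ ++ Γ)) (S.bring A Γ Δ)
  | [], [], _ => .refl _ _
  | _ :: _, _ :: _, h => .step 0 ((exch_bring M A k Γ (Nat.succ.inj h)).cons _ _)

variable (S) in
/-- Exchange of two sequences. -/
def block (Γ Δ : List (Ty G)) :
    ∀ Λ : List (Ty G), S.ctx (Δ ++ (Λ ++ Γ)) ⟶ S.ctx (Λ ++ (Δ ++ Γ))
  | [] => 𝟙 _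
  | A :: Λ => S.bring A (Λ ++ Γ) Δ ≫ block Γ Δ Λ ▷ S.ty A

theorem exch_block {l : List (Tm G)} {Δ : List (Ty G)} (hl : l.length = Δ.length)
    (k : List (Tm G)) (Γ : List (Ty G)) :
    ∀ {l' : List (Tm G)} {Λ : List (Ty G)}, l'.length = Λ.length →
      S.Exch (l ++ (l' ++ k)) (Δ ++ (Λ ++ Γ)) (l' ++ (l ++ k)) (Λ ++ (Δ ++ Γ)) (S.block Γ Δ Λ)
  | [], [], _ => .refl _ _
  | _ :: _, _ :: _, h =>
    (exch_bring _ _ _ _ hl).trans ((exch_block hl k Γ (Nat.succ.inj h)).cons _ _)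

theorem sw_unit (X B : C) : sw X B (𝟙_ C) ≫ (ρ_ X).hom ▷ B = (ρ_ (X ⊗ B)).hom := by
  simp only [sw, braiding_tensorUnit_right]
  monoidal

theorem sw_unit' (X D : C) : sw X (𝟙_ C) D ≫ (ρ_ (X ⊗ D)).hom = (ρ_ X).hom ▷ D := by
  simp only [sw, braiding_tensorUnit_left]
  monoidal

theorem sw_whiskerRight {X X' : C} (f : X ⟶ X') (A B : C) :
    f ▷ A ▷ B ≫ sw X' A B = sw X A B ≫ f ▷ B ▷ A := by
  simpa using sw_naturality f (𝟙 A) (𝟙 B)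

theorem join_bring_aux {X B D A T R : C} (j : (X ⊗ B) ⊗ D ⟶ T) (b : T ⟶ R ⊗ B)
    (k : X ⊗ D ⟶ R) (h : j ≫ b = sw X B D ≫ k ▷ B) :
    ((α_ (X ⊗ B) D A).inv ≫ j ▷ A) ≫ b ▷ A ≫ sw R B A =
      sw X B (D ⊗ A) ≫ ((α_ X D A).inv ≫ k ▷ A) ▷ B := by
  rw [Category.assoc, ← comp_whiskerRight_assoc, h, comp_whiskerRight, Category.assoc,
    sw_whiskerRight, comp_whiskerRight, ← Category.assoc (sw X B (D ⊗ A)), ← sw_tensor]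
  simp only [Category.assoc]

theorem join_bring (A : Ty G) (Γ : List (Ty G)) : ∀ Δ : List (Ty G),
    S.join (A :: Γ) Δ ≫ S.bring A Γ Δ =
      sw (S.ctx Γ) (S.ty A) (S.ctx Δ) ≫ S.join Γ Δ ▷ S.ty A
  | [] => (Category.comp_id _).trans (sw_unit _ _).symm
  | _ :: Δ => join_bring_aux _ _ _ (join_bring A Γ Δ)

theorem sw_tensor' (X A B D : C) :
    (α_ X A B).inv ▷ D ≫ sw (X ⊗ A) B D ≫ sw X A D ▷ B = sw X (A ⊗ B) D ≫ (α_ (X ⊗ D) A B).inv := by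
  have : IsIso (sw X D (A ⊗ B)) := ⟨sw X (A ⊗ B) D, sw_sw _ _ _, sw_sw _ _ _⟩
  rw [← cancel_epi (sw X D (A ⊗ B)), sw_sw_assoc, ← reassoc_of% sw_tensor]
  simp [← comp_whiskerRight]

theorem join_block_aux {X L A D T U V R P : C} (j : X ⊗ L ⟶ T) (j₁ : (T ⊗ A) ⊗ D ⟶ U)
    (b : U ⟶ V ⊗ A) (k : V ⟶ R) (j₂ : T ⊗ D ⟶ V) (h₁ : j₁ ≫ b = sw T A D ≫ j₂ ▷ A)
    (p : X ⊗ D ⟶ P) (q : P ⊗ L ⟶ R)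
    (h₂ : j ▷ D ≫ j₂ ≫ k = sw X L D ≫ p ▷ L ≫ q) :
    ((α_ X L A).inv ≫ j ▷ A) ▷ D ≫ j₁ ≫ b ≫ k ▷ A =
      sw X (L ⊗ A) D ≫ p ▷ (L ⊗ A) ≫ (α_ P L A).inv ≫ q ▷ A := by
  rw [reassoc_of% h₁, comp_whiskerRight, Category.assoc, ← Category.assoc (j ▷ A ▷ D),
    sw_whiskerRight, Category.assoc, ← comp_whiskerRight, ← comp_whiskerRight, h₂,
    comp_whiskerRight, reassoc_of% sw_tensor', comp_whiskerRight]
  simp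

/-- Induction on `Λ`: its last entry is moved past `Δ` by `join_bring`, the others by the induction
hypothesis. -/
theorem join_block (Γ Δ : List (Ty G)) : ∀ Λ : List (Ty G),
    S.join Γ Λ ▷ S.ctx Δ ≫ S.join (Λ ++ Γ) Δ ≫ S.block Γ Δ Λ =
      sw (S.ctx Γ) (S.ctx Λ) (S.ctx Δ) ≫ S.join Γ Δ ▷ S.ctx Λ ≫ S.join (Δ ++ Γ) Λ
  | [] => by
    have e : ∀ {X D T : C} (k : X ⊗ D ⟶ T), (ρ_ X).hom ▷ D ≫ k ≫ 𝟙 T =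
        sw X (𝟙_ C) D ≫ k ▷ 𝟙_ C ≫ (ρ_ T).hom := by
      intro X D T k
      rw [rightUnitor_naturality, ← Category.assoc (sw _ _ _), sw_unit', Category.comp_id]
    exact e _
  | A :: Λ => join_block_aux _ _ _ _ _ (join_bring A (Λ ++ Γ) Δ) _ _ (join_block Γ Δ Λ)

/-- The first triangle identity, for `∖`. -/
theorem mkcHom_postpHom {A B X : C} (f : A ⟶ X ⊗ B) :
    mkcHom A B ≫ B ◁ postpHom f = f ≫ (β_ X B).hom := by
  have := ((LeftClosed.adj B).homEquiv A X).apply_symm_apply (f ≫ (β_ X B).hom)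
  rwa [Adjunction.homEquiv_unit] at this

/-- The second triangle identity, for `∖`. -/
theorem postpHom_mkcHom (A B : C) :
    postpHom (mkcHom A B ≫ (β_ B _).hom) = 𝟙 ((LeftClosed.coexp B).obj A) := by
  rw [postpHom, Category.assoc, SymmetricCategory.symmetry, Category.comp_id]
  exact (Equiv.symm_apply_eq _).2 (Adjunction.homEquiv_id _ _).symm

end Structure
end CoILL

-- Derivations of the two sides of the β and η equations

namespace CoILL

universe u

set_option linter.unusedSectionVars false

variable {G : Type u} {C : Type*} [Category C] [MonoidalCategory C] [SymmetricCategory C]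
  [LeftClosed C]

open Classical

theorem Deriv.length_eq {x : Var G} {κ : Cx G} {Γ : List (Ty G)} (d : Deriv x κ Γ) :
    κ.terms.length = Γ.length := by
  simpa using congrArg List.length (d.types_eq (ρ := .var) rfl)

theorem Deriv.length_subst {x : Var G} {κ : Cx G} {Γ : List (Ty G)} (d : Deriv x κ Γ) (y : Var G)
    (M : Tm G) : (κ.subst y M).terms.length = Γ.length := by
  rw [← d.length_eq]; simp [Cx.subst]

namespace Structure

variable {S : Structure G C}

theorem Derives.cut {z x : Var G} {κ ζ : Cx G} {M : Tm G} {Γ Δ : List (Ty G)}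
    {f : S.ty z.ty ⟶ S.ctx Γ ⊗ S.ty x.ty} {g : S.ty x.ty ⟶ S.ctx Δ}
    (h : S.Derives z (κ.snoc M) (x.ty :: Γ) f) (h' : S.Derives x ζ Δ g)
    (ha : Apart z (κ.snoc M) x ζ) :
    S.Derives z (κ.append (ζ.subst x M)) (Δ ++ Γ) (f ≫ S.ctx Γ ◁ g ≫ S.join Γ Δ) := by
  obtain ⟨d, rfl⟩ := h
  obtain ⟨e, rfl⟩ := h'
  exact ⟨d.cut e ha, rfl⟩

theorem Derives.of_eq {x : Var G} {κ κ' : Cx G} {Γ : List (Ty G)} {f g : S.ty x.ty ⟶ S.ctx Γ}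
    (h : S.Derives x κ Γ f) (hκ : κ = κ') (hf : f = g) : S.Derives x κ' Γ g := by
  subst hκ hf; exact h

variable (S) in
/-- Both sides of an equation are derivable, with the same interpretation. -/
def Sound (x : Var G) (κ κ' : Cx G) (Γ : List (Ty G)) : Prop :=
  ∃ f, S.Derives x κ Γ f ∧ S.Derives x κ' Γ f

theorem union_names_ax (x : Var G) : {x} ∪ (⟨0, [.var x]⟩ : Cx G).names = {x} := by
  ext v
  simp [Cx.names, Cx.Has, Tm.names]

theorem apart_ax {x z : Var G} {κ : Cx G} (h : x ∉ {z} ∪ κ.names) :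
    Apart z κ x ⟨0, [.var x]⟩ := by
  rw [Apart, union_names_ax]
  exact Set.disjoint_singleton_right.2 h

theorem par_beta_aux {P X A B U V Q R T : C} (d : P ⟶ (X ⊗ A) ⊗ B) (e : A ⟶ U) (f : B ⟶ V)
    (j : X ⊗ U ⟶ R) (k : R ⊗ V ⟶ T) (j' : (X ⊗ B) ⊗ U ⟶ Q) (b : Q ⟶ R ⊗ B)
    (h : j' ≫ b = sw X B U ≫ j ▷ B) :
    (((d ≫ sw X A B) ≫ (X ⊗ B) ◁ e ≫ j') ≫ b) ≫ R ◁ f ≫ k =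
      (d ≫ (α_ X A B).hom) ≫ X ◁ (e ⊗ₘ f) ≫ (α_ X U V).inv ≫ j ▷ V ≫ k := by
  have n : (X ⊗ B) ◁ e ≫ sw X B U = sw X B A ≫ (X ◁ e) ▷ B := by
    simpa using sw_naturality (𝟙 X) (𝟙 B) e
  simp only [Category.assoc]
  rw [reassoc_of% h, reassoc_of% n, sw_sw_assoc, ← whisker_exchange_assoc]
  simp [MonoidalCategory.tensorHom_def]

/-- The right side is derived by two cuts, of `M₀` into `ζ` and of `M₁` into `ξ`, with exchanges
that bring the term to be cut to the end of the sequence. -/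
theorem sound_par_beta {z x y : Var G} {κ ζ ξ : Cx G} {M₀ M₁ : Tm G} {Θ Γ Δ : List (Ty G)}
    (d : Deriv z ((κ.snoc M₀).snoc M₁) (y.ty :: x.ty :: Θ)) (e : Deriv x ζ Γ) (f : Deriv y ξ Δ)
    (h₁ : Apart z ((κ.snoc M₀).snoc M₁) x ζ) (h₂ : Apart z ((κ.snoc M₀).snoc M₁) y ξ)
    (h₃ : Apart x ζ y ξ) :
    S.Sound z
      ((κ.append (ζ.subst x (.casel (.par M₀ M₁)))).append (ξ.subst y (.caser (.par M₀ M₁))))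
      ((κ.append (ζ.subst x M₀)).append (ξ.subst y M₁)) (Δ ++ (Γ ++ Θ)) := by
  have hn : (κ.snoc (.par M₀ M₁)).names ⊆ ((κ.snoc M₀).snoc M₁).names := by
    simp only [Cx.names_snoc, Tm.names]; grind
  refine ⟨_, ⟨d.parI.parE e f (h₁.left_mono hn) (h₂.left_mono hn) h₃, rfl⟩, ?_⟩
  have i₁ : S.Derives z ((κ.snoc M₁).snoc M₀) (x.ty :: y.ty :: Θ)
      (S.interp d ≫ sw (S.ctx Θ) (S.ty x.ty) (S.ty y.ty)) := ⟨d.exch 0, rfl⟩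
  have i₂ := i₁.cut ⟨e, rfl⟩ (h₁.left_mono (by simp only [Cx.names_snoc]; grind))
  have i₃ : S.Derives z ((κ.append (ζ.subst x M₀)).snoc M₁) (y.ty :: (Γ ++ Θ)) _ :=
    i₂.exch (exch_bring M₁ y.ty κ.terms Θ (e.length_subst x M₀))
  refine (i₃.cut ⟨f, rfl⟩ (h₂.union h₃ ?_)).of_eq rfl ?_
  · have := Cx.names_subst_subset x M₀ ζ
    simp only [Cx.names_snoc, Cx.names_append]
    grind
  · exact par_beta_aux _ _ _ _ _ _ _ (join_bring y.ty Θ Γ)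

theorem par_eta_aux {P X A B : C} (d : P ⟶ X ⊗ (A ⊗ B)) :
    (d ≫ X ◁ ((λ_ A).inv ⊗ₘ (λ_ B).inv) ≫ (α_ X (𝟙_ C ⊗ A) (𝟙_ C ⊗ B)).inv ≫
      ((α_ X (𝟙_ C) A).inv ≫ (ρ_ X).hom ▷ A) ▷ (𝟙_ C ⊗ B) ≫
        ((α_ (X ⊗ A) (𝟙_ C) B).inv ≫ (ρ_ (X ⊗ A)).hom ▷ B)) ≫ (α_ X A B).hom = d := by
  simp only [Category.assoc]
  refine (congrArg (d ≫ ·) ?_).trans (Category.comp_id d)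
  monoidal

theorem interp_parE_ax {z x y : Var G} {κ : Cx G} {N : Tm G} {Υ : List (Ty G)}
    (d : Deriv z (κ.snoc N) (.par x.ty y.ty :: Υ)) (h₁ h₂ h₃) :
    S.interp (d.parE (.ax x) (.ax y) h₁ h₂ h₃) ≫ (α_ (S.ctx Υ) (S.ty x.ty) (S.ty y.ty)).hom =
      S.interp d := by
  have e : S.interp (d.parE (.ax x) (.ax y) h₁ h₂ h₃) =
      S.interp d ≫ (S.ctx Υ ◁ ((λ_ (S.ty x.ty)).inv ⊗ₘ (λ_ (S.ty y.ty)).inv)) ≫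
        (α_ (S.ctx Υ) (S.ctx [x.ty]) (S.ctx [y.ty])).inv ≫
        (S.join Υ [x.ty] ▷ S.ctx [y.ty]) ≫ S.join ([x.ty] ++ Υ) [y.ty] := rfl
  exact (congrArg (· ≫ (α_ (S.ctx Υ) (S.ty x.ty) (S.ty y.ty)).hom) e).trans
    (par_eta_aux (X := S.ctx Υ) (A := S.ty x.ty) (B := S.ty y.ty) (S.interp d))

/-- `⅋`-elimination against axioms for two fresh variables yields `casel(M)` and `caser(M)`; joining
them again undoes the reassociation. -/
theorem sound_par_eta {z : Var G} {κ : Cx G} {M : Tm G} {A B : Ty G} {Υ : List (Ty G)}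
    (d : Deriv z (κ.snoc M) (.par A B :: Υ)) :
    S.Sound z (κ.snoc (.par (.casel M) (.caser M))) (κ.snoc M) (.par A B :: Υ) := by
  have hfin : ({z} ∪ (κ.snoc M).names).Finite := (Set.finite_singleton z).union (Cx.finite_names _)
  obtain ⟨n, hx⟩ := exists_fresh hfin A
  obtain ⟨m, hy⟩ := exists_fresh (hfin.union (Set.finite_singleton ⟨n, A⟩)) B
  have i : S.Derives z ((κ.snoc (.casel M)).snoc (.caser M)) (B :: A :: Υ) _ :=
    Derives.of_eq ⟨Deriv.parE (x := ⟨n, A⟩) (y := ⟨m, B⟩) d (.ax _) (.ax _)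
      (apart_ax fun h => hx h) (apart_ax fun h => hy (.inl h)) (apart_ax fun h => hy (.inr ?_)),
        rfl⟩ ?_ rfl
  · obtain ⟨e, he⟩ := i
    refine ⟨S.interp d, ⟨e.parI, ?_⟩, d, rfl⟩
    exact (congrArg (· ≫ (α_ (S.ctx Υ) (S.ty A) (S.ty B)).hom) he).trans
      (interp_parE_ax (x := ⟨n, A⟩) (y := ⟨m, B⟩) d _ _ _)
  · rwa [union_names_ax] at h
  · ext1 <;> simp [Cx.append, Cx.subst, Cx.snoc, Tm.subst]

/-- By `mkcHom_postpHom` the unit followed by the transpose of `f` is `f` followed by the symmetry;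
this symmetry matches the exchange of blocks `b` on the side of the cuts. -/
theorem sub_beta_aux {P X A B U L Q R T V : C} (d : P ⟶ X ⊗ A) (e : B ⟶ U) (f : A ⟶ L ⊗ B)
    (j : X ⊗ L ⟶ Q) (k : Q ⊗ U ⟶ V) (b : V ⟶ T) (p : X ⊗ U ⟶ R) (q : R ⊗ L ⟶ T)
    (h : j ▷ U ≫ k ≫ b = sw X L U ≫ p ▷ L ≫ q) :
    ((d ≫ X ◁ f ≫ (α_ X L B).inv ≫ j ▷ B) ≫ Q ◁ e ≫ k) ≫ b =
      (d ≫ X ◁ mkcHom A B ≫ X ◁ (e ▷ _) ≫ (α_ X U _).inv ≫ p ▷ _) ≫ R ◁ postpHom f ≫ q := by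
  simp only [Category.assoc]
  rw [← whisker_exchange_assoc, h, ← whisker_exchange_assoc]
  have t : mkcHom A B ≫ e ▷ _ ≫ U ◁ postpHom f = f ≫ L ◁ e ≫ (β_ L U).hom := by
    rw [← whisker_exchange, reassoc_of% mkcHom_postpHom]
    simp
  have t' := congrArg (X ◁ ·) t
  simp only [MonoidalCategory.whiskerLeft_comp] at t'
  rw [← MonoidalCategory.associator_inv_naturality_right_assoc,
    ← MonoidalCategory.associator_inv_naturality_right_assoc, reassoc_of% t', sw]
  simp

/-- The right side is derived by cutting `M` into `ξ, L` and then `L[z := M]` into `ζ`. This puts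
the block of `ξ` before that of `ζ`, so the two blocks have to be exchanged. -/
theorem sound_sub_beta {x y z : Var G} {κ ζ ξ : Cx G} {M L : Tm G} {Γ Δ Λ : List (Ty G)}
    (d : Deriv x (κ.snoc M) (z.ty :: Γ)) (e : Deriv y ζ Δ) (f : Deriv z (ξ.snoc L) (y.ty :: Λ))
    (h₁ : Apart x (κ.snoc M) y ζ) (h₂ : Apart x (κ.snoc M) z (ξ.snoc L))
    (h₃ : Apart y ζ z (ξ.snoc L)) :
    S.Sound x
      (((κ.append (ζ.subst y (.app y M))).append
        (ξ.subst z (.app z (.mkc M y)))).addP (.postp₂ z L (.mkc M y)))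
      ((κ.append (ζ.subst y (Tm.subst z M L))).append (ξ.subst z M)) (Λ ++ (Δ ++ Γ)) := by
  have ha : Apart x ((κ.append (ζ.subst y (.app y M))).snoc (.mkc M y)) z (ξ.snoc L) := by
    refine h₂.union h₃ ?_
    have := Cx.names_subst_subset y (.app y M) ζ
    simp only [Cx.names_snoc, Cx.names_append, Tm.names] at this ⊢
    grind
  refine ⟨_, ⟨(d.subI e h₁).subE f ha, rfl⟩, ?_⟩
  have i₁ : S.Derives x ((κ.append (ξ.subst z M)).snoc (Tm.subst z M L)) (y.ty :: (Λ ++ Γ)) _ :=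
    ⟨d.cut f h₂, rfl⟩
  have i₂ := i₁.cut ⟨e, rfl⟩ (by
    refine h₁.union h₃.symm ?_
    have := Cx.names_subst_subset z M ξ
    have := Tm.names_subst_subset z M L
    simp only [Cx.names_snoc, Cx.names_append] at *
    grind)
  refine (i₂.exch (exch_block (e.length_subst y _) κ.terms Γ (l' := (ξ.subst z M).terms) ?_)).of_eq
    ?_ ?_
  · have := f.length_subst z M
    simpa [Cx.subst, Cx.snoc] using this
  · ext1
    · simp only [Cx.append]; abel
    · rfl
  · exact sub_beta_aux _ _ _ _ _ _ _ _ (join_block Γ Δ Λ)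

/-- Up to unitors, the content of the box is the unit of the adjunction followed by the symmetry,
and the transpose of that is the identity by `postpHom_mkcHom`. -/
theorem sub_eta_aux {P X A B : C} (d : P ⟶ X ⊗ (LeftClosed.coexp B).obj A) :
    d ≫ X ◁ postpHom ((((λ_ A).inv ≫ 𝟙_ C ◁ mkcHom A B ≫ 𝟙_ C ◁ ((λ_ B).inv ▷ _) ≫
      (α_ (𝟙_ C) (𝟙_ C ⊗ B) _).inv ≫ ((α_ (𝟙_ C) (𝟙_ C) B).inv ≫ (ρ_ (𝟙_ C)).hom ▷ B) ▷ _)) ≫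
        sw (𝟙_ C) B _) ≫ (α_ X (𝟙_ C) _).inv ≫ (ρ_ X).hom ▷ _ = d := by
  have e : ((((λ_ A).inv ≫ 𝟙_ C ◁ mkcHom A B ≫ 𝟙_ C ◁ ((λ_ B).inv ▷ _) ≫
      (α_ (𝟙_ C) (𝟙_ C ⊗ B) _).inv ≫ ((α_ (𝟙_ C) (𝟙_ C) B).inv ≫ (ρ_ (𝟙_ C)).hom ▷ B) ▷ _)) ≫
        sw (𝟙_ C) B _) = (mkcHom A B ≫ (β_ B _).hom) ≫
          (λ_ ((LeftClosed.coexp B).obj A)).inv ▷ B := by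
    have n : (λ_ (B ⊗ (LeftClosed.coexp B).obj A)).inv ≫ 𝟙_ C ◁ ((λ_ B).inv ▷ _) ≫
        (α_ (𝟙_ C) (𝟙_ C ⊗ B) _).inv ≫
        ((α_ (𝟙_ C) (𝟙_ C) B).inv ≫ (ρ_ (𝟙_ C)).hom ▷ B) ▷ _ ≫ (α_ (𝟙_ C) B _).hom =
        (λ_ _).inv := by monoidal
    rw [sw]
    simp only [Category.assoc]
    rw [← leftUnitor_inv_naturality_assoc, reassoc_of% n, ← leftUnitor_inv_naturality_assoc]
    simp
  rw [e, ← postpHom_comp, postpHom_mkcHom, Category.id_comp]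
  refine (congrArg (d ≫ ·) ?_).trans (Category.comp_id d)
  monoidal

theorem interp_subI_ax {x y : Var G} (h : Apart x ((⟨0, []⟩ : Cx G).snoc (.var x)) y ⟨0, [.var y]⟩) :
    S.interp (Deriv.subI (κ := ⟨0, []⟩) (.ax x) (.ax y) h) =
      ((λ_ (S.ty x.ty)).inv ≫ 𝟙_ C ◁ mkcHom (S.ty x.ty) (S.ty y.ty) ≫
        𝟙_ C ◁ ((λ_ (S.ty y.ty)).inv ▷ (LeftClosed.coexp (S.ty y.ty)).obj (S.ty x.ty)) ≫
      (α_ (𝟙_ C) (𝟙_ C ⊗ S.ty y.ty) _).inv ≫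
        ((α_ (𝟙_ C) (𝟙_ C) (S.ty y.ty)).inv ≫ (ρ_ (𝟙_ C)).hom ▷ S.ty y.ty) ▷ _) := rfl

theorem interp_subE_exch {z x : Var G} {κ ξ : Cx G} {M N L : Tm G} {A B : Ty G} {Δ : List (Ty G)}
    (d : Deriv z (κ.snoc M) (.sub x.ty B :: Δ)) (e : Deriv x ((ξ.snoc N).snoc L) [A, B]) (h) :
    S.interp (d.subE (ξ := ξ.snoc L) (N := N) (Δ := [A]) (e.exch 0) h) = S.interp d ≫
      S.ctx Δ ◁ postpHom (S.interp e ≫ sw (𝟙_ C) (S.ty B) (S.ty A)) ≫ S.join Δ [A] := rfl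

/-- The left side arises from `∖`-introduction on the axioms for `x` and `y`, an exchange that makes
`y(x)` the last term, and `∖`-elimination against `M`. -/
theorem sound_sub_eta {z x y : Var G} {κ : Cx G} {M : Tm G} {Δ : List (Ty G)}
    (d : Deriv z (κ.snoc M) (.sub x.ty y.ty :: Δ)) (hxy : x ≠ y)
    (hx : x ∉ {z} ∪ (κ.snoc M).names) (hy : y ∉ {z} ∪ (κ.snoc M).names) :
    S.Sound z ((κ.snoc (.mkc (.app x M) y)).addP (.postp₂ x (.app y (.var x)) M)) (κ.snoc M)
      (.sub x.ty y.ty :: Δ) := by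
  have i₀ : S.Derives x ⟨0, [.mkc (.var x) y, .app y (.var x)]⟩ [.sub x.ty y.ty, y.ty] _ :=
    Derives.of_eq ⟨Deriv.subI (κ := ⟨0, []⟩) (.ax x) (.ax y) (apart_ax ?_), rfl⟩ ?_ rfl
  · obtain ⟨d₀, h₀⟩ := i₀
    have i₁ : S.Derives z ((κ.snoc (.mkc (.app x M) y)).addP (.postp₂ x (.app y (.var x)) M))
        (.sub x.ty y.ty :: Δ) _ :=
      Derives.of_eq ⟨Deriv.subE (ξ := ⟨0, [.mkc (.var x) y]⟩) (N := .app y (.var x)) d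
        (d₀.exch 0) ?_, rfl⟩
        ?_ rfl
    · refine ⟨S.interp d, i₁.of_eq rfl ?_, d, rfl⟩
      refine (interp_subE_exch (ξ := ⟨0, []⟩) d d₀ _).trans ?_
      exact (congrArg (fun g => S.interp d ≫ S.ctx Δ ◁ postpHom (g ≫ sw (𝟙_ C) (S.ty y.ty)
        (S.ty (.sub x.ty y.ty))) ≫ S.join Δ [.sub x.ty y.ty]) h₀).trans
          ((congrArg (fun g => S.interp d ≫ S.ctx Δ ◁ postpHom (g ≫ sw (𝟙_ C) (S.ty y.ty)
            (S.ty (.sub x.ty y.ty))) ≫ S.join Δ [.sub x.ty y.ty]) (interp_subI_ax _)).trans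
            (sub_eta_aux (X := S.ctx Δ) (A := S.ty x.ty) (B := S.ty y.ty) (S.interp d)))
    · have : {x} ∪ ((⟨0, [.mkc (.var x) y]⟩ : Cx G).snoc (.app y (.var x))).names = {x, y} := by
        ext v
        simp [Cx.names, Cx.Has, Cx.snoc, Tm.names]
      rw [Apart, this]
      refine Set.disjoint_right.2 fun v hv => ?_
      rcases hv with rfl | rfl
      · exact hx
      · exact hy
    · ext1 <;> simp [Cx.append, Cx.subst, Cx.snoc, Cx.addP, Tm.subst]
  · change y ∉ {x} ∪ (⟨0, [.var x]⟩ : Cx G).names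
    rw [union_names_ax]
    exact hxy.symm
  · ext1 <;> simp [Cx.append, Cx.subst, Cx.snoc, Tm.subst]

/-- As `R` need not belong to `ζ`, the given derivation need not end with `⊥`-introduction, and the
comparison rests on `coherence_link`. -/
theorem sound_rewire_late {y : Var G} {ζ : Cx G} {R R' : Tm G} {Γ : List (Ty G)}
    (d : Deriv y (ζ.snoc (.connect R)) (.bot :: Γ)) (d' : Deriv y ζ Γ) (h : ζ.Has R') :
    S.Sound y (ζ.snoc (.connect R)) (ζ.snoc (.connect R')) (.bot :: Γ) :=
  ⟨_, ⟨d, rfl⟩, d'.botI h, (coherence_link d (d'.botI h)).symm⟩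

/-- This is a cut against `⊥`-elimination at a fresh variable, the common ingredient of both
equations for `⊥`. -/
theorem exists_botE {z : Var G} {κ : Cx G} {M : Tm G} {Γ : List (Ty G)}
    {f : S.ty z.ty ⟶ S.ctx Γ ⊗ 𝟙_ C} (h : S.Derives z (κ.snoc M) (.bot :: Γ) f) :
    S.Derives z (κ.addP (.postp M)) Γ (f ≫ (ρ_ _).hom) := by
  have hfin : ({z} ∪ (κ.snoc M).names).Finite := (Set.finite_singleton z).union (Cx.finite_names _)
  obtain ⟨n, hx⟩ := exists_fresh hfin .bot
  have hn : {⟨n, .bot⟩} ∪ (⟨{.postp (.var ⟨n, .bot⟩)}, []⟩ : Cx G).names = {⟨n, .bot⟩} := by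
    ext v
    simp [Cx.names, Cx.Has, Tm.names]
  have ha : Apart z (κ.snoc M) ⟨n, .bot⟩ ⟨{.postp (.var ⟨n, .bot⟩)}, []⟩ := by
    rw [Apart, hn]
    exact Set.disjoint_singleton_right.2 hx
  refine (Derives.cut (x := ⟨n, .bot⟩) h ⟨.botE n, rfl⟩ ha).of_eq ?_ ?_
  · ext1
    · simp [Cx.append, Cx.subst, Cx.addP, Tm.subst, add_comm κ.ctrl]
    · rfl
  · have e : ∀ {P X : C} (f : P ⟶ X ⊗ 𝟙_ C), f ≫ X ◁ 𝟙 (𝟙_ C) ≫ (ρ_ X).hom = f ≫ (ρ_ X).hom := by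
      intro P X f; simp
    exact e f

theorem sound_bot_beta {x : Var G} {κ : Cx G} {R : Tm G} {Γ : List (Ty G)}
    (d : Deriv x κ Γ) (h : κ.Has R) : S.Sound x (κ.addP (.postp (.connect R))) κ Γ := by
  have i : S.Derives x (κ.snoc (.connect R)) (.bot :: Γ) (S.interp d ≫ (ρ_ (S.ctx Γ)).inv) :=
    ⟨d.botI h, rfl⟩
  refine ⟨S.interp d, (exists_botE i).of_eq rfl ?_, d, rfl⟩
  have e : ∀ {P X : C} (f : P ⟶ X), (f ≫ (ρ_ X).inv) ≫ (ρ_ X).hom = f := by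
    intro P X f; simp
  exact e _

theorem sound_bot_eta {z : Var G} {κ : Cx G} {M : Tm G} {Γ : List (Ty G)}
    (d : Deriv z (κ.snoc M) (.bot :: Γ)) :
    S.Sound z ((κ.snoc (.connect (.postp M))).addP (.postp M)) (κ.snoc M) (.bot :: Γ) := by
  obtain ⟨d', hd'⟩ := exists_botE (S := S) (f := S.interp d) ⟨d, rfl⟩
  refine ⟨S.interp d, ⟨d'.botI (Cx.has_addP.2 (.inl rfl)), ?_⟩, d, rfl⟩
  have e : ∀ {P X : C} (f : P ⟶ X ⊗ 𝟙_ C), (f ≫ (ρ_ X).hom) ≫ (ρ_ X).inv = f := by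
    intro P X f; simp
  exact (congrArg (· ≫ (ρ_ (S.ctx Γ)).inv) hd').trans (e _)

end Structure
end CoILL

namespace CoILL

universe u

set_option linter.unusedSectionVars false

/-! ### Renaming and soundness -/

variable {G : Type u} {C : Type*} [Category C] [MonoidalCategory C] [SymmetricCategory C]
  [LeftClosed C]

open Classical

theorem Var.rename_injective (π : Ty G → Equiv.Perm ℕ) : Function.Injective (Var.rename π) := by
  rintro ⟨n, A⟩ ⟨m, B⟩ h
  have h₂ : A = B := congrArg Var.ty h
  subst h₂
  have h₁ : π A n = π A m := congrArg Var.id h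
  rw [(π A).injective h₁]

theorem Tm.rename_subst (π : Ty G → Equiv.Perm ℕ) (x : Var G) (M t : Tm G) :
    (Tm.subst x M t).rename π = Tm.subst (x.rename π) (M.rename π) (t.rename π) := by
  have hi : ∀ y : Var G, y.rename π = x.rename π ↔ y = x :=
    fun y => (Var.rename_injective π).eq_iff
  induction t with
  | var y => by_cases h : y = x <;> simp [Tm.subst, Tm.rename, hi, h]
  | postp₂ y N L ih ih' => by_cases h : y = x <;> simp [Tm.subst, Tm.rename, hi, h, ih, ih']
  | _ => simp_all [Tm.subst, Tm.rename]

theorem Tm.names_rename (π : Ty G → Equiv.Perm ℕ) (t : Tm G) :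
    (t.rename π).names = Var.rename π '' t.names := by
  induction t <;> simp_all [Tm.rename, Tm.names, Set.image_union, Set.image_insert_eq]

namespace Cx

variable (π : Ty G → Equiv.Perm ℕ)

theorem has_rename {κ : Cx G} {t : Tm G} :
    (κ.rename π).Has t ↔ ∃ t', κ.Has t' ∧ t'.rename π = t := by
  simp only [Has, rename, Multiset.mem_map, List.mem_map, or_and_right, exists_or]

theorem names_rename (κ : Cx G) : (κ.rename π).names = Var.rename π '' κ.names := by
  ext v
  simp only [names, has_rename, Set.mem_image, Set.mem_ofPred_eq]
  constructor
  · rintro ⟨_, ⟨t, ht, rfl⟩, hv⟩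
    rw [Tm.names_rename] at hv
    obtain ⟨w, hw, rfl⟩ := hv
    exact ⟨w, ⟨t, ht, hw⟩, rfl⟩
  · rintro ⟨w, ⟨t, ht, hw⟩, rfl⟩
    refine ⟨_, ⟨t, ht, rfl⟩, ?_⟩
    rw [Tm.names_rename]
    exact ⟨w, hw, rfl⟩

theorem rename_append (κ ζ : Cx G) :
    (κ.append ζ).rename π = (κ.rename π).append (ζ.rename π) := by
  ext1 <;> simp [rename, append]

theorem rename_addP (κ : Cx G) (P : Tm G) :
    (κ.addP P).rename π = (κ.rename π).addP (P.rename π) := by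
  ext1 <;> simp [rename, addP]

theorem rename_subst (κ : Cx G) (x : Var G) (M : Tm G) :
    (κ.subst x M).rename π = (κ.rename π).subst (x.rename π) (M.rename π) := by
  ext1 <;> simp [rename, subst, Tm.rename_subst]

theorem rename_swapAt (κ : Cx G) (n : ℕ) :
    (κ.swapAt n).rename π = (κ.rename π).swapAt n := by
  ext1
  · rfl
  · exact map_swapAt _ _ _

end Cx

theorem Apart.rename {x y : Var G} {κ ζ : Cx G} (h : Apart x κ y ζ) (π : Ty G → Equiv.Perm ℕ) :
    Apart (x.rename π) (κ.rename π) (y.rename π) (ζ.rename π) := by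
  have := (Set.disjoint_image_iff (Var.rename_injective π)).2 h
  rwa [Set.image_union, Set.image_union, Set.image_singleton, Set.image_singleton,
    ← Cx.names_rename, ← Cx.names_rename] at this

namespace Structure

variable {S : Structure G C}

/-- Renaming does not change the interpretation. -/
theorem derives_rename (π : Ty G → Equiv.Perm ℕ) {x : Var G} {κ : Cx G} {Γ : List (Ty G)}
    (d : Deriv x κ Γ) : S.Derives (x.rename π) (κ.rename π) Γ (S.interp d : S.ty x.ty ⟶ S.ctx Γ) := by
  induction d with
  | ax x => exact ⟨.ax (x.rename π), rfl⟩
  | exch n d ih =>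
    obtain ⟨d', h⟩ := ih
    exact Derives.of_eq ⟨d'.exch n, rfl⟩ (Cx.rename_swapAt π _ n).symm
      (congrArg (· ≫ S.swapHom n _) h)
  | @cut z x κ ζ M Γ Δ d e ha ih ih' =>
    obtain ⟨d', h⟩ := ih
    obtain ⟨e', h'⟩ := ih'
    refine Derives.of_eq ⟨Deriv.cut (x := x.rename π) (κ := κ.rename π) (M := M.rename π) d' e'
      (ha.rename π), rfl⟩ ?_ ?_
    · rw [Cx.rename_append, Cx.rename_subst]
    · exact congrArg₂ (fun f g => f ≫ (S.ctx Γ ◁ g) ≫ S.join Γ Δ) h h'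
  | @parI x κ M₀ M₁ A B Θ d ih =>
    obtain ⟨d', h⟩ := ih
    exact ⟨Deriv.parI (κ := κ.rename π) (M₀ := M₀.rename π) (M₁ := M₁.rename π) d',
      congrArg (· ≫ (α_ (S.ctx Θ) (S.ty A) (S.ty B)).hom) h⟩
  | @parE z x y κ ζ ξ N Υ Γ Δ d e f h₁ h₂ h₃ ih ih' ih'' =>
    obtain ⟨d', h⟩ := ih
    obtain ⟨e', h'⟩ := ih'
    obtain ⟨f', h''⟩ := ih''
    refine Derives.of_eq ⟨Deriv.parE (x := x.rename π) (y := y.rename π) (κ := κ.rename π)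
      (N := N.rename π) d' e' f' (h₁.rename π) (h₂.rename π) (h₃.rename π), rfl⟩ ?_ ?_
    · rw [Cx.rename_append, Cx.rename_append, Cx.rename_subst, Cx.rename_subst]; rfl
    · exact congrArg₂ (fun f (g : (S.ty x.ty ⟶ S.ctx Γ) × (S.ty y.ty ⟶ S.ctx Δ)) =>
        f ≫ (S.ctx Υ ◁ (g.1 ⊗ₘ g.2)) ≫ (α_ (S.ctx Υ) (S.ctx Γ) (S.ctx Δ)).inv ≫
          (S.join Υ Γ ▷ S.ctx Δ) ≫ S.join (Γ ++ Υ) Δ) h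
            (congrArg₂ Prod.mk h' h'')
  | @subI x y κ ζ M A Γ Δ d e ha ih ih' =>
    obtain ⟨d', h⟩ := ih
    obtain ⟨e', h'⟩ := ih'
    refine Derives.of_eq ⟨Deriv.subI (y := y.rename π) (κ := κ.rename π) (M := M.rename π) d' e'
      (ha.rename π), rfl⟩ ?_ ?_
    · change _ = ((κ.append (ζ.subst y (.app y M))).rename π).snoc _
      rw [Cx.rename_append, Cx.rename_subst]; rfl
    · exact congrArg₂ (fun f g => f ≫ (S.ctx Γ ◁ mkcHom (S.ty A) (S.ty y.ty)) ≫
        (S.ctx Γ ◁ (g ▷ S.ty (.sub A y.ty))) ≫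
        (α_ (S.ctx Γ) (S.ctx Δ) (S.ty (.sub A y.ty))).inv ≫
        (S.join Γ Δ ▷ S.ty (.sub A y.ty))) h h'
  | @subE x y κ ξ M N B Γ Δ d e ha ih ih' =>
    obtain ⟨d', h⟩ := ih
    obtain ⟨e', h'⟩ := ih'
    refine Derives.of_eq ⟨Deriv.subE (y := y.rename π) (κ := κ.rename π) (M := M.rename π)
      (ξ := ξ.rename π) (N := N.rename π) d' e' (ha.rename π), rfl⟩ ?_ ?_
    · rw [Cx.rename_addP, Cx.rename_append, Cx.rename_subst]; rfl
    · exact congrArg₂ (fun f g => f ≫ (S.ctx Γ ◁ postpHom g) ≫ S.join Γ Δ) h h'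
  | @botI x κ R Γ d hR ih =>
    obtain ⟨d', h⟩ := ih
    exact ⟨Deriv.botI (R := R.rename π) d' ((Cx.has_rename π).2 ⟨R, hR, rfl⟩),
      congrArg (· ≫ (ρ_ (S.ctx Γ)).inv) h⟩
  | botE n => exact ⟨.botE (π .bot n), rfl⟩

/-- Meant for a root fixed by a renaming: the types of the two roots agree by definition, while the
roots themselves are only propositionally equal. -/
theorem derives_root {x y : Var G} {κ : Cx G} {Γ : List (Ty G)} {f : S.ty x.ty ⟶ S.ctx Γ}
    {g : S.ty y.ty ⟶ S.ctx Γ} (h : S.Derives x κ Γ f) (hxy : x = y) (hfg : HEq f g) :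
    S.Derives y κ Γ g := by
  subst hxy
  rw [← eq_of_heq hfg]; exact h

theorem sound_rename {x : Var G} {κ : Cx G} {Γ : List (Ty G)} (π : Ty G → Equiv.Perm ℕ)
    (d : Deriv x κ Γ) (h : x.rename π = x) : S.Sound x κ (κ.rename π) Γ :=
  ⟨S.interp d, ⟨d, rfl⟩, derives_root (derives_rename π d) h HEq.rfl⟩

theorem Derives.unique {x : Var G} {κ : Cx G} {Γ : List (Ty G)} {f g : S.ty x.ty ⟶ S.ctx Γ}
    (h : S.Derives x κ Γ f) (h' : S.Derives x κ Γ g) : f = g := by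
  obtain ⟨d, rfl⟩ := h
  obtain ⟨d', rfl⟩ := h'
  exact coherence d d'

/-- Equations of the theory are sound. -/
theorem sound {x : Var G} {κ κ' : Cx G} {Γ : List (Ty G)} (h : EqCx x κ κ' Γ) :
    S.Sound x κ κ' Γ := by
  induction h with
  | refl d => exact ⟨_, ⟨d, rfl⟩, d, rfl⟩
  | symm _ ih => obtain ⟨f, h, h'⟩ := ih; exact ⟨f, h', h⟩
  | trans _ _ ih ih' =>
    obtain ⟨f, h₁, h₂⟩ := ih
    obtain ⟨g, h₃, h₄⟩ := ih'
    -- The middle term comes with two derivations, in general different ones; coherence identifies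
    -- their interpretations.
    obtain rfl := h₂.unique h₃
    exact ⟨f, h₁, h₄⟩
  | subst _ _ ha ha' ih ih' =>
    obtain ⟨f, h₁, h₂⟩ := ih
    obtain ⟨g, h₃, h₄⟩ := ih'
    exact ⟨_, h₁.cut h₃ ha, h₂.cut h₄ ha'⟩
  | exch n _ ih =>
    obtain ⟨f, ⟨d, hd⟩, ⟨d', hd'⟩⟩ := ih
    exact ⟨f ≫ S.swapHom n _, ⟨d.exch n, congrArg (· ≫ _) hd⟩, d'.exch n, congrArg (· ≫ _) hd'⟩
  | alpha π d h => exact sound_rename π d h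
  | par_beta d e f h₁ h₂ h₃ => exact sound_par_beta d e f h₁ h₂ h₃
  | par_eta d => exact sound_par_eta d
  | sub_beta d e f h₁ h₂ h₃ => exact sound_sub_beta d e f h₁ h₂ h₃
  | sub_eta d hxy hx hy => exact sound_sub_eta d hxy hx hy
  -- The interpretation of `⊥`-introduction does not involve the term that the link refers to.
  | rewire d h h' => exact ⟨_, ⟨d.botI h, rfl⟩, d.botI h', rfl⟩
  | rewire_late d d' h => exact sound_rewire_late d d' h
  | bot_beta d h => exact sound_bot_beta d h
  | bot_eta d => exact sound_bot_eta d

theorem Derives.denotes {x : Var G} {κ : Cx G} {Γ : List (Ty G)} {f : S.ty x.ty ⟶ S.ctx Γ}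
    (h : S.Derives x κ Γ f) : S.Denotes x κ Γ f := by
  obtain ⟨d, rfl⟩ := h
  exact ⟨⟨d⟩, fun d' => coherence d' d⟩

end Structure
end CoILL

theorem mainTheorem1 {G : Type*} {C : Type*} [Category C] [MonoidalCategory C]
    [SymmetricCategory C] [CoILL.LeftClosed C] (S : CoILL.Structure G C)
    {x : CoILL.Var G} {κ κ' : CoILL.Cx G} {Γ : List (CoILL.Ty G)}
    (h : CoILL.EqCx x κ κ' Γ) : S.Satisfies x κ κ' Γ := by
  obtain ⟨f, h₁, h₂⟩ := CoILL.Structure.sound (S := S) h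
  exact ⟨f, h₁.denotes, h₂.denotes⟩
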